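/- **Conventions.** Let $N\ge 2$, $d_1,\dots,d_N\ge 1$, $r_0=r_N=1$ and $r_1,\dots,r_{N-1}\ge 1$. For factors $X_i$ consisting of slices $X_i(s)\in\mathbb R^{r_{i-1}\times r_i}$, $s\in[d_i]$, let $[X_1,\dots,X_N]\in\mathbb R^{d_1\times\cdots\times d_N}$ be the TT format tensor with entries $X_1(s_1)X_2(s_2)\cdots X_N(s_N)$. Let $L(X_i)\in\mathbb R^{r_{i-1}d_i\times r_i}$ be the slices of $X_i$ stacked vertically and $R(X_i)\in\mathbb R^{r_{i-1}\times d_ir_i}$ the slices side by side. The factors are left-orthogonal if $L(X_i)^\top L(X_i)=I_{r_i}$ for $i\in[N-1]$, and minimal if $\operatorname{rank}L(X_i)=r_i$ and $\operatorname{rank}R(X_i)=r_{i-1}$ for all $i\in[N]$. Write $\overline r=\max_{1\le i\le N-1}r_i$, $\overline d=\max_i d_i$ and $S=N+1+\sum_{i=2}^{N-1}r_i$. Let $\mathcal X^\star=[X_1^\star,\dots,X_N^\star]$ with left-orthogonal, minimal factors $X_i^\star$, so that $r_1,\dots,r_{N-1}$ are the TT ranks of $\mathcal X^\star$, and let $\underline\sigma=\min_{1\le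 i\le N-1}\sigma_{r_i}\big((\mathcal X^\star)^{\langle i\rangle}\big)$, where $(\mathcal X^\star)^{\langle i\rangle}\in\mathbb R^{(d_1\cdots d_i)\times(d_{i+1}\cdots d_N)}$ is the $i$-th unfolding and $\sigma_k$ the $k$-th largest singular value. For factors $X=\{X_i\}$ of the same sizes put $$\operatorname{dist}^2(X,X^\star)=\min_{R_i\in O(r_i),\,i\in[N-1]}\ \sum_{i=1}^{N-1}\|\mathcal X^\star\|_F^2\,\|L(X_i)-L_R(X_i^\star)\|_F^2+\|L(X_N)-L_R(X_N^\star)\|_2^2,$$ where $L_R(X_i^\star)$ stacks the slices $R_{i-1}^\top X_i^\star(s)R_i$, with $R_0=R_N=1$. Given tensors $\mathcal A_1,\dots,\mathcal A_m$, let $\mathcal A(\mathcal X)=(\langle\mathcal A_k,\mathcal X\rangle)_{k=1}^m$. The map $\mathcal A$ satisfies the $\rho$-RIP with constant $\delta$ if $(1-\delta)\|\mathcal X\|_F^2\le\frac1m\|\mathcal A(\mathcal X)\|_2^2\le(1+\delta)\|\mathcal X\|_F^2$ for every $\mathcal X$ that has a TT format with all ranks at most $\rho$. Let $\widehat y=\mathcal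 A(\mathcal X^\star)+\epsilon$ with $\epsilon\sim\mathcal N(0,\gamma^2I_m)$, and $G(X)=\frac1{2m}\|\mathcal A([X_1,\dots,X_N])-\widehat y\|_2^2$. Riemannian gradient descent (RGD) with step size $\mu>0$, started at left-orthogonal factors $X^{(0)}$, is the simultaneous update $$L(X_i^{(t+1)})=\operatorname{Retr}\Big(L(X_i^{(t)})-\tfrac{\mu}{\|\mathcal X^\star\|_F^2}\,\mathcal P_{L(X_i^{(t)})}\big(\nabla_{L(X_i)}G(X^{(t)})\big)\Big)\quad(i\in[N-1]),$$ $$L(X_N^{(t+1)})=L(X_N^{(t)})-\mu\nabla_{L(X_N)}G(X^{(t)}),$$ with $\mathcal P_Y(B)=B-\frac12Y(B^\top Y+Y^\top B)$ and $\operatorname{Retr}(Y)=Y(Y^\top Y)^{-1/2}$. **Theorem.** There are universal constants $c,C,K>0$ such that the following holds for all data as above. Assume that $\mathcal A$ satisfies the $(N+3)\overline r$-RIP with a constant $\delta\le\frac7{30}$ and that $$m\ \ge\ C\,\frac{N^4\,\overline d\,\overline r^3(\log N)\gamma^2}{\underline\sigma^2}.$$ Then, with probability at least $1-2Ne^{-cN\overline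 d\,\overline r^2\log N}-2e^{-cN^3\overline d\,\overline r^2\log N}$ over $\epsilon$, for all left-orthogonal initial factors $X^{(0)}$ with $$\operatorname{dist}^2(X^{(0)},X^\star)\le\frac{(7-30\delta)\,\underline\sigma^2}{8S\,(129N^2+7231N-7360)},$$ all step sizes $0<\mu\le\dfrac{7-30\delta}{20(9N-5)(1+\delta)^2}$ and all $t\ge0$, the RGD iterates satisfy $$\operatorname{dist}^2(X^{(t+1)},X^\star)\le\Big(1-\frac{(7-30\delta)\,\underline\sigma^2}{1280\,S\,\|\mathcal X^\star\|_F^2}\,\mu\Big)^{t+1}\operatorname{dist}^2(X^{(0)},X^\star)+K\,\frac{(N+\mu)\,S\,(1+\delta)\,N^2\,\overline d\,\overline r^2(\log N)\,\|\mathcal X^\star\|_F^2\,\gamma^2}{m\,(7-30\delta)\,\underline\sigma^2}.$$ -/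

import Mathlib

open scoped BigOperators Matrix NNReal

noncomputable section

namespace TT

/-- Real tensors of order `N` and size `d 0 × ⋯ × d (N - 1)`, as arrays of entries. -/
abbrev Tensor {N : ℕ} (d : Fin N → ℕ) : Type := ((i : Fin N) → Fin (d i)) → ℝ

/-- The entrywise inner product of two tensors. -/
def inner {N : ℕ} {d : Fin N → ℕ} (S T : Tensor d) : ℝ := ∑ s, S s * T s

/-- The squared Frobenius norm of a tensor. -/
def normSq {N : ℕ} {d : Fin N → ℕ} (T : Tensor d) : ℝ := ∑ s, T s ^ 2

/-- The squared Frobenius norm of a matrix. -/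
def frobSq {p q : Type*} [Fintype p] [Fintype q] (M : Matrix p q ℝ) : ℝ :=
  ∑ a, ∑ b, M a b ^ 2

/-- Tensor-train factors. The factor number `i` (counted from `0`) consists of `d i` slices, which
are matrices of size `r i × r (i + 1)`. The sizes `r 0` and `r N` of the two ends are to be `1`. -/
abbrev Factors {N : ℕ} (d : Fin N → ℕ) (r : Fin (N + 1) → ℕ) : Type :=
  (i : Fin N) → Fin (d i) → Matrix (Fin (r i.castSucc)) (Fin (r i.succ)) ℝ

variable {N : ℕ} {d : Fin N → ℕ} {r : Fin (N + 1) → ℕ}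

/-- The product of the first `k` selected slices, `X_1(s_1) X_2(s_2) ⋯ X_k(s_k)`. -/
def partialProd (X : Factors d r) (s : (i : Fin N) → Fin (d i)) (k : Fin (N + 1)) :
    Matrix (Fin (r 0)) (Fin (r k)) ℝ :=
  Fin.induction (motive := fun k => Matrix (Fin (r 0)) (Fin (r k)) ℝ) 1
    (fun i M => M * X i (s i)) k

/-- The tensor `[X_1, …, X_N]` with entries `X_1(s_1) X_2(s_2) ⋯ X_N(s_N)`. For `r 0 = r N = 1` this
product is a `1 × 1` matrix, and the sum below is its single entry. -/
def tensor (X : Factors d r) : Tensor d :=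
  fun s => ∑ a, ∑ b, partialProd X s (Fin.last N) a b

/-- The left unfolding of a factor: its slices stacked on top of each other. -/
def leftUnfold {e a b : ℕ} (Y : Fin e → Matrix (Fin a) (Fin b) ℝ) :
    Matrix (Fin e × Fin a) (Fin b) ℝ :=
  Matrix.of fun p j => Y p.1 p.2 j

/-- The factor with a given left unfolding. -/
def leftFold {e a b : ℕ} (M : Matrix (Fin e × Fin a) (Fin b) ℝ) :
    Fin e → Matrix (Fin a) (Fin b) ℝ :=
  fun s => Matrix.of fun i j => M (s, i) j

/-- The right unfolding of a factor: its slices written side by side. -/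
def rightUnfold {e a b : ℕ} (Y : Fin e → Matrix (Fin a) (Fin b) ℝ) :
    Matrix (Fin a) (Fin e × Fin b) ℝ :=
  Matrix.of fun i p => Y p.1 i p.2

/-- Left-orthogonal form: the left unfoldings of all factors but the last one have orthonormal
columns. -/
def LeftOrthogonal (X : Factors d r) : Prop :=
  ∀ i : Fin N, (i : ℕ) + 1 < N → (leftUnfold (X i))ᵀ * leftUnfold (X i) = 1

/-- Minimality of a tensor-train decomposition: all left and right unfoldings have full rank, the
rank being the size of the bond. The bond sizes are then the TT ranks of the tensor. -/
def Minimal (X : Factors d r) : Prop :=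
  ∀ i : Fin N, (leftUnfold (X i)).rank = r i.succ ∧ (rightUnfold (X i)).rank = r i.castSucc

/-- The inner bonds `1, …, N - 1`. -/
def innerBonds (N : ℕ) : Finset (Fin (N + 1)) :=
  Finset.univ.filter fun i => 1 ≤ (i : ℕ) ∧ (i : ℕ) < N

/-- The largest TT rank, `max_{1 ≤ i ≤ N - 1} r_i`. -/
def maxRank (r : Fin (N + 1) → ℕ) : ℕ := (innerBonds N).sup r

/-- The largest dimension, `max_i d_i`. -/
def maxDim (d : Fin N → ℕ) : ℕ := Finset.univ.sup d

/-- The number `N + 1 + ∑_{i = 2}^{N - 1} r_i`. -/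
def rankSum (r : Fin (N + 1) → ℕ) : ℝ :=
  (N : ℝ) + 1 + ∑ i ∈ (innerBonds N).filter (fun i : Fin (N + 1) => 2 ≤ (i : ℕ)), (r i : ℝ)

/-- The `k`-th unfolding matrix of a tensor: the first `k` indices number the rows, the others the
columns. -/
def unfolding (T : Tensor d) (k : ℕ) :
    Matrix ((j : {j : Fin N // (j : ℕ) < k}) → Fin (d j))
      ((j : {j : Fin N // ¬ (j : ℕ) < k}) → Fin (d j)) ℝ :=
  Matrix.of fun a b =>
    T ((Equiv.piEquivPiSubtypeProd (fun j : Fin N => (j : ℕ) < k) (fun j => Fin (d j))).symm (a, b))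

/-- `min_{1 ≤ i ≤ N - 1} σ_{r_i}(T^{⟨i⟩})`; Mathlib counts singular values from `0`. -/
def sigmaMin (r : Fin (N + 1) → ℕ) (T : Tensor d) : ℝ :=
  ⨅ i : {i : Fin (N + 1) // i ∈ innerBonds N},
    (Matrix.toEuclideanLin (unfolding T (i : Fin (N + 1)))).singularValues (r i - 1)

/-- Families of orthogonal matrices `R_0, …, R_N` with `R_0 = 1` and `R_N = 1`. -/
abbrev Rotations (r : Fin (N + 1) → ℕ) : Type :=
  {R : (i : Fin (N + 1)) → Matrix.orthogonalGroup (Fin (r i)) ℝ // R 0 = 1 ∧ R (Fin.last N) = 1}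

/-- The rotated factors, with slices `R_{i-1}ᵀ X_i(s) R_i`. -/
def rotate (R : Rotations r) (X : Factors d r) : Factors d r :=
  fun i s => (R.1 i.castSucc : Matrix (Fin (r i.castSucc)) (Fin (r i.castSucc)) ℝ)ᵀ * X i s *
    (R.1 i.succ : Matrix (Fin (r i.succ)) (Fin (r i.succ)) ℝ)

/-- The squared distance between the factors `X` and the reference factors `Xs`. -/
def distSq (X Xs : Factors d r) : ℝ :=
  ⨅ R : Rotations r, ∑ i : Fin N,
    (if (i : ℕ) + 1 < N then normSq (tensor Xs) else 1) *
      frobSq (leftUnfold (X i) - leftUnfold (rotate R Xs i))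

/-- The restricted isometry property of order `ρ` with constant `δ` of the linear map
`T ↦ (⟨A_k, T⟩)_k`: it holds for all tensors in TT format whose TT ranks are at most `ρ`. -/
def RIP {m : ℕ} (A : Fin m → Tensor d) (ρ : ℕ) (δ : ℝ) : Prop :=
  ∀ q : Fin (N + 1) → ℕ, q 0 = 1 → q (Fin.last N) = 1 → (∀ i ∈ innerBonds N, q i ≤ ρ) →
    ∀ X : Factors d q,
      (1 - δ) * normSq (tensor X) ≤ 1 / (m : ℝ) * ∑ k, inner (A k) (tensor X) ^ 2 ∧
      1 / (m : ℝ) * ∑ k, inner (A k) (tensor X) ^ 2 ≤ (1 + δ) * normSq (tensor X)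

/-- The loss `(1 / 2m) ‖A([X_1, …, X_N]) - y‖²`. -/
def loss {m : ℕ} (A : Fin m → Tensor d) (y : Fin m → ℝ) (X : Factors d r) : ℝ :=
  1 / (2 * (m : ℝ)) * ∑ k, (inner (A k) (tensor X) - y k) ^ 2

/-- The gradient of `F` with respect to the left unfolding of factor `i`: the matrix of the partial
derivatives of `F` in the entries of that unfolding. -/
def leftGrad (F : Factors d r → ℝ) (X : Factors d r) (i : Fin N) :
    Matrix (Fin (d i) × Fin (r i.castSucc)) (Fin (r i.succ)) ℝ :=
  Matrix.of fun p b => deriv (fun τ : ℝ =>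
    F (Function.update X i (leftFold (leftUnfold (X i) + τ • Matrix.single p b (1 : ℝ))))) 0

/-- The orthogonal projection of `B` onto the tangent space of the Stiefel manifold at `Y`. -/
def tangentProj {p q : Type*} [Fintype p] [Fintype q] (Y B : Matrix p q ℝ) : Matrix p q ℝ :=
  B - (1 / 2 : ℝ) • (Y * (Bᵀ * Y + Yᵀ * B))

/-- The polar retraction `Y (Yᵀ Y)^{-1/2}`. -/
def polarRetr {p q : Type*} [Fintype p] [Fintype q] [DecidableEq q] (Y : Matrix p q ℝ) :
    Matrix p q ℝ :=
  Y * cfc (fun x : ℝ => (√x)⁻¹) (Yᵀ * Y)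

/-- One step of Riemannian gradient descent for `F` with step size `μ`, where `w` is the factor by
which the step size is divided on the orthonormal factors. All factors are updated at once. -/
def rgdStep (F : Factors d r → ℝ) (w μ : ℝ) (X : Factors d r) : Factors d r :=
  fun i =>
    if (i : ℕ) + 1 < N then
      leftFold (polarRetr
        (leftUnfold (X i) - (μ / w) • tangentProj (leftUnfold (X i)) (leftGrad F X i)))
    else leftFold (leftUnfold (X i) - μ • leftGrad F X i)

/-- The iterates of Riemannian gradient descent started at `X₀`. -/
def rgd (F : Factors d r → ℝ) (w μ : ℝ) (X₀ : Factors d r) : ℕ → Factors d r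
  | 0 => X₀
  | t + 1 => rgdStep F w μ (rgd F w μ X₀ t)

end TT

end

/-! The proof separates a deterministic statement about gradient descent from a probabilistic bound
for the noise. The interface is `Regular`: on all sums of $N+3$ TT tensors of the given sizes,
$\frac1m\|\mathcal A(\cdot)\|^2$ lies within $1\pm\delta$ of the squared norm, and the noise form
$\frac1m\langle\epsilon,\mathcal A(\cdot)\rangle$ is at most $\zeta$ times the norm.

Let $e$ be the norm of the error tensor and $M=\|\mathcal X^\star\|_F$. Error of the tensor controls
error of the factors (`distSq_le`: $\underline\sigma^2\operatorname{dist}^2\le4SM^2e^2$): at each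
inner bond the orthonormal prefix frames can be rotated onto each other up to an error of order
$e/\underline\sigma$, and two consecutive frames determine the factor between them. In return, the
tensor is multilinear, so linearising it in the factors costs only a quadratic term
(`tnorm_sum_testDir_sub_le`), which is at most $e/4$ inside the admissible ball.

If $e>20\zeta$, the gradient correlates with the deviation of the factors. The polar retraction of a
tangent step does not increase distances to the Stiefel manifold (`polarRetr_tangent`), so a step
lowers $\operatorname{dist}^2$ by at least $\frac{23}{30}\mu e^2$ (`Regular.distSq_rgdStep_le`). By
`distSq_le` this is a linear contraction.

If $e\le20\zeta$, the noise may dominate and the distance need not decrease, so the loss takes over.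
Its sublevel set at height $270\zeta^2$ (up to a constant) contains the errors of norm at most
$20\zeta$ and only errors of norm at most $30\zeta$, and a step from it does not increase the loss
(`Regular.potential_rgdStep_le`). An iterate that has entered this set stays there, and `distSq_le`
turns $30\zeta$ into the statistical error. `Regular.distSq_rgd_le` runs this dichotomy by
induction, without accumulating any error term.

The noise level comes from a union bound over a net (`exists_event_noise_le_tnorm`): every TT tensor
is its norm times one with contractive factors (`exists_contraction_tensor`), and a linear form on
such tensors is controlled by its values on a net of the factors (`abs_le_two_mul_of_net`). The
assumption on $m$ makes $\zeta\le\underline\sigma/600$. -/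

set_option linter.unusedSectionVars false

noncomputable section

namespace TT

/-! ### Frobenius inner product and operator bounds. -/

section MatrixTools

variable {p q l : Type*} [Fintype p] [Fintype q] [Fintype l]

/-- The Frobenius inner product of two matrices. -/
def fdot (A B : Matrix p q ℝ) : ℝ := ∑ a, ∑ b, A a b * B a b

lemma fdot_eq_trace (A B : Matrix p q ℝ) : fdot A B = (Aᵀ * B).trace := by
  simp only [fdot, Matrix.trace, Matrix.diag, Matrix.mul_apply, Matrix.transpose_apply]
  exact Finset.sum_comm

lemma frobSq_eq_fdot (A : Matrix p q ℝ) : frobSq A = fdot A A := by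
  simp [frobSq, fdot, sq]

lemma fdot_comm (A B : Matrix p q ℝ) : fdot A B = fdot B A := by
  simp [fdot, mul_comm]

lemma fdot_add_right (A B C : Matrix p q ℝ) : fdot A (B + C) = fdot A B + fdot A C := by
  simp [fdot, mul_add, Finset.sum_add_distrib]

lemma fdot_sub_right (A B C : Matrix p q ℝ) : fdot A (B - C) = fdot A B - fdot A C := by
  simp [fdot, mul_sub, Finset.sum_sub_distrib]

lemma fdot_smul_right (c : ℝ) (A B : Matrix p q ℝ) : fdot A (c • B) = c * fdot A B := by
  simp [fdot, Finset.mul_sum, mul_left_comm]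

lemma fdot_add_left (A B C : Matrix p q ℝ) : fdot (A + B) C = fdot A C + fdot B C := by
  simp [fdot, add_mul, Finset.sum_add_distrib]

lemma fdot_sub_left (A B C : Matrix p q ℝ) : fdot (A - B) C = fdot A C - fdot B C := by
  simp [fdot, sub_mul, Finset.sum_sub_distrib]

lemma fdot_smul_left (c : ℝ) (A B : Matrix p q ℝ) : fdot (c • A) B = c * fdot A B := by
  simp [fdot, Finset.mul_sum, mul_assoc]

lemma fdot_mul_left (A : Matrix p l ℝ) (B : Matrix l q ℝ) (C : Matrix p q ℝ) :
    fdot (A * B) C = fdot B (Aᵀ * C) := by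
  simp [fdot_eq_trace, Matrix.transpose_mul, Matrix.mul_assoc]

lemma fdot_mul_right (A : Matrix p l ℝ) (B : Matrix l q ℝ) (C : Matrix p q ℝ) :
    fdot (A * B) C = fdot A (C * Bᵀ) := by
  rw [fdot_eq_trace, fdot_eq_trace, Matrix.transpose_mul, Matrix.mul_assoc, Matrix.trace_mul_comm,
    Matrix.mul_assoc]

lemma fdot_transpose (A B : Matrix p q ℝ) : fdot Aᵀ Bᵀ = fdot A B := by
  simp only [fdot, Matrix.transpose_apply]
  exact Finset.sum_comm

lemma frobSq_transpose (A : Matrix p q ℝ) : frobSq Aᵀ = frobSq A := by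
  rw [frobSq_eq_fdot, frobSq_eq_fdot, fdot_transpose]

lemma frobSq_nonneg (A : Matrix p q ℝ) : 0 ≤ frobSq A :=
  Finset.sum_nonneg fun _ _ => Finset.sum_nonneg fun _ _ => sq_nonneg _

lemma frobSq_zero : frobSq (0 : Matrix p q ℝ) = 0 := by simp [frobSq]

lemma frobSq_neg (A : Matrix p q ℝ) : frobSq (-A) = frobSq A := by simp [frobSq]

lemma frobSq_smul (c : ℝ) (A : Matrix p q ℝ) : frobSq (c • A) = c ^ 2 * frobSq A := by
  simp [frobSq, mul_pow, Finset.mul_sum]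

lemma frobSq_sub_comm (A B : Matrix p q ℝ) : frobSq (A - B) = frobSq (B - A) := by
  rw [← frobSq_neg, neg_sub]

lemma frobSq_add (A B : Matrix p q ℝ) :
    frobSq (A + B) = frobSq A + 2 * fdot A B + frobSq B := by
  simp only [frobSq_eq_fdot, fdot_add_left, fdot_add_right, fdot_comm B A]; ring

lemma frobSq_sub (A B : Matrix p q ℝ) :
    frobSq (A - B) = frobSq A - 2 * fdot A B + frobSq B := by
  simp only [frobSq_eq_fdot, fdot_sub_left, fdot_sub_right, fdot_comm B A]; ring

lemma frobSq_add_le (A B : Matrix p q ℝ) : frobSq (A + B) ≤ 2 * frobSq A + 2 * frobSq B := by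
  have := frobSq_nonneg (A - B)
  rw [frobSq_sub] at this
  rw [frobSq_add]; linarith

lemma frobSq_sub_le (A B : Matrix p q ℝ) : frobSq (A - B) ≤ 2 * frobSq A + 2 * frobSq B := by
  have := frobSq_add_le A (-B)
  rwa [frobSq_neg, ← sub_eq_add_neg] at this

lemma fdot_sq_le (A B : Matrix p q ℝ) : fdot A B ^ 2 ≤ frobSq A * frobSq B := by
  have := Finset.sum_mul_sq_le_sq_mul_sq (Finset.univ : Finset (p × q))
    (fun x => A x.1 x.2) (fun x => B x.1 x.2)
  simpa only [Fintype.sum_prod_type, fdot, frobSq] using this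

lemma fdot_le (A B : Matrix p q ℝ) : |fdot A B| ≤ √(frobSq A) * √(frobSq B) := by
  rw [← Real.sqrt_mul (frobSq_nonneg A)]
  exact Real.abs_le_sqrt (fdot_sq_le A B)

/-- `c` bounds the operator norm of `A`. -/
def OpBound (A : Matrix p q ℝ) (c : ℝ) : Prop :=
  ∀ v : q → ℝ, (A *ᵥ v) ⬝ᵥ (A *ᵥ v) ≤ c ^ 2 * (v ⬝ᵥ v)

lemma frobSq_mul_le (A : Matrix p q ℝ) (B : Matrix q l ℝ) :
    frobSq (A * B) ≤ frobSq A * frobSq B := by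
  have key : ∀ a b, (A * B) a b ^ 2 ≤ (∑ c, A a c ^ 2) * ∑ c, B c b ^ 2 := fun a b =>
    Finset.sum_mul_sq_le_sq_mul_sq _ _ _
  calc frobSq (A * B) ≤ ∑ a, ∑ b, (∑ c, A a c ^ 2) * ∑ c, B c b ^ 2 :=
        Finset.sum_le_sum fun a _ => Finset.sum_le_sum fun b _ => key a b
    _ = frobSq A * ∑ b, ∑ c, B c b ^ 2 := by simp_rw [← Finset.mul_sum, ← Finset.sum_mul]; rfl
    _ = frobSq A * frobSq B := by rw [Finset.sum_comm]; rfl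

lemma opBound_sqrt_frobSq (A : Matrix p q ℝ) : OpBound A (√(frobSq A)) := by
  intro v
  rw [Real.sq_sqrt (frobSq_nonneg A)]
  have := frobSq_mul_le A (Matrix.of fun a (_ : Unit) => v a)
  simpa [frobSq, dotProduct, sq, Matrix.mul_apply, Matrix.mulVec] using this

lemma mulVec_dot_self (A : Matrix p q ℝ) (v : q → ℝ) :
    (A *ᵥ v) ⬝ᵥ (A *ᵥ v) = v ⬝ᵥ ((Aᵀ * A) *ᵥ v) := by
  rw [← Matrix.mulVec_mulVec, Matrix.dotProduct_mulVec, Matrix.mulVec_transpose,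
    dotProduct_comm v]

lemma opBound_one_of_isometry [DecidableEq q] {A : Matrix p q ℝ} (h : Aᵀ * A = 1) :
    OpBound A 1 := fun v => by
  rw [mulVec_dot_self, h]; simp

lemma frobSq_isometry_mul [DecidableEq q] {A : Matrix p q ℝ} (h : Aᵀ * A = 1)
    (B : Matrix q l ℝ) : frobSq (A * B) = frobSq B := by
  rw [frobSq_eq_fdot, fdot_mul_left, ← Matrix.mul_assoc, h, Matrix.one_mul, frobSq_eq_fdot]

lemma frobSq_of_isometry [DecidableEq q] {A : Matrix p q ℝ} (h : Aᵀ * A = 1) :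
    frobSq A = Fintype.card q := by
  rw [frobSq_eq_fdot, fdot_eq_trace, h, Matrix.trace_one]

end MatrixTools

/-! ### The polar decomposition and the polar retraction. -/

section Polar

variable {p q : Type*} [Fintype p] [Fintype q] [DecidableEq q]

/-- The spectrum of a matrix is finite, so every function is continuous on it. The functional
calculus thus accepts $(\sqrt x)^{-1}$ and indicator functions although they jump at $0$. -/
lemma continuousOn_spectrum (S : Matrix q q ℝ) (f : ℝ → ℝ) : ContinuousOn f (spectrum ℝ S) :=
  (Matrix.finite_real_spectrum (A := S)).continuousOn f

lemma gram_isSelfAdjoint (Y : Matrix p q ℝ) : IsSelfAdjoint (Yᵀ * Y) := by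
  have := Matrix.isHermitian_conjTranspose_mul_self Y
  rwa [Matrix.conjTranspose_eq_transpose_of_trivial] at this

lemma gram_isHermitian (Y : Matrix p q ℝ) : (Yᵀ * Y).IsHermitian := gram_isSelfAdjoint Y

lemma gram_spectrum_nonneg (Y : Matrix p q ℝ) {x : ℝ} (hx : x ∈ spectrum ℝ (Yᵀ * Y)) : 0 ≤ x := by
  have h := Matrix.posSemidef_conjTranspose_mul_self Y
  rw [Matrix.conjTranspose_eq_transpose_of_trivial] at h
  rw [h.1.spectrum_real_eq_range_eigenvalues] at hx
  obtain ⟨i, rfl⟩ := hx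
  exact h.eigenvalues_nonneg i

lemma cfc_transpose (S : Matrix q q ℝ) (f : ℝ → ℝ) : (cfc f S)ᵀ = cfc f S := by
  have : IsSelfAdjoint (cfc f S) := cfc_predicate f S
  rw [← Matrix.conjTranspose_eq_transpose_of_trivial]; exact this

lemma cfc_mul_cfc (S : Matrix q q ℝ) (f g : ℝ → ℝ) :
    cfc f S * cfc g S = cfc (fun x => f x * g x) S :=
  (cfc_mul f g S (continuousOn_spectrum S f) (continuousOn_spectrum S g)).symm

lemma cfc_gram (Y : Matrix p q ℝ) : cfc (fun x : ℝ => x) (Yᵀ * Y) = Yᵀ * Y :=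
  cfc_id' ℝ _ (gram_isSelfAdjoint Y)

/-- `Y f(YᵀY)` has Gram matrix `f(YᵀY) YᵀY f(YᵀY)`. -/
lemma gram_mul_cfc (Y : Matrix p q ℝ) (f : ℝ → ℝ) :
    (Y * cfc f (Yᵀ * Y))ᵀ * (Y * cfc f (Yᵀ * Y)) = cfc (fun x => f x * x * f x) (Yᵀ * Y) := by
  rw [Matrix.transpose_mul, cfc_transpose, Matrix.mul_assoc, ← Matrix.mul_assoc Yᵀ,
    ← Matrix.mul_assoc]
  conv_lhs => enter [1, 2]; rw [← cfc_gram Y]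
  rw [cfc_mul_cfc, cfc_mul_cfc]

lemma cfc_congr_gram (Y : Matrix p q ℝ) {f g : ℝ → ℝ} (h : ∀ x, 0 ≤ x → f x = g x) :
    cfc f (Yᵀ * Y) = cfc g (Yᵀ * Y) :=
  cfc_congr fun _ hx => h _ (gram_spectrum_nonneg Y hx)

lemma eq_zero_of_gram_eq_zero {Y : Matrix p q ℝ} (h : Yᵀ * Y = 0) : Y = 0 := by
  rw [← Matrix.conjTranspose_eq_transpose_of_trivial] at h
  exact Matrix.conjTranspose_mul_self_eq_zero.1 h

lemma sqrt_inv_mul_aux {x : ℝ} (hx : 0 ≤ x) : (√x)⁻¹ * x * (√x)⁻¹ = if x = 0 then 0 else 1 := by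
  split_ifs with h
  · simp [h]
  · have h' : √x ≠ 0 := (Real.sqrt_ne_zero hx).2 h
    field_simp
    exact (Real.sq_sqrt hx).symm

/-- The polar decomposition. -/
lemma polarRetr_mul_sqrt (Y : Matrix p q ℝ) :
    polarRetr Y * cfc (fun x : ℝ => √x) (Yᵀ * Y) = Y := by
  rw [polarRetr, Matrix.mul_assoc, cfc_mul_cfc]
  rw [← sub_eq_zero]
  apply eq_zero_of_gram_eq_zero
  have h1 : Y * cfc (fun x : ℝ => (√x)⁻¹ * √x) (Yᵀ * Y) - Y =
      Y * cfc (fun x : ℝ => (√x)⁻¹ * √x - 1) (Yᵀ * Y) := by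
    rw [cfc_sub _ _ _ (continuousOn_spectrum _ _) (continuousOn_spectrum _ _), Matrix.mul_sub,
      cfc_const_one ℝ _ (gram_isSelfAdjoint Y), Matrix.mul_one]
  rw [h1, gram_mul_cfc, cfc_congr_gram Y (g := fun _ => 0), cfc_const_zero]
  intro x hx
  by_cases h : x = 0
  · simp [h]
  · have h' : √x ≠ 0 := (Real.sqrt_ne_zero hx).2 h
    simp [h']

lemma sqrt_gram_transpose_mul_self (Y : Matrix p q ℝ) :
    (cfc (fun x : ℝ => √x) (Yᵀ * Y))ᵀ * cfc (fun x : ℝ => √x) (Yᵀ * Y) = Yᵀ * Y := by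
  rw [cfc_transpose, cfc_mul_cfc, cfc_congr_gram Y (g := fun x => x), cfc_gram]
  exact fun x hx => Real.mul_self_sqrt hx

/-- Because $(\sqrt0)^{-1}=0$, the Gram matrix of the polar factor is a symmetric idempotent $E$
even if $Y$ is not injective, and $\langle v,Ev\rangle=\|Ev\|^2\le\|v\|^2$. -/
lemma opBound_polarRetr (Y : Matrix p q ℝ) : OpBound (polarRetr Y) 1 := by
  set E := cfc (fun x : ℝ => if x = 0 then (0 : ℝ) else 1) (Yᵀ * Y) with hE
  have h1 : (polarRetr Y)ᵀ * polarRetr Y = E := by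
    rw [polarRetr, gram_mul_cfc]
    exact cfc_congr_gram Y fun x hx => sqrt_inv_mul_aux hx
  have h2 : E * E = E := by rw [hE, cfc_mul_cfc]; congr 1; ext x; split_ifs <;> simp
  have h3 : Eᵀ = E := cfc_transpose _ _
  intro v
  rw [mulVec_dot_self, h1]
  have h4 := mulVec_dot_self E v
  rw [h3, h2] at h4
  have h5 : 0 ≤ (v - E *ᵥ v) ⬝ᵥ (v - E *ᵥ v) := by
    simp only [dotProduct]; exact Finset.sum_nonneg fun _ _ => mul_self_nonneg _
  rw [sub_dotProduct, dotProduct_sub, dotProduct_sub, h4, dotProduct_comm (E *ᵥ v) v] at h5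
  linarith

lemma one_le_of_mem_spectrum {V : Matrix p q ℝ} {x : ℝ} (hx : x ∈ spectrum ℝ (1 + Vᵀ * V)) :
    1 ≤ x := by
  have h : (1 : Matrix q q ℝ) = algebraMap ℝ _ 1 := by simp
  rw [h, ← spectrum.singleton_add_eq] at hx
  obtain ⟨a, ha, b, hb, rfl⟩ := Set.mem_add.1 hx
  rw [Set.mem_singleton_iff] at ha
  have := gram_spectrum_nonneg V hb
  linarith

/-- The polar retraction from a tangent vector is the projection to the Stiefel manifold, and it
does not increase distances to the manifold. -/
lemma polarRetr_tangent {Y V : Matrix p q ℝ} (hY : Yᵀ * Y = 1) (hV : Yᵀ * V + Vᵀ * Y = 0) :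
    (polarRetr (Y + V))ᵀ * polarRetr (Y + V) = 1 ∧
    ∀ Q : Matrix p q ℝ, Qᵀ * Q = 1 →
      frobSq (polarRetr (Y + V) - Q) + frobSq (Y + V - polarRetr (Y + V)) ≤
        frobSq (Y + V - Q) := by
  set Z := Y + V with hZ
  -- Tangency cancels the cross terms, so the spectrum lies in $[1,\infty)$ and $\sqrt{\sqrt x-1}$
  -- below is a true square root of $\sqrt x-1$.
  have hS : Zᵀ * Z = 1 + Vᵀ * V := by
    rw [hZ, Matrix.transpose_add, Matrix.add_mul, Matrix.mul_add, Matrix.mul_add, hY]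
    rw [show ∀ a b c e : Matrix q q ℝ, a + b + (c + e) = a + ((b + c) + e) from fun _ _ _ _ => by abel, hV, zero_add]
  have hspec : ∀ x ∈ spectrum ℝ (Zᵀ * Z), 1 ≤ x := fun x hx => by
    rw [hS] at hx; exact one_le_of_mem_spectrum hx
  set U := polarRetr Z with hU
  have hUU : Uᵀ * U = 1 := by
    rw [hU, polarRetr, gram_mul_cfc, ← cfc_const_one ℝ (Zᵀ * Z) (gram_isSelfAdjoint Z)]
    refine cfc_congr fun x hx => ?_
    have := hspec x hx
    simp only [sqrt_inv_mul_aux (by linarith : 0 ≤ x), if_neg (by linarith : x ≠ 0)]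
  refine ⟨hUU, fun Q hQ => ?_⟩
  set B := cfc (fun x : ℝ => √(√x - 1)) (Zᵀ * Z) with hB
  have hBt : Bᵀ = B := cfc_transpose _ _
  have hUB : Z - U = U * (B * B) := by
    have : B * B = cfc (fun x : ℝ => √x) (Zᵀ * Z) - 1 := by
      rw [hB, cfc_mul_cfc, ← cfc_const_one ℝ (Zᵀ * Z) (gram_isSelfAdjoint Z),
        ← cfc_sub _ _ _ (continuousOn_spectrum _ _) (continuousOn_spectrum _ _)]
      refine cfc_congr fun x hx => ?_
      have h1 := hspec x hx
      have : 1 ≤ √x := Real.one_le_sqrt.2 h1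
      exact Real.mul_self_sqrt (by linarith)
    rw [this, Matrix.mul_sub, Matrix.mul_one, hU, polarRetr_mul_sqrt]
  have hsym : fdot (B * B) (Qᵀ * U) = fdot (B * B) (Uᵀ * Q) := by
    rw [← fdot_transpose, Matrix.transpose_mul, Matrix.transpose_mul, Matrix.transpose_transpose,
      hBt]
  -- The obtuse-angle property of a projection: the inner product of $Z-U$ and $U-Q$ is half a
  -- squared norm, hence nonnegative.
  have h1 : frobSq ((U - Q) * B) = 2 * fdot (Z - U) (U - Q) := by
    have h3 : fdot (U * (B * B)) (U - Q) = fdot (B * B) 1 - fdot (B * B) (Uᵀ * Q) := by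
      rw [fdot_mul_left, Matrix.mul_sub, hUU, fdot_sub_right]
    have h4 : (U - Q)ᵀ * (U - Q) = 1 + 1 - Uᵀ * Q - Qᵀ * U := by
      rw [Matrix.transpose_sub, Matrix.sub_mul, Matrix.mul_sub, Matrix.mul_sub, hUU, hQ]; abel
    rw [hUB, h3, frobSq_eq_fdot, fdot_mul_right, hBt, Matrix.mul_assoc, fdot_comm, fdot_mul_left,
      h4, fdot_sub_right, fdot_sub_right, fdot_add_right, hsym]
    ring
  have h2 : Z - Q = (Z - U) + (U - Q) := by abel
  rw [h2, frobSq_add (Z - U)]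
  have := frobSq_nonneg ((U - Q) * B)
  linarith

end Polar

end TT
end

noncomputable section

namespace TT

/-! ### Alignment of orthonormal frames. -/

section Procrustes

variable {p q l : Type*} [Fintype p] [Fintype q] [Fintype l] [DecidableEq q]

/-- A matrix of operator norm at most one has an orthogonal matrix whose inner product with it is at
least its squared Frobenius norm. -/
lemma exists_orthogonal_frobSq_le_fdot {C : Matrix q q ℝ} (hC : OpBound C 1) :
    ∃ R : Matrix.orthogonalGroup q ℝ, frobSq C ≤ fdot (R : Matrix q q ℝ) C := by
  have hS := gram_isHermitian C
  set V : Matrix q q ℝ := (hS.eigenvectorUnitary : Matrix q q ℝ) with hV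
  have hVV : Vᵀ * V = 1 := by
    have := Unitary.coe_star_mul_self hS.eigenvectorUnitary
    rwa [Matrix.star_eq_conjTranspose, Matrix.conjTranspose_eq_transpose_of_trivial] at this
  have hVV' : V * Vᵀ = 1 := mul_eq_one_comm.1 hVV
  set ev := hS.eigenvalues with hev
  set D : Matrix q q ℝ := C * V with hD
  have hDD : Dᵀ * D = Matrix.diagonal ev := by
    have h := hS.spectral_theorem
    rw [Unitary.conjStarAlgAut_apply, Matrix.star_eq_conjTranspose,
      Matrix.conjTranspose_eq_transpose_of_trivial] at h
    rw [hD, Matrix.transpose_mul, Matrix.mul_assoc, ← Matrix.mul_assoc Cᵀ, h, ← hV]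
    simp only [← Matrix.mul_assoc, hVV, Matrix.one_mul]
    rw [Matrix.mul_assoc, hVV, Matrix.mul_one]
    rfl
  have hgram : ∀ j k, ∑ a, D a j * D a k = if j = k then ev j else 0 := fun j k => by
    have := congrFun (congrFun hDD j) k
    simpa [Matrix.mul_apply, Matrix.diagonal_apply] using this
  have hev0 : ∀ k, 0 ≤ ev k := fun k => by
    have := hgram k k
    rw [if_pos rfl] at this
    rw [← this]; exact Finset.sum_nonneg fun _ _ => mul_self_nonneg _
  have hev1 : ∀ k, ev k ≤ 1 := fun k => by
    have h1 := hC (fun a => V a k)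
    have h2 := hgram k k
    rw [if_pos rfl] at h2
    have h3 := congrFun (congrFun hVV k) k
    simp only [Matrix.mul_apply, Matrix.transpose_apply, Matrix.one_apply_eq] at h3
    have h4 : (fun a => V a k) ⬝ᵥ (fun a => V a k) = 1 := h3
    have h5 : (C *ᵥ fun a => V a k) ⬝ᵥ (C *ᵥ fun a => V a k) = ev k := h2
    rw [h4, h5] at h1; linarith
  -- Left singular vectors of $C$. Where the singular value vanishes this is the zero vector, and
  -- the orthonormal basis $b$ supplies a replacement.
  let u : q → EuclideanSpace ℝ q := fun k => WithLp.toLp 2 fun a => (√(ev k))⁻¹ * D a k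
  have hu : Orthonormal ℝ ({k | ev k ≠ 0}.domRestrict u) := by
    rw [orthonormal_iff_ite]
    rintro ⟨j, hj⟩ ⟨k, hk⟩
    have h1 : Inner.inner ℝ (u j) (u k) = (√(ev j))⁻¹ * (√(ev k))⁻¹ * ∑ a, D a j * D a k := by
      simp only [u, PiLp.inner_apply, RCLike.inner_apply, conj_trivial, Finset.mul_sum]
      exact Finset.sum_congr rfl fun a _ => by ring
    simp only [Set.domRestrict_apply, h1, hgram, Subtype.mk.injEq]
    split_ifs with h
    · subst h
      have h' : √(ev j) ≠ 0 := (Real.sqrt_ne_zero (hev0 j)).2 hj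
      field_simp
      exact (Real.sq_sqrt (hev0 j)).symm
    · simp
  obtain ⟨b, hb⟩ := hu.exists_orthonormalBasis_extension_of_card_eq (by simp)
  set W : Matrix q q ℝ := Matrix.of fun a k => b k a with hW
  have hWW : Wᵀ * W = 1 := by
    ext j k
    have := (orthonormal_iff_ite.1 b.orthonormal) j k
    simp only [PiLp.inner_apply, RCLike.inner_apply, conj_trivial] at this
    simp only [hW, Matrix.mul_apply, Matrix.transpose_apply, Matrix.of_apply, Matrix.one_apply]
    rw [← this]
    exact Finset.sum_congr rfl fun a _ => by ring
  have hR : W * Vᵀ ∈ Matrix.orthogonalGroup q ℝ := by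
    rw [Matrix.mem_orthogonalGroup_iff', Matrix.transpose_mul,
      Matrix.transpose_transpose, Matrix.mul_assoc, ← Matrix.mul_assoc Wᵀ, hWW, Matrix.one_mul,
      hVV']
  refine ⟨⟨W * Vᵀ, hR⟩, ?_⟩
  have h1 : fdot (W * Vᵀ) C = ∑ k, √(ev k) := by
    rw [fdot_mul_right, Matrix.transpose_transpose, ← hD]
    simp only [fdot]
    rw [Finset.sum_comm]
    refine Finset.sum_congr rfl fun k _ => ?_
    by_cases hk : ev k = 0
    · have h2 := hgram k k
      rw [if_pos rfl, hk] at h2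
      have h3 : ∀ a, D a k = 0 := fun a => by
        have := (Finset.sum_eq_zero_iff_of_nonneg fun a _ => mul_self_nonneg (D a k)).1 h2 a
          (Finset.mem_univ a)
        exact mul_self_eq_zero.1 this
      simp [h3, hk]
    · have h2 : ∀ a, W a k = (√(ev k))⁻¹ * D a k := fun a => by
        have : b k = u k := hb k hk
        simp [hW, this, u]
      simp only [h2, mul_assoc, ← Finset.mul_sum, hgram, if_pos]
      have h' : √(ev k) ≠ 0 := (Real.sqrt_ne_zero (hev0 k)).2 hk
      field_simp
      exact (Real.sq_sqrt (hev0 k)).symm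
  have h2 : frobSq C = ∑ k, ev k := by
    rw [frobSq_eq_fdot, fdot_eq_trace, hS.trace_eq_sum_eigenvalues]; rfl
  change frobSq C ≤ fdot (W * Vᵀ) C
  rw [h1, h2]
  -- The singular values are at most $1$, so each is at least its square.
  refine Finset.sum_le_sum fun k _ => ?_
  exact Real.le_sqrt_of_sq_le (by nlinarith [hev0 k, hev1 k])

/-- Orthonormal frames `U`, `U'` can be aligned up to the part of `U'` orthogonal to `U`. -/
lemma exists_orthogonal_frobSq_sub_le {U U' : Matrix p q ℝ} (hU : Uᵀ * U = 1)
    (hU' : U'ᵀ * U' = 1) : ∃ R : Matrix.orthogonalGroup q ℝ,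
      frobSq (U - U' * (R : Matrix q q ℝ)) ≤ 2 * frobSq (U' - U * (Uᵀ * U')) := by
  have hR' : ∀ R : Matrix.orthogonalGroup q ℝ, (R : Matrix q q ℝ)ᵀ * (R : Matrix q q ℝ) = 1 :=
    fun R => (Matrix.mem_orthogonalGroup_iff' q ℝ).1 R.2
  -- For $n$ columns, the two sides of the goal are $2n-2\langle R,U'^\top U\rangle$ and
  -- $2n-2\|U'^\top U\|_F^2$, so the previous lemma for $U'^\top U$ suffices.
  have h1 : frobSq (U' - U * (Uᵀ * U')) = Fintype.card q - frobSq (U'ᵀ * U) := by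
    rw [frobSq_sub, frobSq_isometry_mul hU, frobSq_of_isometry hU', fdot_comm, fdot_mul_left,
      ← frobSq_eq_fdot, ← frobSq_transpose (U'ᵀ * U), Matrix.transpose_mul,
      Matrix.transpose_transpose]
    ring
  have hC : OpBound (U'ᵀ * U) 1 := by
    intro v
    have h2 := mulVec_dot_self U v
    rw [hU, Matrix.one_mulVec] at h2
    have h3 : (U'ᵀ * U) *ᵥ v = U'ᵀ *ᵥ (U *ᵥ v) := by rw [Matrix.mulVec_mulVec]
    set w := U *ᵥ v
    have h4 := mulVec_dot_self U' (U'ᵀ *ᵥ w)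
    rw [hU', Matrix.one_mulVec] at h4
    have h5 : 0 ≤ (w - U' *ᵥ (U'ᵀ *ᵥ w)) ⬝ᵥ (w - U' *ᵥ (U'ᵀ *ᵥ w)) := by
      simp only [dotProduct]; exact Finset.sum_nonneg fun _ _ => mul_self_nonneg _
    have h6 : w ⬝ᵥ (U' *ᵥ (U'ᵀ *ᵥ w)) = (U'ᵀ *ᵥ w) ⬝ᵥ (U'ᵀ *ᵥ w) := by
      rw [Matrix.dotProduct_mulVec, ← Matrix.mulVec_transpose]
    rw [sub_dotProduct, dotProduct_sub, dotProduct_sub, h4, dotProduct_comm (U' *ᵥ _) w, h6] at h5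
    rw [h3]; linarith
  obtain ⟨R, hR⟩ := exists_orthogonal_frobSq_le_fdot hC
  refine ⟨R, ?_⟩
  have h2 : frobSq (U' * (R : Matrix q q ℝ)) = Fintype.card q := by
    rw [frobSq_isometry_mul hU', frobSq_of_isometry (hR' R)]
  rw [h1, frobSq_sub, frobSq_of_isometry hU, h2, fdot_comm, fdot_mul_left]
  linarith

end Procrustes

end TT
end

noncomputable section

namespace TT

variable {N : ℕ} {d : Fin N → ℕ} {r : Fin (N + 1) → ℕ}

/-! ### Multilinearity of the tensor and telescoping over the factors. -/

section PartialProd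

lemma partialProd_zero (X : Factors d r) (s : (i : Fin N) → Fin (d i)) :
    partialProd X s 0 = 1 := rfl

lemma partialProd_succ (X : Factors d r) (s : (i : Fin N) → Fin (d i)) (i : Fin N) :
    partialProd X s i.succ = partialProd X s i.castSucc * X i (s i) :=
  Fin.induction_succ _ _ _

lemma partialProd_congr {X Y : Factors d r} {s t : (i : Fin N) → Fin (d i)} (k : Fin (N + 1))
    (h : ∀ j : Fin N, (j : ℕ) < k → X j (s j) = Y j (t j)) :
    partialProd X s k = partialProd Y t k := by
  induction k using Fin.induction with
  | zero => rfl
  | succ i ih =>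
    rw [partialProd_succ, partialProd_succ, ih fun j hj => h j (hj.trans (Nat.lt_succ_self _)),
      h i (Nat.lt_succ_self _)]

lemma partialProd_update_of_le (X : Factors d r) (s : (i : Fin N) → Fin (d i)) (i : Fin N)
    (B : Fin (d i) → Matrix (Fin (r i.castSucc)) (Fin (r i.succ)) ℝ) (k : Fin (N + 1))
    (hk : (k : ℕ) ≤ i) : partialProd (Function.update X i B) s k = partialProd X s k := by
  refine partialProd_congr k fun j hj => ?_
  rw [Function.update_of_ne]
  rintro rfl
  omega

lemma partialProd_update_add (X : Factors d r) (s : (i : Fin N) → Fin (d i)) (i : Fin N)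
    (B C : Fin (d i) → Matrix (Fin (r i.castSucc)) (Fin (r i.succ)) ℝ) (k : Fin (N + 1))
    (hk : (i : ℕ) < k) : partialProd (Function.update X i (B + C)) s k =
      partialProd (Function.update X i B) s k + partialProd (Function.update X i C) s k := by
  induction k using Fin.induction with
  | zero => exact absurd hk (Nat.not_lt_zero _)
  | succ j ih =>
    simp only [partialProd_succ]
    by_cases h : (i : ℕ) < j
    · have hne : j ≠ i := by rintro rfl; exact lt_irrefl _ h
      rw [ih h, Function.update_of_ne hne, Function.update_of_ne hne, Function.update_of_ne hne,
        Matrix.add_mul]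
    · obtain rfl : i = j := by
        apply Fin.ext; rw [Fin.val_succ] at hk; omega
      simp only [partialProd_update_of_le _ _ _ _ i.castSucc le_rfl, Function.update_self,
        Pi.add_apply, Matrix.mul_add]

lemma partialProd_update_smul (X : Factors d r) (s : (i : Fin N) → Fin (d i)) (i : Fin N) (c : ℝ)
    (B : Fin (d i) → Matrix (Fin (r i.castSucc)) (Fin (r i.succ)) ℝ) (k : Fin (N + 1))
    (hk : (i : ℕ) < k) : partialProd (Function.update X i (c • B)) s k =
      c • partialProd (Function.update X i B) s k := by
  induction k using Fin.induction with
  | zero => exact absurd hk (Nat.not_lt_zero _)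
  | succ j ih =>
    simp only [partialProd_succ]
    by_cases h : (i : ℕ) < j
    · have hne : j ≠ i := by rintro rfl; exact lt_irrefl _ h
      rw [ih h, Function.update_of_ne hne, Function.update_of_ne hne, Matrix.smul_mul]
    · obtain rfl : i = j := by
        apply Fin.ext; rw [Fin.val_succ] at hk; omega
      simp only [partialProd_update_of_le _ _ _ _ i.castSucc le_rfl, Function.update_self,
        Pi.smul_apply, Matrix.mul_smul]

lemma tensor_update_add (X : Factors d r) (i : Fin N)
    (B C : Fin (d i) → Matrix (Fin (r i.castSucc)) (Fin (r i.succ)) ℝ) :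
    tensor (Function.update X i (B + C)) =
      tensor (Function.update X i B) + tensor (Function.update X i C) := by
  ext s
  simp only [tensor, partialProd_update_add X s i B C (Fin.last N) i.2, Matrix.add_apply,
    Finset.sum_add_distrib, Pi.add_apply]

lemma tensor_update_smul (X : Factors d r) (i : Fin N) (c : ℝ)
    (B : Fin (d i) → Matrix (Fin (r i.castSucc)) (Fin (r i.succ)) ℝ) :
    tensor (Function.update X i (c • B)) = c • tensor (Function.update X i B) := by
  ext s
  simp only [tensor, partialProd_update_smul X s i c B (Fin.last N) i.2, Matrix.smul_apply,
    Finset.mul_sum, Pi.smul_apply, smul_eq_mul]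

/-- The tensor as a linear function of factor `i`. -/
def tensorAt (X : Factors d r) (i : Fin N) :
    (Fin (d i) → Matrix (Fin (r i.castSucc)) (Fin (r i.succ)) ℝ) →ₗ[ℝ] Tensor d where
  toFun B := tensor (Function.update X i B)
  map_add' := tensor_update_add X i
  map_smul' := tensor_update_smul X i

lemma tensorAt_apply (X : Factors d r) (i : Fin N)
    (B : Fin (d i) → Matrix (Fin (r i.castSucc)) (Fin (r i.succ)) ℝ) :
    tensorAt X i B = tensor (Function.update X i B) := rfl

/-- The factors of `Y` before position `k`, and those of `X` from there on. -/
def mix (X Y : Factors d r) (k : ℕ) : Factors d r := fun j => if (j : ℕ) < k then Y j else X j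

lemma mix_of_lt {X Y : Factors d r} {k : ℕ} {j : Fin N} (h : (j : ℕ) < k) :
    mix X Y k j = Y j := if_pos h

lemma mix_of_le {X Y : Factors d r} {k : ℕ} {j : Fin N} (h : k ≤ j) :
    mix X Y k j = X j := if_neg (not_lt.2 h)

lemma tensor_mix_sub (X Y : Factors d r) (i : Fin N) :
    tensor (mix X Y i) - tensor (mix X Y (i + 1)) = tensorAt (mix X Y i) i (X i - Y i) := by
  rw [map_sub, tensorAt_apply, tensorAt_apply]
  congr 2
  · ext j : 1
    by_cases h : j = i
    · subst h; rw [Function.update_self, mix_of_le le_rfl]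
    · rw [Function.update_of_ne h]
  · ext j : 1
    by_cases h : j = i
    · subst h; rw [Function.update_self, mix_of_lt (Nat.lt_succ_self _)]
    · rw [Function.update_of_ne h]
      have h' : (j : ℕ) ≠ i := fun h' => h (Fin.ext h')
      by_cases hj : (j : ℕ) < i
      · rw [mix_of_lt hj, mix_of_lt (by omega)]
      · rw [mix_of_le (by omega), mix_of_le (by omega)]

/-- The difference of two tensors is the sum over the positions of the changes of one factor. -/
lemma tensor_sub_eq_sum (X Y : Factors d r) :
    tensor X - tensor Y = ∑ i : Fin N, tensorAt (mix X Y i) i (X i - Y i) := by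
  simp_rw [← tensor_mix_sub]
  rw [Fin.sum_univ_eq_sum_range (fun k => tensor (mix X Y k) - tensor (mix X Y (k + 1))) N,
    Finset.sum_range_sub']
  congr 2
  ext j : 1
  rw [mix_of_lt j.2]

end PartialProd

/-! ### Left unfoldings in terms of slices. -/

section Slices

variable {e a b : ℕ}

lemma frobSq_leftUnfold (Y : Fin e → Matrix (Fin a) (Fin b) ℝ) :
    frobSq (leftUnfold Y) = ∑ x, frobSq (Y x) := by
  simp only [frobSq, leftUnfold, Matrix.of_apply, Fintype.sum_prod_type]

lemma leftUnfold_leftFold (M : Matrix (Fin e × Fin a) (Fin b) ℝ) : leftUnfold (leftFold M) = M :=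
  rfl

lemma leftFold_leftUnfold (Y : Fin e → Matrix (Fin a) (Fin b) ℝ) : leftFold (leftUnfold Y) = Y :=
  rfl

lemma leftUnfold_sub (Y Z : Fin e → Matrix (Fin a) (Fin b) ℝ) :
    leftUnfold (Y - Z) = leftUnfold Y - leftUnfold Z := rfl

lemma leftUnfold_mulVec_dot (Y : Fin e → Matrix (Fin a) (Fin b) ℝ) (v : Fin b → ℝ) :
    (leftUnfold Y *ᵥ v) ⬝ᵥ (leftUnfold Y *ᵥ v) = ∑ x, (Y x *ᵥ v) ⬝ᵥ (Y x *ᵥ v) := by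
  simp only [dotProduct, Matrix.mulVec, leftUnfold, Matrix.of_apply, Fintype.sum_prod_type]

lemma leftUnfold_gram (Y : Fin e → Matrix (Fin a) (Fin b) ℝ) :
    (leftUnfold Y)ᵀ * leftUnfold Y = ∑ x, (Y x)ᵀ * Y x := by
  ext i j
  simp only [Matrix.mul_apply, Matrix.transpose_apply, leftUnfold, Matrix.of_apply,
    Fintype.sum_prod_type, Matrix.sum_apply]

end Slices

/-! ### Prefix matrices of a tensor train. -/

section LeftMat

/-- Choices of the first `k` indices. -/
abbrev Pre (d : Fin N → ℕ) (k : ℕ) : Type := (j : {j : Fin N // (j : ℕ) < k}) → Fin (d j)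

/-- Extension of a choice of the first `k` indices by the indices of `s₀`. -/
def Pre.extend (s₀ : (i : Fin N) → Fin (d i)) {k : ℕ} (a : Pre d k) : (i : Fin N) → Fin (d i) :=
  fun j => if h : (j : ℕ) < k then a ⟨j, h⟩ else s₀ j

lemma Pre.extend_of_lt (s₀ : (i : Fin N) → Fin (d i)) {k : ℕ} (a : Pre d k) {j : Fin N}
    (h : (j : ℕ) < k) : a.extend s₀ j = a ⟨j, h⟩ := dif_pos h

/-- Choices of the first `i + 1` indices consist of the first `i` indices and another one. -/
def preEquiv (d : Fin N → ℕ) (i : Fin N) : Pre d (i + 1) ≃ Pre d i × Fin (d i) where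
  toFun a := (fun j => a ⟨j.1, j.2.trans (Nat.lt_succ_self _)⟩, a ⟨i, Nat.lt_succ_self _⟩)
  invFun p j :=
    if h : (j.1 : ℕ) < i then p.1 ⟨j.1, h⟩
    else Fin.cast (congrArg d (Fin.ext (by have := j.2; omega))) p.2
  left_inv a := by
    ext ⟨j, hj⟩
    by_cases h : (j : ℕ) < i
    · simp [h]
    · obtain rfl : i = j := Fin.ext (by omega)
      simp
  right_inv p := by
    refine Prod.ext ?_ ?_
    · ext ⟨j, hj⟩
      simp [hj]
    · simp

lemma preEquiv_symm_lt (i : Fin N) (p : Pre d i × Fin (d i)) (j : Fin N) (h : (j : ℕ) < i) :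
    (preEquiv d i).symm p ⟨j, h.trans (Nat.lt_succ_self _)⟩ = p.1 ⟨j, h⟩ := dif_pos h

lemma preEquiv_symm_self (i : Fin N) (p : Pre d i × Fin (d i)) :
    (preEquiv d i).symm p ⟨i, Nat.lt_succ_self _⟩ = p.2 := by
  simp [preEquiv]

/-- The matrix with rows `X_1(s_1) ⋯ X_k(s_k)`; the rows of `X_1(s_1)` are added up. -/
def leftMat (X : Factors d r) (s₀ : (i : Fin N) → Fin (d i)) (k : Fin (N + 1)) :
    Matrix (Pre d k) (Fin (r k)) ℝ :=
  Matrix.of fun a b => ∑ c, partialProd X (a.extend s₀) k c b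

variable (s₀ : (i : Fin N) → Fin (d i))

lemma leftMat_succ (X : Factors d r) (i : Fin N) (p : Pre d i × Fin (d i)) (b : Fin (r i.succ)) :
    leftMat X s₀ i.succ ((preEquiv d i).symm p) b =
      ∑ c, leftMat X s₀ i.castSucc p.1 c * X i p.2 c b := by
  have h1 : partialProd X (Pre.extend s₀ (k := (i.succ : Fin (N + 1))) ((preEquiv d i).symm p))
      i.castSucc = partialProd X (Pre.extend s₀ (k := (i.castSucc : Fin (N + 1))) p.1)
        i.castSucc := by
    refine partialProd_congr _ fun j hj => ?_
    have hj' : (j : ℕ) < i := hj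
    rw [Pre.extend_of_lt s₀ _ hj, Pre.extend_of_lt s₀ _ (show (j : ℕ) < i.succ from
      hj'.trans (Nat.lt_succ_self _)), preEquiv_symm_lt i p j hj']
  have h2 : Pre.extend s₀ (k := (i.succ : Fin (N + 1))) ((preEquiv d i).symm p) i = p.2 := by
    rw [Pre.extend_of_lt s₀ _ (show (i : ℕ) < i.succ from Nat.lt_succ_self _),
      preEquiv_symm_self]
  simp only [leftMat, Matrix.of_apply]
  rw [partialProd_succ, h1, h2]
  simp only [Matrix.mul_apply, Finset.sum_mul]
  exact Finset.sum_comm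

lemma leftMat_succ_mulVec (X : Factors d r) (i : Fin N) (p : Pre d i × Fin (d i))
    (v : Fin (r i.succ) → ℝ) :
    (leftMat X s₀ i.succ *ᵥ v) ((preEquiv d i).symm p) =
      (leftMat X s₀ i.castSucc *ᵥ (X i p.2 *ᵥ v)) p.1 := by
  simp only [Matrix.mulVec, dotProduct, leftMat_succ, Finset.sum_mul, Finset.mul_sum, mul_assoc]
  exact Finset.sum_comm

lemma sum_pre_succ {M : Type*} [AddCommMonoid M] (i : Fin N)
    (f : Pre d ((i.succ : Fin (N + 1)) : ℕ) → M) :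
    ∑ a, f a = ∑ a : Pre d i, ∑ x : Fin (d i), f ((preEquiv d i).symm (a, x)) := by
  rw [← Fintype.sum_prod_type']
  exact (Equiv.sum_comp (preEquiv d i).symm f).symm

lemma leftMat_succ_dot (X : Factors d r) (i : Fin N) (v : Fin (r i.succ) → ℝ) :
    (leftMat X s₀ i.succ *ᵥ v) ⬝ᵥ (leftMat X s₀ i.succ *ᵥ v) =
      ∑ x, (leftMat X s₀ i.castSucc *ᵥ (X i x *ᵥ v)) ⬝ᵥ
        (leftMat X s₀ i.castSucc *ᵥ (X i x *ᵥ v)) := by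
  simp only [dotProduct, sum_pre_succ, leftMat_succ_mulVec]
  exact Finset.sum_comm

instance : Unique (Pre d ((0 : Fin (N + 1)) : ℕ)) where
  default := fun j => absurd j.2 (Nat.not_lt_zero _)
  uniq _ := funext fun j => absurd j.2 (Nat.not_lt_zero _)

lemma leftMat_zero (X : Factors d r) (a : Pre d ((0 : Fin (N + 1)) : ℕ)) (b : Fin (r 0)) :
    leftMat X s₀ 0 a b = 1 := by
  simp only [leftMat, partialProd_zero, Matrix.one_apply, Matrix.of_apply]
  simp

/-- Appending a factor applies the previous prefix matrix to each slice, and the slices together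
form the left unfolding, so the bounds multiply. At the start the matrix is the scalar $1$, as
$r_0=1$. -/
lemma opBound_leftMat (hr : r 0 = 1) (X : Factors d r) (b : Fin N → ℝ)
    (hb : ∀ i, OpBound (leftUnfold (X i)) (b i)) (k : Fin (N + 1)) :
    OpBound (leftMat X s₀ k) (∏ j : Fin N, if (j : ℕ) < k then b j else 1) := by
  induction k using Fin.induction with
  | zero =>
    intro v
    have : Unique (Fin (r 0)) := by rw [hr]; infer_instance
    have h : ∀ a, (leftMat X s₀ 0 *ᵥ v) a = v default := fun a => by
      simp [Matrix.mulVec, dotProduct, leftMat_zero s₀ X a]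
    rw [dotProduct, Fintype.sum_unique, h, dotProduct, Fintype.sum_unique]
    simp
  | succ i ih =>
    intro v
    have hprod : (∏ j : Fin N, if (j : ℕ) < i.succ then b j else 1) =
        (∏ j : Fin N, if (j : ℕ) < i.castSucc then b j else 1) * b i := by
      have : b i = ∏ j : Fin N, if j = i then b j else 1 := by simp
      rw [this, ← Finset.prod_mul_distrib]
      refine Finset.prod_congr rfl fun j _ => ?_
      by_cases h : j = i
      · subst h; simp
      · have h' : (j : ℕ) ≠ i := fun h' => h (Fin.ext h')
        have h2 : (j : ℕ) < i + 1 ↔ (j : ℕ) < i := by omega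
        simp only [Fin.val_succ, Fin.val_castSucc, h2, h, if_false, mul_one]
    rw [leftMat_succ_dot, hprod, mul_pow, mul_assoc]
    refine (Finset.sum_le_sum fun x _ => ih (X i x *ᵥ v)).trans ?_
    rw [← Finset.mul_sum, ← leftUnfold_mulVec_dot]
    exact mul_le_mul_of_nonneg_left (hb i v) (sq_nonneg _)

/-- The first `N` indices are all indices. -/
def preLast (d : Fin N → ℕ) : Pre d ((Fin.last N : Fin (N + 1)) : ℕ) ≃ ((i : Fin N) → Fin (d i)) where
  toFun a j := a ⟨j, j.2⟩
  invFun s j := s j.1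
  left_inv _ := rfl
  right_inv _ := rfl

lemma tensor_eq_leftMat (X : Factors d r) (a : Pre d ((Fin.last N : Fin (N + 1)) : ℕ)) :
    tensor X (preLast d a) = ∑ b, leftMat X s₀ (Fin.last N) a b := by
  have : a.extend s₀ = preLast d a := funext fun j => Pre.extend_of_lt s₀ a j.2
  simp only [tensor, leftMat, Matrix.of_apply, this]
  exact Finset.sum_comm

lemma normSq_tensor_eq_dot (X : Factors d r) :
    normSq (tensor X) =
      (leftMat X s₀ (Fin.last N) *ᵥ 1) ⬝ᵥ (leftMat X s₀ (Fin.last N) *ᵥ 1) := by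
  rw [normSq, ← Equiv.sum_comp (preLast d)]
  simp only [tensor_eq_leftMat s₀, dotProduct, Matrix.mulVec, sq, Pi.one_apply, mul_one]

lemma normSq_tensor_le (h0 : r 0 = 1) (hN : r (Fin.last N) = 1) (X : Factors d r) (b : Fin N → ℝ)
    (hb : ∀ i, OpBound (leftUnfold (X i)) (b i)) : normSq (tensor X) ≤ (∏ j, b j) ^ 2 := by
  by_cases hd : Nonempty ((i : Fin N) → Fin (d i))
  · obtain ⟨s₀⟩ := hd
    have := opBound_leftMat s₀ h0 X b hb (Fin.last N) 1
    rw [normSq_tensor_eq_dot s₀]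
    simpa [hN, dotProduct] using this
  · rw [not_nonempty_iff] at hd
    simp only [normSq, Finset.univ_eq_empty, Finset.sum_empty]
    positivity

/-- Once the previous prefix matrix has orthonormal columns it cancels from the Gram matrix of the
next one, which becomes that of the left unfolding. The last bond is excluded because the last
factor is not orthonormal. -/
lemma leftMat_gram (hr : r 0 = 1) {X : Factors d r} (hX : LeftOrthogonal X) (k : Fin (N + 1))
    (hk : (k : ℕ) < N) : (leftMat X s₀ k)ᵀ * leftMat X s₀ k = 1 := by
  induction k using Fin.induction with
  | zero =>
    have : Unique (Fin (r 0)) := by rw [hr]; infer_instance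
    ext a b
    rw [Subsingleton.elim a b]
    rw [Matrix.mul_apply, Fintype.sum_unique, Matrix.transpose_apply, leftMat_zero]
    simp
  | succ i ih =>
    have ih' := ih (by simp only [Fin.val_succ] at hk; simp only [Fin.val_castSucc]; omega)
    rw [← hX i hk, leftUnfold_gram]
    have : ∀ x, (X i x)ᵀ * X i x =
        (leftMat X s₀ i.castSucc * X i x)ᵀ * (leftMat X s₀ i.castSucc * X i x) := fun x => by
      rw [Matrix.transpose_mul, Matrix.mul_assoc, ← Matrix.mul_assoc (leftMat X s₀ i.castSucc)ᵀ,
        ih', Matrix.one_mul]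
    simp_rw [this]
    ext b c
    simp only [Matrix.mul_apply, Matrix.transpose_apply, Matrix.sum_apply, sum_pre_succ,
      leftMat_succ]
    exact Finset.sum_comm

end LeftMat

end TT
end

noncomputable section

namespace TT

variable {N : ℕ} {d : Fin N → ℕ} {r : Fin (N + 1) → ℕ}

/-! ### Factorization of the unfoldings and consequences of minimality. -/

section Suffix

/-- The vector of row sums of `X_{k+1}(s_{k+1}) ⋯ X_N(s_N)`. -/
def suffixVec (X : Factors d r) (s : (i : Fin N) → Fin (d i)) (k : Fin (N + 1)) : Fin (r k) → ℝ :=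
  Fin.reverseInduction (motive := fun k => Fin (r k) → ℝ) (fun _ => 1)
    (fun i v => X i (s i) *ᵥ v) k

lemma suffixVec_last (X : Factors d r) (s : (i : Fin N) → Fin (d i)) :
    suffixVec X s (Fin.last N) = fun _ => 1 := Fin.reverseInduction_last

lemma suffixVec_castSucc (X : Factors d r) (s : (i : Fin N) → Fin (d i)) (i : Fin N) :
    suffixVec X s i.castSucc = X i (s i) *ᵥ suffixVec X s i.succ :=
  Fin.reverseInduction_castSucc i

lemma suffixVec_congr (X : Factors d r) {s t : (i : Fin N) → Fin (d i)} (k : Fin (N + 1))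
    (h : ∀ j : Fin N, (k : ℕ) ≤ j → s j = t j) : suffixVec X s k = suffixVec X t k := by
  induction k using Fin.reverseInduction with
  | last => rw [suffixVec_last, suffixVec_last]
  | cast i ih =>
    rw [suffixVec_castSucc, suffixVec_castSucc, h i le_rfl,
      ih fun j hj => h j ((Nat.le_succ _).trans hj)]

/-- Associativity moves one slice at a time across the cut, starting from the last bond. -/
lemma tensor_eq_dot_suffixVec (X : Factors d r) (s : (i : Fin N) → Fin (d i)) (k : Fin (N + 1)) :
    tensor X s = ∑ c, (∑ a, partialProd X s k a c) * suffixVec X s k c := by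
  induction k using Fin.reverseInduction with
  | last =>
    simp only [suffixVec_last, mul_one, tensor]
    exact Finset.sum_comm
  | cast i ih =>
    have h : ∀ (k : Fin (N + 1)) (v : Fin (r k) → ℝ),
        ∑ c, (∑ a, partialProd X s k a c) * v c = ((1 : Fin (r 0) → ℝ) ᵥ* partialProd X s k) ⬝ᵥ v :=
      fun k v => by simp [dotProduct, Matrix.vecMul]
    rw [ih, h, h, partialProd_succ, suffixVec_castSucc, Matrix.dotProduct_mulVec,
      Matrix.vecMul_vecMul]

/-- The second factor of the `k`-th unfolding. -/
def rightMat (X : Factors d r) (s₀ : (i : Fin N) → Fin (d i)) (k : Fin (N + 1)) :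
    Matrix (Fin (r k)) ((j : {j : Fin N // ¬ (j : ℕ) < k}) → Fin (d j)) ℝ :=
  Matrix.of fun c b => suffixVec X
    (fun j => if h : (j : ℕ) < k then s₀ j else b ⟨j, h⟩) k c

lemma unfolding_tensor (X : Factors d r) (s₀ : (i : Fin N) → Fin (d i)) (k : Fin (N + 1)) :
    unfolding (tensor X) k = leftMat X s₀ k * rightMat X s₀ k := by
  ext a b
  rw [unfolding, Matrix.of_apply, tensor_eq_dot_suffixVec X _ k, Matrix.mul_apply]
  refine Finset.sum_congr rfl fun c _ => ?_
  simp only [leftMat, rightMat, Matrix.of_apply]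
  congr 1
  · refine Finset.sum_congr rfl fun e _ => ?_
    rw [partialProd_congr k]
    intro j hj
    rw [Pre.extend_of_lt s₀ a hj]
    simp [Equiv.piEquivPiSubtypeProd, hj]
  · refine congrFun (suffixVec_congr X k fun j hj => ?_) c
    simp [Equiv.piEquivPiSubtypeProd, not_lt.2 hj]

lemma frobSq_unfolding (T : Tensor d) (k : ℕ) : frobSq (unfolding T k) = normSq T := by
  simp only [frobSq, unfolding, Matrix.of_apply, normSq]
  rw [← Fintype.sum_prod_type']
  exact Equiv.sum_comp
    (Equiv.piEquivPiSubtypeProd (fun j : Fin N => (j : ℕ) < k) (fun j => Fin (d j))).symm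
    (fun s => T s ^ 2)

lemma unfolding_sub (S T : Tensor d) (k : ℕ) :
    unfolding (S - T) k = unfolding S k - unfolding T k := rfl

/-- A right unfolding of positive rank has a column, so $d_ir_i>0$ whenever $r_{i-1}>0$. -/
lemma Minimal.pos {X : Factors d r} (hX : Minimal X) (h0 : r 0 = 1) (k : Fin (N + 1)) :
    0 < r k := by
  induction k using Fin.induction with
  | zero => omega
  | succ i ih =>
    have h1 := (hX i).2
    have h2 := Matrix.rank_le_card_width (rightUnfold (X i))
    simp only [Fintype.card_prod, Fintype.card_fin] at h2
    rw [h1] at h2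
    exact Nat.pos_of_mul_pos_left (ih.trans_le h2)

lemma Minimal.dim_pos {X : Factors d r} (hX : Minimal X) (h0 : r 0 = 1) (i : Fin N) :
    0 < d i := by
  have h1 := (hX i).2
  have h2 := Matrix.rank_le_card_width (rightUnfold (X i))
  simp only [Fintype.card_prod, Fintype.card_fin] at h2
  rw [h1] at h2
  exact Nat.pos_of_mul_pos_right ((hX.pos h0 _).trans_le h2)

lemma eq_zero_of_rank_eq_height {m : ℕ} {l : Type*} [Fintype l] {A : Matrix (Fin m) l ℝ}
    (hA : A.rank = m) {v : Fin m → ℝ} (hv : v ᵥ* A = 0) : v = 0 := by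
  have h1 : LinearIndependent ℝ A.row := by
    rw [linearIndependent_iff_card_eq_finrank_span, Set.finrank, ← Matrix.rank_eq_finrank_span_row,
      hA, Fintype.card_fin]
  exact Matrix.vecMul_injective_iff.2 h1 (by simpa using hv)

lemma Minimal.suffixVec_separating {X : Factors d r} (hX : Minimal X) (hN : r (Fin.last N) = 1)
    (k : Fin (N + 1)) (v : Fin (r k) → ℝ)
    (hv : ∀ s : (i : Fin N) → Fin (d i), v ⬝ᵥ suffixVec X s k = 0)
    (hd : Nonempty ((i : Fin N) → Fin (d i))) : v = 0 := by
  induction k using Fin.reverseInduction with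
  | last =>
    obtain ⟨s⟩ := hd
    have h := hv s
    have : Unique (Fin (r (Fin.last N))) := by rw [hN]; infer_instance
    rw [suffixVec_last, dotProduct, Fintype.sum_unique, mul_one] at h
    ext c
    rw [Subsingleton.elim c default]; exact h
  | cast i ih =>
    refine eq_zero_of_rank_eq_height (hX i).2 ?_
    have key : ∀ x, v ᵥ* X i x = 0 := fun x => by
      refine ih _ fun s => ?_
      -- Index $i$ can be set to $x$ freely, since the suffix after it does not see it.
      have h := hv (Function.update s i x)
      rw [suffixVec_castSucc, Matrix.dotProduct_mulVec, Function.update_self,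
        suffixVec_congr X (t := s)] at h
      · exact h
      · intro j hj
        rw [Function.update_of_ne]
        rintro rfl
        simp at hj
    ext ⟨x, c⟩
    exact congrFun (key x) c

lemma Minimal.rightMat_injective {X : Factors d r} (hX : Minimal X) (hN : r (Fin.last N) = 1)
    (s₀ : (i : Fin N) → Fin (d i)) (k : Fin (N + 1)) (v : Fin (r k) → ℝ)
    (hv : v ᵥ* rightMat X s₀ k = 0) : v = 0 := by
  refine hX.suffixVec_separating hN k v (fun s => ?_) ⟨s₀⟩
  have h := congrFun hv fun j => s j
  simp only [Matrix.vecMul, rightMat, dotProduct, Matrix.of_apply, Pi.zero_apply] at h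
  rw [suffixVec_congr X (t := s)] at h
  · exact h
  · intro j hj
    rw [dif_neg (not_lt.2 hj)]

end Suffix

/-! ### Lower bounds from singular values. -/

section SingularValue

variable {p q : Type*} [Fintype p] [Fintype q] [DecidableEq q]

/-- If `T = U B` and `U` has `n` orthonormal columns, then the `n`-th singular value of `T` is a
lower bound for the transpose of `B`. -/
lemma singularValue_sq_mul_le {n : ℕ} {U : Matrix p (Fin n) ℝ} {B : Matrix (Fin n) q ℝ}
    (hU : Uᵀ * U = 1) (v : Fin n → ℝ) :
    (Matrix.toEuclideanLin (U * B)).singularValues (n - 1) ^ 2 * (v ⬝ᵥ v) ≤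
      (v ᵥ* B) ⬝ᵥ (v ᵥ* B) := by
  set T := Matrix.toEuclideanLin (U * B) with hT
  set σ := T.singularValues (n - 1) with hσ
  have hσ0 : 0 ≤ σ := T.singularValues_nonneg _
  have hnn : ∀ w : q → ℝ, 0 ≤ w ⬝ᵥ w := fun w => by
    simp only [dotProduct]; exact Finset.sum_nonneg fun _ _ => mul_self_nonneg _
  rcases hσ0.eq_or_lt with h0 | hpos
  · rw [← h0]; simpa using hnn _
  -- Singular values vanish from the dimension of the domain on, so a positive one ensures that the
  -- first $n$ eigenvectors exist.
  have hn : n - 1 < Module.finrank ℝ (EuclideanSpace ℝ q) := by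
    by_contra h
    rw [hσ, T.singularValues_of_finrank_le (not_lt.1 h)] at hpos
    exact lt_irrefl _ hpos
  have hsym := T.isSymmetric_adjoint_comp_self
  set b := hsym.eigenvectorBasis rfl with hb
  let idx : Fin n → Fin (Module.finrank ℝ (EuclideanSpace ℝ q)) := fun k => ⟨k, by omega⟩
  have hidx : Function.Injective idx := fun j k h => Fin.ext (by simpa [idx] using h)
  -- The top $n$ right singular vectors. For $G=BF$ the frame $U$ drops out and $G^\top G$ is the
  -- diagonal matrix of the squared singular values. Hence $G$ is invertible, and every $v$ is some
  -- $Gx$. Projecting $B^\top v$ to the span of $F$ only shortens it, which leaves a comparison of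
  -- diagonal sums.
  set F : Matrix q (Fin n) ℝ := Matrix.of fun a k => b (idx k) a with hF
  have hFF : Fᵀ * F = 1 := by
    ext j k
    have := (orthonormal_iff_ite.1 b.orthonormal) (idx j) (idx k)
    simp only [PiLp.inner_apply, RCLike.inner_apply, conj_trivial, hidx.eq_iff] at this
    simp only [hF, Matrix.mul_apply, Matrix.transpose_apply, Matrix.of_apply, Matrix.one_apply]
    rw [← this]
    exact Finset.sum_congr rfl fun a _ => by ring
  let ev : Fin n → ℝ := fun k => T.singularValues k ^ 2
  have hev : ∀ k, σ ^ 2 ≤ ev k := fun k =>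
    pow_le_pow_left₀ hσ0 (T.singularValues_antitone (by omega)) 2
  set G : Matrix (Fin n) (Fin n) ℝ := B * F with hG
  have hGG : Gᵀ * G = Matrix.diagonal ev := by
    have h1 : Gᵀ * G = ((U * B) * F)ᵀ * ((U * B) * F) := by
      rw [Matrix.mul_assoc, ← hG, Matrix.transpose_mul U, Matrix.mul_assoc, ← Matrix.mul_assoc Uᵀ,
        hU, Matrix.one_mul]
    rw [h1]
    ext j k
    have h2 : Inner.inner ℝ (T (b (idx j))) (T (b (idx k))) = Matrix.diagonal ev j k := by
      rw [← LinearMap.adjoint_inner_right, ← LinearMap.comp_apply, hb,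
        hsym.apply_eigenvectorBasis rfl, ← hb, inner_smul_right,
        orthonormal_iff_ite.1 b.orthonormal, Matrix.diagonal_apply]
      simp only [hidx.eq_iff]
      split_ifs with h
      · subst h
        rw [mul_one]
        simp only [ev]
        have := T.sq_singularValues_fin rfl (idx j)
        simpa [idx] using this.symm
      · simp
    rw [← h2]
    have h3 : ∀ k a, ((U * B) * F) a k = T (b (idx k)) a := fun k a => by
      simp [hT, hF, Matrix.toLpLin_apply, Matrix.mul_apply, Matrix.mulVec, dotProduct]
    simp only [PiLp.inner_apply, RCLike.inner_apply, conj_trivial, Matrix.mul_apply (M := (_)ᵀ),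
      Matrix.transpose_apply, h3]
    exact Finset.sum_congr rfl fun a _ => by ring
  have hdet : IsUnit G := by
    have : IsUnit (Gᵀ * G) := by
      rw [hGG, Matrix.isUnit_diagonal, Pi.isUnit_iff]
      exact fun k => (lt_of_lt_of_le (by positivity) (hev k)).ne'.isUnit
    exact (IsUnit.mul_iff.1 this).2
  obtain ⟨x, rfl⟩ : ∃ x, G *ᵥ x = v := Matrix.mulVec_surjective_iff_isUnit.2 hdet v
  have h1 : (G *ᵥ x) ⬝ᵥ (G *ᵥ x) = ∑ k, ev k * x k ^ 2 := by
    rw [mulVec_dot_self, hGG]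
    simp only [dotProduct, Matrix.mulVec_diagonal]
    exact Finset.sum_congr rfl fun k _ => by ring
  have h2 : ((G *ᵥ x) ᵥ* G) ⬝ᵥ ((G *ᵥ x) ᵥ* G) = ∑ k, ev k ^ 2 * x k ^ 2 := by
    rw [← Matrix.mulVec_transpose, Matrix.mulVec_mulVec, hGG]
    simp only [dotProduct, Matrix.mulVec_diagonal]
    exact Finset.sum_congr rfl fun k _ => by ring
  have h3 : ((G *ᵥ x) ᵥ* G) ⬝ᵥ ((G *ᵥ x) ᵥ* G) ≤
      ((G *ᵥ x) ᵥ* B) ⬝ᵥ ((G *ᵥ x) ᵥ* B) := by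
    conv_lhs => rw [hG, ← Matrix.vecMul_vecMul, ← hG]
    set w := (G *ᵥ x) ᵥ* B
    have h5 := hnn (w - F *ᵥ (w ᵥ* F))
    have h6 := mulVec_dot_self F (w ᵥ* F)
    rw [hFF, Matrix.one_mulVec] at h6
    have h7 : w ⬝ᵥ (F *ᵥ (w ᵥ* F)) = (w ᵥ* F) ⬝ᵥ (w ᵥ* F) := by rw [Matrix.dotProduct_mulVec]
    rw [sub_dotProduct, dotProduct_sub, dotProduct_sub, h6, dotProduct_comm (F *ᵥ _) w, h7] at h5
    linarith
  refine le_trans ?_ h3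
  rw [h1, h2, Finset.mul_sum]
  refine Finset.sum_le_sum fun k _ => ?_
  have h4 : 0 ≤ ev k * x k ^ 2 := mul_nonneg (sq_nonneg _) (sq_nonneg _)
  nlinarith [mul_le_mul_of_nonneg_right (hev k) h4]

/-- Multiplication by $U^\top$ recovers $B$, so $UB$ has rank at least $n$; singular values below
the rank are positive. -/
lemma singularValue_pos {n : ℕ} (hn : 0 < n) {U : Matrix p (Fin n) ℝ} {B : Matrix (Fin n) q ℝ}
    (hU : Uᵀ * U = 1) (hB : ∀ v, v ᵥ* B = 0 → v = 0) :
    0 < (Matrix.toEuclideanLin (U * B)).singularValues (n - 1) := by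
  rw [LinearMap.singularValues_pos_iff_lt_finrank_range]
  have h1 : B.rank = n := by
    have h : LinearIndependent ℝ B.row := Matrix.vecMul_injective_iff.1 fun v w h => by
      rw [← sub_eq_zero]
      exact hB _ (by rw [Matrix.sub_vecMul, sub_eq_zero]; exact h)
    rw [h.rank_matrix, Fintype.card_fin]
  have h2 : n ≤ (U * B).rank := by
    have h3 : Uᵀ * (U * B) = B := by rw [← Matrix.mul_assoc, hU, Matrix.one_mul]
    calc n = (Uᵀ * (U * B)).rank := by rw [h3, h1]
      _ ≤ _ := Matrix.rank_mul_le_right _ _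
  have h3 : Module.finrank ℝ (LinearMap.range (Matrix.toEuclideanLin (U * B))) = (U * B).rank := by
    rw [Matrix.rank_eq_finrank_range_toLin (U * B) (EuclideanSpace.basisFun p ℝ).toBasis
      (EuclideanSpace.basisFun q ℝ).toBasis]
    rfl
  omega

end SingularValue

/-! ### The smallest singular value over the inner bonds. -/

section SigmaMin

variable {X : Factors d r}

lemma mem_innerBonds {k : Fin (N + 1)} : k ∈ innerBonds N ↔ 1 ≤ (k : ℕ) ∧ (k : ℕ) < N := by
  simp [innerBonds]

lemma sigmaMin_le (T : Tensor d) {k : Fin (N + 1)} (hk : k ∈ innerBonds N) :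
    sigmaMin r T ≤ (Matrix.toEuclideanLin (unfolding T k)).singularValues (r k - 1) :=
  ciInf_le (Set.finite_range _).bddBelow (⟨k, hk⟩ : {i : Fin (N + 1) // i ∈ innerBonds N})

lemma sigmaMin_nonneg (T : Tensor d) : 0 ≤ sigmaMin r T :=
  Real.iInf_nonneg fun _ => LinearMap.singularValues_nonneg _ _

lemma sigmaMin_pos (h2 : 2 ≤ N) (h0 : r 0 = 1) (hN : r (Fin.last N) = 1) (hl : LeftOrthogonal X)
    (hm : Minimal X) : 0 < sigmaMin r (tensor X) := by
  have hne : Nonempty {i : Fin (N + 1) // i ∈ innerBonds N} :=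
    ⟨⟨⟨1, by omega⟩, mem_innerBonds.2 ⟨le_rfl, by simp; omega⟩⟩⟩
  obtain ⟨k, hk⟩ := exists_eq_ciInf_of_finite (f := fun i : {i : Fin (N + 1) // i ∈ innerBonds N} =>
    (Matrix.toEuclideanLin (unfolding (tensor X) (i : Fin (N + 1)))).singularValues (r i - 1))
  rw [sigmaMin, ← hk]
  let s₀ : (i : Fin N) → Fin (d i) := fun i => ⟨0, hm.dim_pos h0 i⟩
  rw [unfolding_tensor X s₀]
  exact singularValue_pos (hm.pos h0 _) (leftMat_gram s₀ h0 hl _ (mem_innerBonds.1 k.2).2)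
    (hm.rightMat_injective hN s₀ _)

/-- The unfolding is an orthonormal frame times `rightMat`, so the singular value bound applies to
every row of $C$. -/
lemma sigmaMin_sq_mul_frobSq_le {p : Type*} [Fintype p] (h0 : r 0 = 1) (hl : LeftOrthogonal X)
    (s₀ : (i : Fin N) → Fin (d i)) {k : Fin (N + 1)} (hk : k ∈ innerBonds N)
    (C : Matrix p (Fin (r k)) ℝ) :
    sigmaMin r (tensor X) ^ 2 * frobSq C ≤ frobSq (C * rightMat X s₀ k) := by
  have h1 := sigmaMin_le (r := r) (tensor X) hk
  rw [unfolding_tensor X s₀] at h1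
  have h2 := pow_le_pow_left₀ (sigmaMin_nonneg _) h1 2
  have h3 : ∀ a, sigmaMin r (tensor X) ^ 2 * ∑ b, C a b ^ 2 ≤
      ∑ b, (C * rightMat X s₀ k) a b ^ 2 := fun a => by
    have h4 := singularValue_sq_mul_le (B := rightMat X s₀ k)
      (leftMat_gram s₀ h0 hl k (mem_innerBonds.1 hk).2) (C a)
    have h5 : C a ⬝ᵥ C a = ∑ b, C a b ^ 2 := by simp [dotProduct, sq]
    have h6 : (C a ᵥ* rightMat X s₀ k) ⬝ᵥ (C a ᵥ* rightMat X s₀ k) =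
        ∑ b, (C * rightMat X s₀ k) a b ^ 2 := by
      simp only [dotProduct, sq]; rfl
    rw [← h5, ← h6]
    exact (mul_le_mul_of_nonneg_right h2 (by rw [h5]; positivity)).trans h4
  rw [frobSq, frobSq, Finset.mul_sum]
  exact Finset.sum_le_sum fun a _ => h3 a

end SigmaMin

end TT
end

noncomputable section

namespace TT

variable {N : ℕ} {d : Fin N → ℕ} {r : Fin (N + 1) → ℕ}

/-! ### Rotations of the bonds and the distance of factors. -/

section Rotate

lemma orthogonal_transpose_mul {q : Type*} [Fintype q] [DecidableEq q]
    (R : Matrix.orthogonalGroup q ℝ) : (R : Matrix q q ℝ)ᵀ * (R : Matrix q q ℝ) = 1 :=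
  (Matrix.mem_orthogonalGroup_iff' q ℝ).1 R.2

lemma orthogonal_mul_transpose {q : Type*} [Fintype q] [DecidableEq q]
    (R : Matrix.orthogonalGroup q ℝ) : (R : Matrix q q ℝ) * (R : Matrix q q ℝ)ᵀ = 1 :=
  (Matrix.mem_orthogonalGroup_iff q ℝ).1 R.2

lemma partialProd_rotate (R : Rotations r) (X : Factors d r) (s : (i : Fin N) → Fin (d i))
    (k : Fin (N + 1)) : partialProd (rotate R X) s k =
      partialProd X s k * (R.1 k : Matrix (Fin (r k)) (Fin (r k)) ℝ) := by
  induction k using Fin.induction with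
  | zero => simp [partialProd_zero, R.2.1]
  | succ i ih =>
    rw [partialProd_succ, partialProd_succ, ih, rotate]
    simp only [Matrix.mul_assoc]
    rw [← Matrix.mul_assoc (R.1 i.castSucc).1, orthogonal_mul_transpose,
      Matrix.one_mul]

lemma tensor_rotate (R : Rotations r) (X : Factors d r) : tensor (rotate R X) = tensor X := by
  ext s
  simp [tensor, partialProd_rotate, R.2.2]

lemma leftMat_rotate (s₀ : (i : Fin N) → Fin (d i)) (R : Rotations r) (X : Factors d r)
    (k : Fin (N + 1)) : leftMat (rotate R X) s₀ k =
      leftMat X s₀ k * (R.1 k : Matrix (Fin (r k)) (Fin (r k)) ℝ) := by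
  ext a b
  simp only [leftMat, Matrix.of_apply, partialProd_rotate, Matrix.mul_apply, Finset.sum_mul]
  exact Finset.sum_comm

lemma leftOrthogonal_rotate (R : Rotations r) {X : Factors d r} (hX : LeftOrthogonal X) :
    LeftOrthogonal (rotate R X) := by
  intro i hi
  have h := hX i hi
  rw [leftUnfold_gram] at h ⊢
  have : ∀ x, (rotate R X i x)ᵀ * rotate R X i x =
      (R.1 i.succ : Matrix (Fin (r i.succ)) (Fin (r i.succ)) ℝ)ᵀ * ((X i x)ᵀ * X i x) *
        (R.1 i.succ : Matrix (Fin (r i.succ)) (Fin (r i.succ)) ℝ) := fun x => by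
    simp only [rotate, Matrix.transpose_mul, Matrix.transpose_transpose, Matrix.mul_assoc]
    rw [← Matrix.mul_assoc (R.1 i.castSucc).1, orthogonal_mul_transpose,
      Matrix.one_mul]
  simp_rw [this]
  rw [← Finset.sum_mul, ← Finset.mul_sum, h, Matrix.mul_one, orthogonal_transpose_mul]

/-- The weighted squared distance of two families of factors, without alignment. -/
def gap (M : ℝ) (X Y : Factors d r) : ℝ :=
  ∑ i : Fin N, (if (i : ℕ) + 1 < N then M else 1) * frobSq (leftUnfold (X i) - leftUnfold (Y i))

lemma gap_nonneg {M : ℝ} (hM : 0 ≤ M) (X Y : Factors d r) : 0 ≤ gap M X Y :=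
  Finset.sum_nonneg fun i _ => mul_nonneg (by split_ifs <;> positivity) (frobSq_nonneg _)

lemma normSq_nonneg (T : Tensor d) : 0 ≤ normSq T := Finset.sum_nonneg fun _ _ => sq_nonneg _

lemma distSq_eq (X Xs : Factors d r) :
    distSq X Xs = ⨅ R : Rotations r, gap (normSq (tensor Xs)) X (rotate R Xs) := rfl

lemma distSq_le_gap (X Xs : Factors d r) (R : Rotations r) :
    distSq X Xs ≤ gap (normSq (tensor Xs)) X (rotate R Xs) :=
  ciInf_le ⟨0, by rintro _ ⟨R, rfl⟩; exact gap_nonneg (normSq_nonneg _) _ _⟩ R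

instance : Nonempty (Rotations r) := ⟨⟨fun _ => 1, rfl, rfl⟩⟩

lemma distSq_nonneg (X Xs : Factors d r) : 0 ≤ distSq X Xs :=
  Real.iInf_nonneg fun _ => gap_nonneg (normSq_nonneg _) _ _

/-- Near-minimizers are enough later on, so attainment of the infimum is never needed. -/
lemma exists_gap_lt (X Xs : Factors d r) {η : ℝ} (hη : 0 < η) :
    ∃ R : Rotations r, gap (normSq (tensor Xs)) X (rotate R Xs) < distSq X Xs + η :=
  exists_lt_of_ciInf_lt (by rw [← distSq_eq]; linarith)

end Rotate

/-! ### The factors are controlled by the tensor. -/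

section FactorDistance

variable (s₀ : (i : Fin N) → Fin (d i))

/-- The rows of a prefix matrix that belong to the last index `x`. -/
def sliceMat {e : ℕ} {i : Fin N} (A : Matrix (Pre d ((i.succ : Fin (N + 1)) : ℕ)) (Fin e) ℝ)
    (x : Fin (d i)) : Matrix (Pre d ((i.castSucc : Fin (N + 1)) : ℕ)) (Fin e) ℝ :=
  Matrix.of fun a b => A ((preEquiv d i).symm (a, x)) b

lemma frobSq_eq_sum_sliceMat {e : ℕ} {i : Fin N}
    (A : Matrix (Pre d ((i.succ : Fin (N + 1)) : ℕ)) (Fin e) ℝ) :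
    frobSq A = ∑ x, frobSq (sliceMat A x) := by
  simp only [frobSq, sum_pre_succ, sliceMat, Matrix.of_apply]
  exact Finset.sum_comm

lemma sliceMat_leftMat (X : Factors d r) (i : Fin N) (x : Fin (d i)) :
    sliceMat (leftMat X s₀ i.succ) x = leftMat X s₀ i.castSucc * X i x := by
  ext a b
  rw [sliceMat, Matrix.of_apply, leftMat_succ, Matrix.mul_apply]

/-- Closeness of the prefix matrices before and after position `i` gives closeness of factor `i`. -/
lemma frobSq_leftUnfold_sub_le {X Y : Factors d r} {i : Fin N}
    (hX : (leftMat X s₀ i.castSucc)ᵀ * leftMat X s₀ i.castSucc = 1) :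
    frobSq (leftUnfold (X i) - leftUnfold (Y i)) ≤
      2 * frobSq (leftMat X s₀ i.succ - leftMat Y s₀ i.succ) +
      2 * (frobSq (leftMat X s₀ i.castSucc - leftMat Y s₀ i.castSucc) *
        frobSq (leftUnfold (Y i))) := by
  rw [← leftUnfold_sub, frobSq_leftUnfold, frobSq_leftUnfold, frobSq_eq_sum_sliceMat,
    Finset.mul_sum, Finset.mul_sum, Finset.mul_sum, ← Finset.sum_add_distrib]
  refine Finset.sum_le_sum fun x _ => ?_
  rw [← frobSq_isometry_mul hX]
  -- The product of the prefix matrix of $Y$ with $Y_i(x)$ is inserted, which produces the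
  -- differences at the two neighbouring bonds.
  have h1 : leftMat X s₀ i.castSucc * (X i - Y i) x =
      sliceMat (leftMat X s₀ i.succ - leftMat Y s₀ i.succ) x -
        (leftMat X s₀ i.castSucc - leftMat Y s₀ i.castSucc) * Y i x := by
    have h2 : sliceMat (leftMat X s₀ i.succ - leftMat Y s₀ i.succ) x =
        sliceMat (leftMat X s₀ i.succ) x - sliceMat (leftMat Y s₀ i.succ) x := rfl
    rw [h2, sliceMat_leftMat, sliceMat_leftMat, Matrix.sub_mul, Pi.sub_apply, Matrix.mul_sub]
    abel
  rw [h1]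
  refine (frobSq_sub_le _ _).trans ?_
  have := frobSq_mul_le (leftMat X s₀ i.castSucc - leftMat Y s₀ i.castSucc) (Y i x)
  linarith

lemma frobSq_leftMat_last_sub (hN : r (Fin.last N) = 1) (X Y : Factors d r) :
    frobSq (leftMat X s₀ (Fin.last N) - leftMat Y s₀ (Fin.last N)) =
      normSq (tensor X - tensor Y) := by
  rw [frobSq, normSq, ← Equiv.sum_comp (preLast d)]
  refine Finset.sum_congr rfl fun a _ => ?_
  have : Unique (Fin (r (Fin.last N))) := by rw [hN]; infer_instance
  rw [Fintype.sum_unique, Pi.sub_apply, tensor_eq_leftMat s₀, tensor_eq_leftMat s₀,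
    Fintype.sum_unique, Fintype.sum_unique, Matrix.sub_apply]

/-- The Frobenius norm of a left-orthogonal tensor is that of its last factor. -/
lemma normSq_tensor_of_leftOrthogonal (s₀ : (i : Fin N) → Fin (d i)) (h0 : r 0 = 1) (hN : r (Fin.last N) = 1) {X : Factors d r}
    (hX : LeftOrthogonal X) {i : Fin N} (hi : (i : ℕ) + 1 = N) :
    normSq (tensor X) = frobSq (leftUnfold (X i)) := by
  have h1 : i.succ = Fin.last N := Fin.ext (by simpa using hi)
  have h3 : normSq (tensor X) = frobSq (leftMat X s₀ (Fin.last N)) := by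
    rw [frobSq, normSq, ← Equiv.sum_comp (preLast d)]
    refine Finset.sum_congr rfl fun a _ => ?_
    have : Unique (Fin (r (Fin.last N))) := by rw [hN]; infer_instance
    rw [Fintype.sum_unique, tensor_eq_leftMat s₀, Fintype.sum_unique]
  rw [h3, ← h1, frobSq_eq_sum_sliceMat, frobSq_leftUnfold]
  refine Finset.sum_congr rfl fun x _ => ?_
  rw [sliceMat_leftMat, frobSq_isometry_mul]
  exact leftMat_gram s₀ h0 hX _ (by simp)

/-- Each bond is indexed by the factor on its left. With factors counted from $0$, bonds
$2,\dots,N-1$ belong to factors $1,\dots,N-2$. -/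
lemma rankSum_eq (r : Fin (N + 1) → ℕ) :
    rankSum r = N + 1 + ∑ i : Fin N, if 1 ≤ (i : ℕ) ∧ (i : ℕ) + 1 < N then (r i.succ : ℝ) else 0 := by
  rw [rankSum, innerBonds, Finset.filter_filter, Finset.sum_filter, Fin.sum_univ_succ]
  simp only [Fin.val_zero, Fin.val_succ]
  norm_num
  refine Finset.sum_congr rfl fun i _ => ?_
  congr 1
  exact propext ⟨fun h => ⟨by omega, h.1⟩, fun h => ⟨h.2, by omega⟩⟩

/-- At bond $1$, with $C$ the orthonormal frame itself, the bound reads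
$\underline\sigma^2r_1\le\|\mathcal X^\star\|_F^2$. -/
lemma sigmaMin_sq_le (h2 : 2 ≤ N) (h0 : r 0 = 1) {Xs : Factors d r} (hXs : LeftOrthogonal Xs)
    (hm : Minimal Xs) : sigmaMin r (tensor Xs) ^ 2 ≤ normSq (tensor Xs) := by
  let s₀ : (i : Fin N) → Fin (d i) := fun i => ⟨0, hm.dim_pos h0 i⟩
  have hk : (⟨1, by omega⟩ : Fin (N + 1)) ∈ innerBonds N :=
    mem_innerBonds.2 ⟨le_rfl, by simp; omega⟩
  set k : Fin (N + 1) := ⟨1, by omega⟩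
  have hU' := leftMat_gram s₀ h0 hXs k (mem_innerBonds.1 hk).2
  have h3 := sigmaMin_sq_mul_frobSq_le h0 hXs s₀ hk (leftMat Xs s₀ k)
  rw [← unfolding_tensor, frobSq_unfolding, frobSq_of_isometry hU', Fintype.card_fin] at h3
  have h4 : (1 : ℝ) ≤ r k := by exact_mod_cast hm.pos h0 k
  nlinarith [sq_nonneg (sigmaMin r (tensor Xs))]

/-- The squared distance of the factors is bounded by the squared distance of the tensors. -/
lemma distSq_le (h2 : 2 ≤ N) (h0 : r 0 = 1) (hN : r (Fin.last N) = 1) {X Xs : Factors d r}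
    (hX : LeftOrthogonal X) (hXs : LeftOrthogonal Xs) (hm : Minimal Xs) :
    sigmaMin r (tensor Xs) ^ 2 * distSq X Xs ≤
      4 * rankSum r * normSq (tensor Xs) * normSq (tensor X - tensor Xs) := by
  let s₀ : (i : Fin N) → Fin (d i) := fun i => ⟨0, hm.dim_pos h0 i⟩
  set σ := sigmaMin r (tensor Xs) with hσ
  have hσ0 : 0 < σ := sigmaMin_pos h2 h0 hN hXs hm
  set M := normSq (tensor Xs) with hM
  set e := normSq (tensor X - tensor Xs) with he
  have he0 : 0 ≤ e := normSq_nonneg _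
  have hM0 : 0 ≤ M := normSq_nonneg _
  -- alignment at the inner bonds
  have key : ∀ k ∈ innerBonds N, ∃ R : Matrix.orthogonalGroup (Fin (r k)) ℝ,
      σ ^ 2 * frobSq (leftMat X s₀ k - leftMat Xs s₀ k * (R : Matrix _ _ ℝ)) ≤ 2 * e := by
    intro k hk
    have hkN := (mem_innerBonds.1 hk).2
    have hU := leftMat_gram s₀ h0 hX k hkN
    have hU' := leftMat_gram s₀ h0 hXs k hkN
    obtain ⟨R, hR⟩ := exists_orthogonal_frobSq_sub_le hU hU'
    refine ⟨R, ?_⟩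
    set U := leftMat X s₀ k
    set U' := leftMat Xs s₀ k
    have h3 := sigmaMin_sq_mul_frobSq_le h0 hXs s₀ hk (U' - U * (Uᵀ * U'))
    -- The projection $1-UU^\top$ annihilates the unfolding of `tensor X`, so only the unfolding of
    -- the error is left.
    have h4 : (U' - U * (Uᵀ * U')) * rightMat Xs s₀ k =
        unfolding (tensor Xs - tensor X) k - U * (Uᵀ * unfolding (tensor Xs - tensor X) k) := by
      rw [unfolding_sub, unfolding_tensor X s₀, unfolding_tensor Xs s₀, Matrix.mul_sub,
        Matrix.mul_sub, ← Matrix.mul_assoc Uᵀ U, hU, Matrix.one_mul, Matrix.sub_mul,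
        Matrix.mul_assoc, Matrix.mul_assoc]
      abel
    have h5 : frobSq (unfolding (tensor Xs - tensor X) k -
        U * (Uᵀ * unfolding (tensor Xs - tensor X) k)) ≤ e := by
      set A := unfolding (tensor Xs - tensor X) k
      have h6 : frobSq A = e := by
        rw [frobSq_unfolding, he]
        simp only [normSq, Pi.sub_apply]
        exact Finset.sum_congr rfl fun s _ => by ring
      rw [frobSq_sub, frobSq_isometry_mul hU, fdot_comm, fdot_mul_left, ← frobSq_eq_fdot, h6]
      linarith [frobSq_nonneg (Uᵀ * A)]
    rw [h4, ← hσ] at h3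
    have h6 := mul_le_mul_of_nonneg_left hR (sq_nonneg σ)
    have h7 := h3.trans h5
    refine h6.trans ?_
    rw [mul_left_comm]
    exact mul_le_mul_of_nonneg_left h7 zero_le_two
  choose R hR using key
  let R' : Rotations r := ⟨fun k => if hk : k ∈ innerBonds N then R k hk else 1, by
    constructor <;> exact dif_neg (by simp [mem_innerBonds])⟩
  have hR' : ∀ k (hk : k ∈ innerBonds N), R'.1 k = R k hk := fun k hk => dif_pos hk
  set Y := rotate R' Xs with hY
  have hYl : LeftOrthogonal Y := leftOrthogonal_rotate R' hXs
  have hYt : tensor Y = tensor Xs := tensor_rotate R' Xs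
  let A : Fin (N + 1) → ℝ := fun k => frobSq (leftMat X s₀ k - leftMat Y s₀ k)
  have hA0 : ∀ k, 0 ≤ A k := fun k => frobSq_nonneg _
  have hAk : ∀ k ∈ innerBonds N, σ ^ 2 * A k ≤ 2 * e := fun k hk => by
    have := hR k hk
    simp only [A, hY, leftMat_rotate, hR' k hk]
    exact this
  have hAzero : A 0 = 0 := by
    have : leftMat X s₀ 0 - leftMat Y s₀ 0 = 0 := by
      ext a b; rw [Matrix.sub_apply, leftMat_zero, leftMat_zero]; simp
    simp only [A, this, frobSq_zero]
  have hAlast : A (Fin.last N) = e := by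
    simp only [A]
    rw [frobSq_leftMat_last_sub s₀ hN, hYt]
  have hσM : σ ^ 2 ≤ M := sigmaMin_sq_le h2 h0 hXs hm
  -- A factor before the last costs $4Me(1+r)$, without the rank term for the first factor because
  -- the prefixes at bond $0$ agree. The last factor costs at most $6Me$; the $8Me$ reserved for it
  -- account for the extra $1$ in `rankSum`.
  have hterm : ∀ i : Fin N, σ ^ 2 * ((if (i : ℕ) + 1 < N then M else 1) *
      frobSq (leftUnfold (X i) - leftUnfold (Y i))) ≤
      4 * M * e * ((1 + if (i : ℕ) + 1 = N then 1 else 0) +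
        if 1 ≤ (i : ℕ) ∧ (i : ℕ) + 1 < N then (r i.succ : ℝ) else 0) := by
    intro i
    have h3 := frobSq_leftUnfold_sub_le s₀ (Y := Y) (leftMat_gram s₀ h0 hX i.castSucc i.2)
    change _ ≤ 2 * A i.succ + 2 * (A i.castSucc * frobSq (leftUnfold (Y i))) at h3
    have hc : σ ^ 2 * A i.castSucc ≤ if 1 ≤ (i : ℕ) then 2 * e else 0 := by
      split_ifs with h
      · exact hAk _ (mem_innerBonds.2 ⟨h, i.2⟩)
      · have : i.castSucc = 0 := Fin.ext (by simp; omega)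
        rw [this, hAzero, mul_zero]
    have hMe : 0 ≤ M * e := mul_nonneg hM0 he0
    by_cases hi : (i : ℕ) + 1 < N
    · have h4 : frobSq (leftUnfold (Y i)) = r i.succ := by
        rw [frobSq_of_isometry (hYl i hi), Fintype.card_fin]
      have h5 := hAk i.succ (mem_innerBonds.2 ⟨by simp, by simpa using hi⟩)
      rw [h4] at h3
      have hr0 : (0 : ℝ) ≤ r i.succ := Nat.cast_nonneg _
      rw [if_pos hi, if_neg hi.ne]
      have h6 : σ ^ 2 * frobSq (leftUnfold (X i) - leftUnfold (Y i)) ≤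
          4 * e * (1 + if 1 ≤ (i : ℕ) then (r i.succ : ℝ) else 0) := by
        have h7 := mul_le_mul_of_nonneg_left h3 (sq_nonneg σ)
        have h8 := mul_le_mul_of_nonneg_right hc hr0
        split_ifs at h8 ⊢ <;> nlinarith
      have h7 := mul_le_mul_of_nonneg_left h6 hM0
      simp only [hi, and_true]
      nlinarith
    · have hiN : (i : ℕ) + 1 = N := by have := i.2; omega
      have h4 : frobSq (leftUnfold (Y i)) = M := by
        rw [← normSq_tensor_of_leftOrthogonal s₀ h0 hN hYl hiN, hYt]
      have h5 : A i.succ = e := by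
        rw [← hAlast]; congr 1; exact Fin.ext (by simpa using hiN)
      rw [h4, h5] at h3
      rw [if_neg hi, if_pos hiN]
      have hc' : σ ^ 2 * A i.castSucc ≤ 2 * e := hc.trans (by split_ifs <;> linarith)
      have h8 := mul_le_mul_of_nonneg_right hc' hM0
      have h7 := mul_le_mul_of_nonneg_left h3 (sq_nonneg σ)
      have h9 := mul_le_mul_of_nonneg_right hσM he0
      simp only [hi, and_false, if_false]
      nlinarith
  have hle := mul_le_mul_of_nonneg_left (distSq_le_gap X Xs R') (sq_nonneg σ)
  refine hle.trans ?_
  rw [gap, Finset.mul_sum]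
  refine (Finset.sum_le_sum fun i _ => hterm i).trans ?_
  rw [← Finset.mul_sum, Finset.sum_add_distrib, Finset.sum_add_distrib, rankSum_eq]
  have hlast : (∑ i : Fin N, if (i : ℕ) + 1 = N then (1 : ℝ) else 0) = 1 := by
    rw [Finset.sum_eq_single (⟨N - 1, by omega⟩ : Fin N)]
    · rw [if_pos (by simp; omega)]
    · intro b _ hb
      rw [if_neg]
      intro h
      exact hb (Fin.ext (by simp; omega))
    · simp
  rw [hlast]
  simp only [Finset.sum_const, Finset.card_univ, Fintype.card_fin, nsmul_eq_mul, mul_one]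
  apply le_of_eq; ring

end FactorDistance

end TT
end

noncomputable section

namespace TT

variable {N : ℕ} {d : Fin N → ℕ} {r : Fin (N + 1) → ℕ}

/-! ### The norm of a tensor. -/

section TensorNorm

/-- The Frobenius norm of a tensor. -/
def tnorm (T : Tensor d) : ℝ := √(normSq T)

lemma tnorm_eq_norm (T : Tensor d) : tnorm T = ‖(WithLp.toLp 2 T : EuclideanSpace ℝ _)‖ := by
  simp [tnorm, normSq, EuclideanSpace.norm_eq]

lemma tnorm_nonneg (T : Tensor d) : 0 ≤ tnorm T := Real.sqrt_nonneg _

lemma tnorm_sq (T : Tensor d) : tnorm T ^ 2 = normSq T := Real.sq_sqrt (normSq_nonneg T)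

lemma tnorm_add_le (S T : Tensor d) : tnorm (S + T) ≤ tnorm S + tnorm T := by
  simp only [tnorm_eq_norm, WithLp.toLp_add]; exact norm_add_le _ _

lemma tnorm_sub_comm (S T : Tensor d) : tnorm (S - T) = tnorm (T - S) := by
  simp only [tnorm_eq_norm, WithLp.toLp_sub]; exact norm_sub_rev _ _

lemma tnorm_zero : tnorm (0 : Tensor d) = 0 := by simp [tnorm, normSq]

lemma tnorm_sum_le {ι : Type*} (s : Finset ι) (f : ι → Tensor d) :
    tnorm (∑ i ∈ s, f i) ≤ ∑ i ∈ s, tnorm (f i) := by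
  classical
  induction s using Finset.induction_on with
  | empty => simp [tnorm_zero]
  | insert a s ha ih =>
    rw [Finset.sum_insert ha, Finset.sum_insert ha]
    exact (tnorm_add_le _ _).trans (by linarith)

/-- The inner product with a fixed tensor as a linear form. -/
def innerₗ (S : Tensor d) : Tensor d →ₗ[ℝ] ℝ where
  toFun T := inner S T
  map_add' T T' := by simp [inner, mul_add, Finset.sum_add_distrib]
  map_smul' c T := by simp [inner, Finset.mul_sum, mul_left_comm]

lemma innerₗ_apply (S T : Tensor d) : innerₗ S T = inner S T := rfl

lemma abs_inner_le (S T : Tensor d) : |inner S T| ≤ tnorm S * tnorm T := by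
  rw [tnorm, tnorm, ← Real.sqrt_mul (normSq_nonneg S)]
  exact Real.abs_le_sqrt (Finset.sum_mul_sq_le_sq_mul_sq _ _ _)

lemma tnorm_tensor_le (h0 : r 0 = 1) (hN : r (Fin.last N) = 1) (X : Factors d r) (b : Fin N → ℝ)
    (hb : ∀ i, OpBound (leftUnfold (X i)) (b i)) (hb0 : ∀ i, 0 ≤ b i) :
    tnorm (tensor X) ≤ ∏ j, b j :=
  Real.sqrt_le_iff.2 ⟨Finset.prod_nonneg fun i _ => hb0 i, normSq_tensor_le h0 hN X b hb⟩

end TensorNorm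

/-! ### Sums of TT tensors are TT tensors of larger ranks. -/

section Sums

/-- The tensor is a sum of `J` tensors with factors of sizes `r`. -/
def IsTTSum (r : Fin (N + 1) → ℕ) (J : ℕ) (T : Tensor d) : Prop :=
  ∃ Y : Fin J → Factors d r, T = ∑ j, tensor (Y j)

lemma isTTSum_tensor (X : Factors d r) : IsTTSum r 1 (tensor X) := ⟨fun _ => X, by simp⟩

lemma IsTTSum.add {J K : ℕ} {S T : Tensor d} (hS : IsTTSum r J S) (hT : IsTTSum r K T) :
    IsTTSum r (J + K) (S + T) := by
  obtain ⟨Y, rfl⟩ := hS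
  obtain ⟨Z, rfl⟩ := hT
  exact ⟨Fin.append Y Z, by simp [Fin.sum_univ_add]⟩

lemma exists_tensor_smul (hN : 0 < N) (c : ℝ) (X : Factors d r) :
    ∃ Y : Factors d r, tensor Y = c • tensor X := by
  refine ⟨Function.update X ⟨0, hN⟩ (c • X ⟨0, hN⟩), ?_⟩
  rw [tensor_update_smul, Function.update_eq_self]

lemma IsTTSum.smul (hN : 0 < N) (c : ℝ) {J : ℕ} {T : Tensor d} (hT : IsTTSum r J T) :
    IsTTSum r J (c • T) := by
  obtain ⟨Y, rfl⟩ := hT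
  choose Z hZ using fun j => exists_tensor_smul hN c (Y j)
  exact ⟨Z, by simp_rw [hZ, Finset.smul_sum]⟩

lemma IsTTSum.sub (hN : 0 < N) {J K : ℕ} {S T : Tensor d} (hS : IsTTSum r J S)
    (hT : IsTTSum r K T) : IsTTSum r (J + K) (S - T) := by
  have := hS.add (hT.smul hN (-1))
  rwa [neg_one_smul, ← sub_eq_add_neg] at this

lemma isTTSum_zero (hN : 0 < N) (J : ℕ) : IsTTSum r J (0 : Tensor d) := by
  obtain ⟨Y, hY⟩ := exists_tensor_smul hN 0 (0 : Factors d r)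
  exact ⟨fun _ => Y, by simp [hY]⟩

lemma IsTTSum.mono (hN : 0 < N) {J K : ℕ} (h : J ≤ K) {T : Tensor d} (hT : IsTTSum r J T) :
    IsTTSum r K T := by
  obtain ⟨m, rfl⟩ := Nat.exists_eq_add_of_le h
  simpa using hT.add (isTTSum_zero hN m)

lemma isTTSum_sum_tensorAt (X : Factors d r)
    (V : (i : Fin N) → Fin (d i) → Matrix (Fin (r i.castSucc)) (Fin (r i.succ)) ℝ) :
    IsTTSum r N (∑ i, tensorAt X i (V i)) :=
  ⟨fun i => Function.update X i (V i), rfl⟩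

/-- The block diagonal family of factors. -/
def blockFactors {J : ℕ} (Y : Fin J → Factors d r) : Factors d (fun k => J * r k) :=
  fun i x => Matrix.of fun a b =>
    if (finProdFinEquiv.symm a).1 = (finProdFinEquiv.symm b).1 then
      Y (finProdFinEquiv.symm a).1 i x (finProdFinEquiv.symm a).2 (finProdFinEquiv.symm b).2 else 0

lemma partialProd_blockFactors {J : ℕ} (Y : Fin J → Factors d r) (s : (i : Fin N) → Fin (d i))
    (k : Fin (N + 1)) (a : Fin J × Fin (r 0)) (b : Fin J × Fin (r k)) :
    partialProd (blockFactors Y) s k (finProdFinEquiv a) (finProdFinEquiv b) =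
      if a.1 = b.1 then partialProd (Y a.1) s k a.2 b.2 else 0 := by
  induction k using Fin.induction with
  | zero =>
    obtain ⟨a1, a2⟩ := a
    obtain ⟨b1, b2⟩ := b
    simp [partialProd_zero, Matrix.one_apply, ite_and]
  | succ i ih =>
    rw [partialProd_succ, Matrix.mul_apply, ← Equiv.sum_comp finProdFinEquiv]
    simp only [ih, Fintype.sum_prod_type, blockFactors, Matrix.of_apply, Equiv.symm_apply_apply]
    simp only [ite_mul, zero_mul]
    rw [Finset.sum_eq_single a.1]
    · simp only [if_true, partialProd_succ, Matrix.mul_apply]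
      split_ifs <;> simp
    · intro j _ hj
      simp [Ne.symm hj]
    · simp

/-- Since `tensor` adds up all entries of the final product, only the diagonal blocks contribute,
whatever the sizes of the ends. -/
lemma tensor_blockFactors {J : ℕ} (Y : Fin J → Factors d r) :
    tensor (blockFactors Y) = ∑ j, tensor (Y j) := by
  ext s
  have h : ∀ a b, partialProd (blockFactors Y) s (Fin.last N) a b =
      if (finProdFinEquiv.symm a).1 = (finProdFinEquiv.symm b).1 then
        partialProd (Y (finProdFinEquiv.symm a).1) s (Fin.last N) (finProdFinEquiv.symm a).2
          (finProdFinEquiv.symm b).2 else 0 := fun a b => by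
    rw [← partialProd_blockFactors, Equiv.apply_symm_apply, Equiv.apply_symm_apply]
  simp only [tensor, Finset.sum_apply, h]
  rw [← Equiv.sum_comp finProdFinEquiv, Fintype.sum_prod_type]
  refine Finset.sum_congr rfl fun j _ => Finset.sum_congr rfl fun a _ => ?_
  rw [← Equiv.sum_comp finProdFinEquiv, Fintype.sum_prod_type]
  simp

/-- The sizes `q` with the end bonds replaced by `1`. -/
def innerSizes (q : Fin (N + 1) → ℕ) : Fin (N + 1) → ℕ :=
  fun k => if k ∈ innerBonds N then q k else 1

lemma innerSizes_of_mem (q : Fin (N + 1) → ℕ) {k : Fin (N + 1)} (hk : k ∈ innerBonds N) :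
    innerSizes q k = q k := if_pos hk

lemma innerSizes_zero (q : Fin (N + 1) → ℕ) : innerSizes q 0 = 1 :=
  if_neg (by simp [mem_innerBonds])

lemma innerSizes_last (q : Fin (N + 1) → ℕ) : innerSizes q (Fin.last N) = 1 :=
  if_neg (by simp [mem_innerBonds])

/-- The matrix that adds up all entries at an end bond and is the identity at an inner bond. -/
def endMat (q : Fin (N + 1) → ℕ) (k : Fin (N + 1)) :
    Matrix (Fin (innerSizes q k)) (Fin (q k)) ℝ :=
  Matrix.of fun a b => if k ∈ innerBonds N then (if (a : ℕ) = b then 1 else 0) else 1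

lemma endMat_gram (q : Fin (N + 1) → ℕ) {k : Fin (N + 1)} (hk : k ∈ innerBonds N) :
    (endMat q k)ᵀ * endMat q k = 1 := by
  have key : ∀ {m n : ℕ} (_ : m = n),
      (Matrix.of fun (a : Fin m) (b : Fin n) => if (a : ℕ) = b then (1 : ℝ) else 0)ᵀ *
        (Matrix.of fun (a : Fin m) (b : Fin n) => if (a : ℕ) = b then (1 : ℝ) else 0) = 1 := by
    rintro m _ rfl
    have : (Matrix.of fun (a b : Fin m) => if (a : ℕ) = b then (1 : ℝ) else 0) = 1 := by
      ext a b
      simp [Matrix.one_apply, Fin.ext_iff]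
    rw [this]; simp
  have h := key (innerSizes_of_mem q hk)
  convert h using 3 <;> · ext a b; simp [endMat, hk]

lemma endMat_of_notMem (q : Fin (N + 1) → ℕ) {k : Fin (N + 1)} (hk : k ∉ innerBonds N)
    (a : Fin (innerSizes q k)) (b : Fin (q k)) : endMat q k a b = 1 := by
  simp [endMat, hk]

/-- The family of factors with the sizes of the end bonds reduced to `1`. -/
def collapse {q : Fin (N + 1) → ℕ} (Z : Factors d q) : Factors d (innerSizes q) :=
  fun i x => endMat q i.castSucc * Z i x * (endMat q i.succ)ᵀ

/-- Inserted matrices cancel at inner bonds. Bond $0$ is excluded: there the partial product is an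
identity, and the first multiplication absorbs the end matrix. -/
lemma partialProd_collapse {q : Fin (N + 1) → ℕ} (Z : Factors d q) (s : (i : Fin N) → Fin (d i))
    (k : Fin (N + 1)) (hk : k ≠ 0) :
    partialProd (collapse Z) s k =
      endMat q 0 * partialProd Z s k * (endMat q k)ᵀ := by
  induction k using Fin.induction with
  | zero => exact absurd rfl hk
  | succ i ih =>
    rw [partialProd_succ, partialProd_succ]
    by_cases h : i.castSucc = 0
    · have h2 : ∀ k : Fin (N + 1), k = 0 → ∀ {e : ℕ} (A : Matrix (Fin (q k)) (Fin e) ℝ),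
          partialProd (collapse Z) s k * (endMat q k * A) =
            endMat q 0 * (partialProd Z s k * A) := by
        rintro _ rfl e A
        rw [partialProd_zero, partialProd_zero, Matrix.one_mul, Matrix.one_mul]
      rw [collapse, Matrix.mul_assoc (endMat q i.castSucc), h2 _ h]
      simp only [Matrix.mul_assoc]
    · have h3 : i.castSucc ∈ innerBonds N := by
        rw [mem_innerBonds]
        refine ⟨?_, i.2⟩
        rw [Nat.one_le_iff_ne_zero]
        exact fun h' => h (Fin.ext h')
      rw [ih h, collapse]
      simp only [Matrix.mul_assoc]
      rw [← Matrix.mul_assoc (endMat q i.castSucc)ᵀ, endMat_gram q h3, Matrix.one_mul]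

/-- The all-ones end matrices carry out the summation over the end indices. This restores end bonds
of size $1$, which `RIP` demands and block sums violate. -/
lemma tensor_collapse (hN : 0 < N) {q : Fin (N + 1) → ℕ} (Z : Factors d q) :
    tensor (collapse Z) = tensor Z := by
  ext s
  have hl : Fin.last N ≠ 0 := fun h => by
    have := congrArg Fin.val h; simp at this; omega
  have h0 : Unique (Fin (innerSizes q 0)) := by rw [innerSizes_zero]; infer_instance
  have h1 : Unique (Fin (innerSizes q (Fin.last N))) := by rw [innerSizes_last]; infer_instance
  simp only [tensor, partialProd_collapse Z s _ hl, Fintype.sum_unique, Matrix.mul_apply,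
    one_mul, Matrix.transpose_apply, endMat_of_notMem q (k := 0) (by simp [mem_innerBonds]),
    endMat_of_notMem q (k := Fin.last N) (by simp [mem_innerBonds]), mul_one]
  exact Finset.sum_comm

lemma exists_factors_of_isTTSum (hN : 0 < N) {J : ℕ} {T : Tensor d} (hT : IsTTSum r J T) :
    ∃ Z : Factors d (innerSizes fun k => J * r k), tensor Z = T := by
  obtain ⟨Y, rfl⟩ := hT
  exact ⟨collapse (blockFactors Y), by rw [tensor_collapse hN, tensor_blockFactors]⟩

lemma le_maxRank (r : Fin (N + 1) → ℕ) {k : Fin (N + 1)} (hk : k ∈ innerBonds N) :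
    r k ≤ maxRank r := Finset.le_sup (f := r) hk

/-- The restricted isometry property for sums of tensors. -/
lemma RIP.isTTSum (hN : 0 < N) {m : ℕ} {A : Fin m → Tensor d} {δ : ℝ} {J : ℕ}
    (h : RIP A (J * maxRank r) δ) {T : Tensor d} (hT : IsTTSum r J T) :
    (1 - δ) * normSq T ≤ 1 / (m : ℝ) * ∑ k, inner (A k) T ^ 2 ∧
      1 / (m : ℝ) * ∑ k, inner (A k) T ^ 2 ≤ (1 + δ) * normSq T := by
  obtain ⟨Z, rfl⟩ := exists_factors_of_isTTSum hN hT
  refine h _ (innerSizes_zero _) (innerSizes_last _) (fun k hk => ?_) Z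
  rw [innerSizes_of_mem _ hk]
  exact Nat.mul_le_mul_left _ (le_maxRank r hk)

end Sums

end TT
end

noncomputable section

namespace TT

variable {N : ℕ} {d : Fin N → ℕ} {r : Fin (N + 1) → ℕ}

/-! ### First order expansion of the tensor in its factors. -/

section FirstOrder

lemma OpBound.mono {p q : Type*} [Fintype p] [Fintype q] {A : Matrix p q ℝ} {c c' : ℝ}
    (h : OpBound A c) (hc : 0 ≤ c) (hcc : c ≤ c') : OpBound A c' := fun v =>
  (h v).trans (mul_le_mul_of_nonneg_right (pow_le_pow_left₀ hc hcc 2)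
    (by simp only [dotProduct]; exact Finset.sum_nonneg fun _ _ => mul_self_nonneg _))

/-- The Frobenius norm of a factor. -/
def fnorm {e a b : ℕ} (V : Fin e → Matrix (Fin a) (Fin b) ℝ) : ℝ := √(frobSq (leftUnfold V))

lemma fnorm_nonneg {e a b : ℕ} (V : Fin e → Matrix (Fin a) (Fin b) ℝ) : 0 ≤ fnorm V :=
  Real.sqrt_nonneg _

lemma fnorm_sq {e a b : ℕ} (V : Fin e → Matrix (Fin a) (Fin b) ℝ) :
    fnorm V ^ 2 = frobSq (leftUnfold V) := Real.sq_sqrt (frobSq_nonneg _)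

lemma opBound_fnorm {e a b : ℕ} (V : Fin e → Matrix (Fin a) (Fin b) ℝ) :
    OpBound (leftUnfold V) (fnorm V) := opBound_sqrt_frobSq _

variable (h0 : r 0 = 1) (hN : r (Fin.last N) = 1) {X Y : Factors d r}

lemma prod_ite_eq_const (i : Fin N) (c : ℝ) : (∏ k : Fin N, if k = i then c else 1) = c := by
  simp

/-- The product of the weights `B` of the last position if it is not position `i`. -/
lemma prod_last_weight (i : Fin N) (B : ℝ) :
    (∏ k : Fin N, if (k : ℕ) + 1 = N ∧ (i : ℕ) + 1 < N then B else 1) =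
      if (i : ℕ) + 1 < N then B else 1 := by
  have hl : N - 1 < N := by have := i.2; omega
  by_cases hi : (i : ℕ) + 1 < N
  · simp only [hi, and_true, if_true]
    have : ∀ k : Fin N, (k : ℕ) + 1 = N ↔ k = ⟨N - 1, hl⟩ := fun k => by
      rw [Fin.ext_iff]; simp only; omega
    simp [this]
  · simp [hi]

include h0 hN in
-- Bounds multiply along the train: factor $i$ contributes its Frobenius norm, the other orthonormal
-- factors $1$, and the last factor $B$ unless it is the one replaced.
lemma tnorm_tensorAt_le (hX : LeftOrthogonal X) {B : ℝ} (hB : 0 ≤ B)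
    (hXB : ∀ i : Fin N, (i : ℕ) + 1 = N → fnorm (X i) ≤ B) (i : Fin N)
    (V : Fin (d i) → Matrix (Fin (r i.castSucc)) (Fin (r i.succ)) ℝ) :
    tnorm (tensorAt X i V) ≤ fnorm V * (if (i : ℕ) + 1 < N then B else 1) := by
  have key := tnorm_tensor_le h0 hN (Function.update X i V)
    (fun k => (if k = i then fnorm V else 1) *
      (if (k : ℕ) + 1 = N ∧ (i : ℕ) + 1 < N then B else 1)) ?_ ?_
  · rwa [Finset.prod_mul_distrib, prod_ite_eq_const, prod_last_weight] at key
  · intro k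
    by_cases hk : k = i
    · subst hk
      have : ¬ ((k : ℕ) + 1 = N ∧ (k : ℕ) + 1 < N) := by omega
      rw [Function.update_self, if_pos rfl, if_neg this, mul_one]
      exact opBound_fnorm V
    · rw [Function.update_of_ne hk, if_neg hk, one_mul]
      by_cases hkN : (k : ℕ) + 1 = N
      · have : (i : ℕ) + 1 < N := by
          have := i.2; have : (k : ℕ) ≠ i := fun h => hk (Fin.ext h); omega
        rw [if_pos ⟨hkN, this⟩]
        exact (opBound_fnorm (X k)).mono (fnorm_nonneg _) (hXB k hkN)
      · rw [if_neg (fun h => hkN h.1)]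
        exact opBound_one_of_isometry (hX k (by have := k.2; omega))
  · intro k
    have := fnorm_nonneg V
    split_ifs <;> simp <;> positivity

include h0 hN in
/-- A change of two factors. -/
lemma tnorm_tensorAt_pair_le (hX : LeftOrthogonal X) (hY : LeftOrthogonal Y) {B : ℝ} (hB : 0 ≤ B)
    (hXB : ∀ i : Fin N, (i : ℕ) + 1 = N → fnorm (X i) ≤ B) (i j : Fin N) (hji : (j : ℕ) < i)
    (V : Fin (d i) → Matrix (Fin (r i.castSucc)) (Fin (r i.succ)) ℝ)
    (W : Fin (d j) → Matrix (Fin (r j.castSucc)) (Fin (r j.succ)) ℝ) :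
    tnorm (tensorAt (mix (Function.update X i V) (Function.update (mix X Y i) i V) j) j W) ≤
      fnorm W * (fnorm V * (if (i : ℕ) + 1 < N then B else 1)) := by
  have hij : i ≠ j := by rintro rfl; exact lt_irrefl _ hji
  have key := tnorm_tensor_le h0 hN (Function.update
    (mix (Function.update X i V) (Function.update (mix X Y i) i V) j) j W)
    (fun k => (if k = j then fnorm W else 1) * ((if k = i then fnorm V else 1) *
      (if (k : ℕ) + 1 = N ∧ (i : ℕ) + 1 < N then B else 1))) ?_ ?_
  · rwa [Finset.prod_mul_distrib, Finset.prod_mul_distrib, prod_ite_eq_const, prod_ite_eq_const,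
      prod_last_weight] at key
  · intro k
    by_cases hk : k = j
    · subst hk
      have : ¬ ((k : ℕ) + 1 = N ∧ (i : ℕ) + 1 < N) := by have := i.2; omega
      rw [Function.update_self, if_pos rfl, if_neg this, if_neg hij.symm, mul_one, mul_one]
      exact opBound_fnorm W
    · rw [Function.update_of_ne hk, if_neg hk, one_mul]
      by_cases hki : k = i
      · subst hki
        have : ¬ ((k : ℕ) + 1 = N ∧ (k : ℕ) + 1 < N) := by omega
        rw [mix_of_le hji.le, Function.update_self, if_pos rfl, if_neg this, mul_one]
        exact opBound_fnorm V
      · rw [if_neg hki, one_mul]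
        by_cases hkN : (k : ℕ) + 1 = N
        · have h1 : (k : ℕ) ≠ i := fun h => hki (Fin.ext h)
          have h2 : (i : ℕ) + 1 < N := by have := i.2; omega
          rw [if_pos ⟨hkN, h2⟩, mix_of_le (by omega), Function.update_of_ne hki]
          exact (opBound_fnorm (X k)).mono (fnorm_nonneg _) (hXB k hkN)
        · rw [if_neg (fun h => hkN h.1)]
          have hkN' : (k : ℕ) + 1 < N := by have := k.2; omega
          refine opBound_one_of_isometry ?_
          by_cases h1 : (k : ℕ) < j
          · rw [mix_of_lt h1, Function.update_of_ne hki, mix_of_lt (h1.trans hji)]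
            exact hY k hkN'
          · rw [mix_of_le (not_lt.1 h1), Function.update_of_ne hki]
            exact hX k hkN'
  · intro k
    have := fnorm_nonneg V
    have := fnorm_nonneg W
    split_ifs <;> simp <;> positivity

include h0 hN in
/-- The error of the first order expansion of the tensor in its factors. -/
lemma tnorm_sum_tensorAt_sub_le (hX : LeftOrthogonal X) (hY : LeftOrthogonal Y) {B : ℝ}
    (hB : 0 ≤ B) (hXB : ∀ i : Fin N, (i : ℕ) + 1 = N → fnorm (X i) ≤ B) :
    tnorm (∑ i, tensorAt X i (X i - Y i) - (tensor X - tensor Y)) ≤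
      ∑ i : Fin N, ∑ j : Fin N, if (j : ℕ) < i then
        fnorm (X j - Y j) * (fnorm (X i - Y i) * (if (i : ℕ) + 1 < N then B else 1)) else 0 := by
  rw [tensor_sub_eq_sum, ← Finset.sum_sub_distrib]
  refine (tnorm_sum_le _ _).trans (Finset.sum_le_sum fun i _ => ?_)
  -- The two tensors differ only in factors before $i$, so a second telescoping leaves the pairs
  -- $j<i$.
  rw [tensorAt_apply, tensorAt_apply, tensor_sub_eq_sum]
  refine (tnorm_sum_le _ _).trans (Finset.sum_le_sum fun j _ => ?_)
  by_cases hji : (j : ℕ) < i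
  · have hij : j ≠ i := by rintro rfl; exact lt_irrefl _ hji
    rw [if_pos hji, Function.update_of_ne hij, Function.update_of_ne hij, mix_of_lt hji]
    exact tnorm_tensorAt_pair_le h0 hN hX hY hB hXB i j hji _ _
  · have : Function.update X i (X i - Y i) j - Function.update (mix X Y i) i (X i - Y i) j = 0 := by
      by_cases hij : j = i
      · subst hij; simp
      · rw [Function.update_of_ne hij, Function.update_of_ne hij, mix_of_le (not_lt.1 hji), sub_self]
    rw [this, map_zero, tnorm_zero, if_neg hji]

/-- Twice the sum over pairs plus the sum of squares is the square of the sum. -/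
lemma two_mul_sum_lt_add_sum_sq (u : Fin N → ℝ) :
    2 * (∑ i : Fin N, ∑ j : Fin N, if (j : ℕ) < i then u j * u i else 0) + ∑ i, u i ^ 2 =
      (∑ i, u i) ^ 2 := by
  have h1 : (∑ i : Fin N, ∑ j : Fin N, if (j : ℕ) < i then u j * u i else 0) =
      ∑ i : Fin N, ∑ j : Fin N, if (i : ℕ) < j then u j * u i else 0 := by
    rw [Finset.sum_comm]
    refine Finset.sum_congr rfl fun i _ => Finset.sum_congr rfl fun j _ => ?_
    rw [mul_comm]
  have h2 : ∑ i, u i ^ 2 = ∑ i : Fin N, ∑ j : Fin N, if i = j then u j * u i else 0 := by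
    simp [sq]
  rw [two_mul]
  nth_rewrite 2 [h1]
  rw [h2, ← Finset.sum_add_distrib, ← Finset.sum_add_distrib, sq, Finset.sum_mul_sum]
  refine Finset.sum_congr rfl fun i _ => ?_
  rw [← Finset.sum_add_distrib, ← Finset.sum_add_distrib]
  refine Finset.sum_congr rfl fun j _ => ?_
  rcases lt_trichotomy (j : ℕ) i with h | h | h
  · have h' : ¬ (i : ℕ) < j := by omega
    have h'' : i ≠ j := by rintro rfl; exact lt_irrefl _ h
    simp [h, h', h'', mul_comm]
  · have h' : i = j := Fin.ext h.symm
    subst h'; simp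
  · have h' : ¬ (j : ℕ) < i := by omega
    have h'' : i ≠ j := by rintro rfl; exact lt_irrefl _ h
    simp [h, h', h'', mul_comm]

/-- The weighted distance of the factors at position `i`. -/
def gapAt (μ : ℝ) (X Y : Factors d r) (i : Fin N) : ℝ :=
  (if (i : ℕ) + 1 < N then μ else 1) * fnorm (X i - Y i)

lemma sum_gapAt_sq (μ : ℝ) (X Y : Factors d r) : ∑ i, gapAt μ X Y i ^ 2 = gap (μ ^ 2) X Y := by
  refine Finset.sum_congr rfl fun i _ => ?_
  rw [gapAt, mul_pow, fnorm_sq, leftUnfold_sub]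
  split_ifs <;> simp

lemma sq_sum_gapAt_le (μ : ℝ) (X Y : Factors d r) :
    (∑ i, gapAt μ X Y i) ^ 2 ≤ N * gap (μ ^ 2) X Y := by
  rw [← sum_gapAt_sq]
  have := sq_sum_le_card_mul_sum_sq (s := (Finset.univ : Finset (Fin N))) (f := gapAt μ X Y)
  simpa using this

include h0 hN in
/-- The first order expansion, with the factors in terms of the weighted distance. -/
lemma tnorm_sum_tensorAt_sub_le_pairs (hX : LeftOrthogonal X) (hY : LeftOrthogonal Y) {μ : ℝ}
    (hμ : 0 < μ) (hXB : ∀ i : Fin N, (i : ℕ) + 1 = N → fnorm (X i) ≤ 3 / 2 * μ) :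
    tnorm (∑ i, tensorAt X i (X i - Y i) - (tensor X - tensor Y)) ≤
      3 / (2 * μ) * ∑ i : Fin N, ∑ j : Fin N,
        if (j : ℕ) < i then gapAt μ X Y j * gapAt μ X Y i else 0 := by
  refine (tnorm_sum_tensorAt_sub_le h0 hN hX hY (by positivity) hXB).trans ?_
  rw [Finset.mul_sum]
  refine Finset.sum_le_sum fun i _ => ?_
  rw [Finset.mul_sum]
  refine Finset.sum_le_sum fun j _ => ?_
  split_ifs with hji hi
  · have hj : (j : ℕ) + 1 < N := by omega
    rw [gapAt, gapAt, if_pos hi, if_pos hj]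
    apply le_of_eq
    field_simp
  · have hj : (j : ℕ) + 1 < N := by have := i.2; omega
    rw [gapAt, gapAt, if_neg hi, if_pos hj]
    have := mul_nonneg (fnorm_nonneg (X j - Y j)) (fnorm_nonneg (X i - Y i))
    have h2 : 3 / (2 * μ) * (μ * fnorm (X j - Y j) * (1 * fnorm (X i - Y i))) =
        3 / 2 * (fnorm (X j - Y j) * fnorm (X i - Y i)) := by field_simp
    rw [h2]; linarith
  · simp

include h0 hN in
/-- The tensor is Lipschitz in the weighted distance of the factors. -/
lemma tnorm_sub_sq_le (hX : LeftOrthogonal X) (hY : LeftOrthogonal Y) {μ : ℝ}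
    (hμ : 0 < μ) (hXB : ∀ i : Fin N, (i : ℕ) + 1 = N → fnorm (X i) ≤ 3 / 2 * μ) :
    tnorm (tensor X - tensor Y) ^ 2 ≤ 9 / 4 * N * gap (μ ^ 2) X Y := by
  have h1 : tnorm (tensor X - tensor Y) ≤ 3 / 2 * ∑ i, gapAt μ X Y i := by
    rw [tensor_sub_eq_sum, Finset.mul_sum]
    refine (tnorm_sum_le _ _).trans (Finset.sum_le_sum fun i _ => ?_)
    have hmix : LeftOrthogonal (mix X Y i) := fun k hk => by
      by_cases h : (k : ℕ) < i
      · rw [mix_of_lt h]; exact hY k hk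
      · rw [mix_of_le (not_lt.1 h)]; exact hX k hk
    refine (tnorm_tensorAt_le h0 hN hmix (B := 3 / 2 * μ) (by positivity) (fun k hk => ?_) i
      (X i - Y i)).trans ?_
    · rw [mix_of_le (by have := i.2; omega)]
      exact hXB k hk
    · rw [gapAt]
      have := fnorm_nonneg (X i - Y i)
      split_ifs <;> nlinarith
  have h2 := pow_le_pow_left₀ (tnorm_nonneg _) h1 2
  have h3 := sq_sum_gapAt_le μ X Y
  nlinarith

end FirstOrder

/-! ### The gradient of the loss. -/

section Gradient

variable {m : ℕ} (A : Fin m → Tensor d) (y : Fin m → ℝ)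

/-- The derivative of the loss in the direction of a tensor. -/
def lossDir (T S : Tensor d) : ℝ := 1 / (m : ℝ) * ∑ k, (inner (A k) T - y k) * inner (A k) S

/-- The derivative of the loss as a linear form. -/
def lossDirₗ (T : Tensor d) : Tensor d →ₗ[ℝ] ℝ :=
  (1 / (m : ℝ)) • ∑ k, (inner (A k) T - y k) • innerₗ (A k)

lemma lossDirₗ_apply (T S : Tensor d) : lossDirₗ A y T S = lossDir A y T S := by
  simp [lossDirₗ, lossDir, innerₗ_apply]

/-- A linear form on a space of matrices is the inner product with the matrix of its values. -/
lemma fdot_of_single {p q : Type*} [Fintype p] [Fintype q] [DecidableEq p] [DecidableEq q]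
    (f : Matrix p q ℝ →ₗ[ℝ] ℝ) (B : Matrix p q ℝ) :
    fdot (Matrix.of fun a b => f (Matrix.single a b 1)) B = f B := by
  conv_rhs => rw [Matrix.matrix_eq_sum_single B]
  simp only [map_sum, fdot, Matrix.of_apply]
  refine Finset.sum_congr rfl fun a _ => Finset.sum_congr rfl fun b _ => ?_
  have : Matrix.single a b (B a b) = B a b • Matrix.single a b (1 : ℝ) := by
    rw [Matrix.smul_single, smul_eq_mul, mul_one]
  rw [this, map_smul, smul_eq_mul, mul_comm]

/-- The tensor is affine along a change of one factor, so the loss is a quadratic polynomial in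
$\tau$. For $m=0$ both sides vanish. -/
lemma leftGrad_loss_apply (X : Factors d r) (i : Fin N) (p : Fin (d i) × Fin (r i.castSucc))
    (b : Fin (r i.succ)) : leftGrad (loss A y) X i p b =
      lossDir A y (tensor X) (tensorAt X i (leftFold (Matrix.single p b 1))) := by
  set S := tensorAt X i (leftFold (Matrix.single p b 1)) with hS
  have h1 : ∀ τ : ℝ, tensor (Function.update X i
      (leftFold (leftUnfold (X i) + τ • Matrix.single p b (1 : ℝ)))) = tensor X + τ • S := by
    intro τ
    have : leftFold (leftUnfold (X i) + τ • Matrix.single p b (1 : ℝ)) =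
        X i + τ • leftFold (Matrix.single p b (1 : ℝ)) := rfl
    rw [this, ← tensorAt_apply, map_add, map_smul, tensorAt_apply, Function.update_eq_self]
  have h2 : ∀ k (τ : ℝ), inner (A k) (tensor X + τ • S) =
      inner (A k) (tensor X) + τ * inner (A k) S := fun k τ => by
    rw [← innerₗ_apply, map_add, map_smul]; rfl
  simp only [leftGrad, Matrix.of_apply, loss, h1, h2]
  have h3 : ∀ k : Fin m, HasDerivAt
      (fun τ : ℝ => (inner (A k) (tensor X) + τ * inner (A k) S - y k) ^ 2)
      (2 * ((inner (A k) (tensor X) - y k) * inner (A k) S)) 0 := fun k => by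
    have := (((hasDerivAt_id (0 : ℝ)).mul_const (inner (A k) S)).const_add
      (inner (A k) (tensor X))).sub_const (y k) |>.fun_pow 2
    refine this.congr_deriv ?_
    simp; ring
  have h4 := (HasDerivAt.fun_sum fun k (_ : k ∈ Finset.univ) => h3 k).const_mul (1 / (2 * (m : ℝ)))
  rw [h4.deriv, lossDir, ← Finset.mul_sum, ← mul_assoc]
  congr 1
  rcases eq_or_ne (m : ℝ) 0 with h | h
  · simp [h]
  · field_simp

/-- Pairings with the gradients of single factors become values of one linear form on tensors, and
can then be summed over the factors. -/
lemma fdot_leftGrad (X : Factors d r) (i : Fin N)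
    (V : Fin (d i) → Matrix (Fin (r i.castSucc)) (Fin (r i.succ)) ℝ) :
    fdot (leftGrad (loss A y) X i) (leftUnfold V) =
      lossDir A y (tensor X) (tensorAt X i V) := by
  let f : Matrix (Fin (d i) × Fin (r i.castSucc)) (Fin (r i.succ)) ℝ →ₗ[ℝ] ℝ :=
    { toFun := fun B => lossDirₗ A y (tensor X) (tensorAt X i (leftFold B))
      map_add' := fun B C => by
        rw [show leftFold (B + C) = leftFold B + leftFold C from rfl, map_add, map_add]
      map_smul' := fun c B => by
        rw [show leftFold (c • B) = c • leftFold B from rfl, map_smul, map_smul]; rfl }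
  have h := fdot_of_single f (leftUnfold V)
  have h2 : leftGrad (loss A y) X i = Matrix.of fun a b => f (Matrix.single a b 1) := by
    ext p b
    rw [leftGrad_loss_apply, Matrix.of_apply]
    exact (lossDirₗ_apply A y _ _).symm
  rw [h2, h]
  exact lossDirₗ_apply A y _ _

end Gradient

end TT
end

noncomputable section

namespace TT

/-! ### The tangent projection of the Stiefel manifold. -/

section Tangent

variable {p q : Type*} [Fintype p] [Fintype q] [DecidableEq q] {Y : Matrix p q ℝ}

lemma tangentProj_tangent (hY : Yᵀ * Y = 1) (B : Matrix p q ℝ) :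
    Yᵀ * tangentProj Y B + (tangentProj Y B)ᵀ * Y = 0 := by
  have h1 : Yᵀ * tangentProj Y B = (1 / 2 : ℝ) • (Yᵀ * B - Bᵀ * Y) := by
    rw [tangentProj, Matrix.mul_sub, Matrix.mul_smul, ← Matrix.mul_assoc, hY, Matrix.one_mul]
    ext a b
    simp only [Matrix.sub_apply, Matrix.smul_apply, Matrix.add_apply, smul_eq_mul]
    ring
  have h2 : (tangentProj Y B)ᵀ * Y = (Yᵀ * tangentProj Y B)ᵀ := by
    rw [Matrix.transpose_mul, Matrix.transpose_transpose]
  rw [h2, h1, Matrix.transpose_smul, Matrix.transpose_sub, Matrix.transpose_mul,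
    Matrix.transpose_mul, Matrix.transpose_transpose, Matrix.transpose_transpose, ← smul_add]
  simp

/-- For two orthonormal frames the symmetric part of $Y^\top(Y-Q)$ is $\frac12(Y-Q)^\top(Y-Q)$, so
the projection alters $Y-Q$ only to second order. -/
lemma tangentProj_sub (hY : Yᵀ * Y = 1) {Q : Matrix p q ℝ} (hQ : Qᵀ * Q = 1) :
    tangentProj Y (Y - Q) = (Y - Q) - (1 / 2 : ℝ) • (Y * ((Y - Q)ᵀ * (Y - Q))) := by
  have : (Y - Q)ᵀ * Y + Yᵀ * (Y - Q) = (Y - Q)ᵀ * (Y - Q) := by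
    simp only [Matrix.transpose_sub, Matrix.sub_mul, Matrix.mul_sub, hY, hQ]
    abel
  rw [tangentProj, this]

lemma fdot_tangentProj_left (B C : Matrix p q ℝ) :
    fdot (tangentProj Y B) C = fdot B (tangentProj Y C) := by
  have h1 : fdot (Bᵀ * Y) (Yᵀ * C) = fdot (Yᵀ * B) (Cᵀ * Y) := by
    rw [← fdot_transpose, Matrix.transpose_mul, Matrix.transpose_mul, Matrix.transpose_transpose,
      Matrix.transpose_transpose]
  have h2 : fdot B (Y * (Cᵀ * Y + Yᵀ * C)) = fdot (Yᵀ * B) (Cᵀ * Y + Yᵀ * C) := by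
    rw [fdot_comm, fdot_mul_left, fdot_comm]
  simp only [tangentProj, fdot_sub_left, fdot_sub_right, fdot_smul_left, fdot_smul_right]
  rw [fdot_mul_left, h2, fdot_add_left, fdot_add_right, h1, add_comm]

/-- The removed part is $Y$ times a symmetric matrix, which is orthogonal to tangent vectors. -/
lemma frobSq_tangentProj_le (hY : Yᵀ * Y = 1) (B : Matrix p q ℝ) :
    frobSq (tangentProj Y B) ≤ frobSq B := by
  set S := Bᵀ * Y + Yᵀ * B with hS
  set P := tangentProj Y B with hP
  have hSt : Sᵀ = S := by
    rw [hS, Matrix.transpose_add, Matrix.transpose_mul, Matrix.transpose_mul,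
      Matrix.transpose_transpose, Matrix.transpose_transpose, add_comm]
  have h1 : fdot P (Y * S) = 0 := by
    have h2 := tangentProj_tangent hY B
    rw [← hP] at h2
    have h3 : fdot P (Y * S) = fdot (Yᵀ * P) S := by
      rw [fdot_comm, fdot_mul_left, fdot_comm]
    have h4 : fdot (Pᵀ * Y) S = fdot (Yᵀ * P) S := by
      rw [← fdot_transpose, Matrix.transpose_mul, Matrix.transpose_transpose, hSt]
    have h5 : fdot (Yᵀ * P) S + fdot (Pᵀ * Y) S = 0 := by
      rw [← fdot_add_left, h2]; simp [fdot]
    linarith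
  have h2 : B = P + (1 / 2 : ℝ) • (Y * S) := by rw [hP, tangentProj]; abel
  conv_rhs => rw [h2]
  rw [frobSq_add, fdot_smul_right, h1]
  linarith [frobSq_nonneg ((1 / 2 : ℝ) • (Y * S))]

end Tangent

variable {N : ℕ} {d : Fin N → ℕ} {r : Fin (N + 1) → ℕ}

/-! ### The quadratic form of the measurements and the noise form. -/

section Quadratic

variable {m : ℕ} (A : Fin m → Tensor d)

/-- The bilinear form `(1 / m) ⟨A(S), A(T)⟩`. -/
def bil (S T : Tensor d) : ℝ := 1 / (m : ℝ) * ∑ k, inner (A k) S * inner (A k) T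

lemma bil_self (T : Tensor d) : bil A T T = 1 / (m : ℝ) * ∑ k, inner (A k) T ^ 2 := by
  simp [bil, sq]

lemma bil_self_nonneg (T : Tensor d) : 0 ≤ bil A T T := by
  rw [bil_self]; positivity

lemma bil_sq_le (S T : Tensor d) : bil A S T ^ 2 ≤ bil A S S * bil A T T := by
  rw [bil_self, bil_self, bil, mul_pow]
  have := Finset.sum_mul_sq_le_sq_mul_sq Finset.univ (fun k => inner (A k) S)
    (fun k => inner (A k) T)
  calc _ ≤ (1 / (m : ℝ)) ^ 2 * ((∑ k, inner (A k) S ^ 2) * ∑ k, inner (A k) T ^ 2) :=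
        mul_le_mul_of_nonneg_left this (sq_nonneg _)
    _ = _ := by ring

lemma abs_bil_le (S T : Tensor d) : |bil A S T| ≤ √(bil A S S) * √(bil A T T) := by
  rw [← Real.sqrt_mul (bil_self_nonneg A S)]
  exact Real.abs_le_sqrt (bil_sq_le A S T)

lemma inner_add_right (S T T' : Tensor d) : inner S (T + T') = inner S T + inner S T' :=
  (innerₗ S).map_add T T'

lemma inner_sub_right (S T T' : Tensor d) : inner S (T - T') = inner S T - inner S T' :=
  (innerₗ S).map_sub T T'

lemma bil_add_right (S T T' : Tensor d) : bil A S (T + T') = bil A S T + bil A S T' := by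
  simp only [bil, inner_add_right, mul_add, Finset.sum_add_distrib]

/-- The linear form `(1 / m) ⟨ε, A(T)⟩` of the noise. -/
def noise (ε : Fin m → ℝ) (T : Tensor d) : ℝ := 1 / (m : ℝ) * ∑ k, ε k * inner (A k) T

lemma noise_add (ε : Fin m → ℝ) (S T : Tensor d) :
    noise A ε (S + T) = noise A ε S + noise A ε T := by
  simp only [noise, inner_add_right, mul_add, Finset.sum_add_distrib]

lemma lossDir_eq (ε : Fin m → ℝ) (Ts T S : Tensor d) :
    lossDir A (fun k => inner (A k) Ts + ε k) T S = bil A (T - Ts) S - noise A ε S := by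
  simp only [lossDir, bil, noise, inner_sub_right, ← mul_sub, ← Finset.sum_sub_distrib]
  congr 1
  exact Finset.sum_congr rfl fun k _ => by ring

/-- The loss as a function of the deviation of the tensor, up to a constant. -/
def potential (ε : Fin m → ℝ) (E : Tensor d) : ℝ := 1 / 2 * bil A E E - noise A ε E

lemma potential_add (ε : Fin m → ℝ) (E S : Tensor d) :
    potential A ε (E + S) =
      potential A ε E + (bil A E S - noise A ε S) + 1 / 2 * bil A S S := by
  have : bil A (E + S) (E + S) = bil A E E + 2 * bil A E S + bil A S S := by
    simp only [bil, inner_add_right, Finset.mul_sum, ← Finset.sum_add_distrib]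
    exact Finset.sum_congr rfl fun k _ => by ring
  rw [potential, potential, this, noise_add]; ring

end Quadratic

/-- The restricted isometry property on sums of `N + 3` tensors, together with a bound for the noise
on them. -/
structure Regular {m : ℕ} (r : Fin (N + 1) → ℕ) (A : Fin m → Tensor d) (δ : ℝ) (ε : Fin m → ℝ)
    (ζ : ℝ) : Prop where
  delta_nonneg : 0 ≤ δ
  delta_le : δ ≤ 7 / 30
  zeta_nonneg : 0 ≤ ζ
  lower : ∀ T : Tensor d, IsTTSum r (N + 3) T → (1 - δ) * tnorm T ^ 2 ≤ bil A T T
  upper : ∀ T : Tensor d, IsTTSum r (N + 3) T → bil A T T ≤ (1 + δ) * tnorm T ^ 2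
  noise_le : ∀ T : Tensor d, IsTTSum r (N + 3) T → |noise A ε T| ≤ ζ * tnorm T

/-! ### Estimates for a single step. -/

section Step

variable {m : ℕ} {A : Fin m → Tensor d} {δ : ℝ} {ε : Fin m → ℝ} {ζ : ℝ}

lemma Regular.abs_bil_sub_noise_le (h : Regular r A δ ε ζ) (E : Tensor d) {S : Tensor d}
    (hS : IsTTSum r (N + 3) S) :
    |bil A E S - noise A ε S| ≤ (√(1 + δ) * √(bil A E E) + ζ) * tnorm S := by
  have h1 := abs_bil_le A E S
  have h2 := h.noise_le S hS
  have h3 : √(bil A S S) ≤ √(1 + δ) * tnorm S := by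
    rw [← Real.sqrt_sq (tnorm_nonneg S), ← Real.sqrt_mul (by linarith [h.delta_nonneg])]
    exact Real.sqrt_le_sqrt (h.upper S hS)
  have h4 := mul_le_mul_of_nonneg_left h3 (Real.sqrt_nonneg (bil A E E))
  calc _ ≤ |bil A E S| + |noise A ε S| := abs_sub _ _
    _ ≤ _ := by nlinarith

lemma sqrt_one_add_le (h : Regular r A δ ε ζ) : √(1 + δ) ≤ 1.111 :=
  Real.sqrt_le_iff.2 ⟨by norm_num, by norm_num; linarith [h.delta_le]⟩

/-- The gradient with respect to a factor. -/
lemma Regular.sqrt_frobSq_leftGrad_le (h : Regular r A δ ε ζ) (hpos : 0 < N) (h0 : r 0 = 1)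
    (hN : r (Fin.last N) = 1) {X : Factors d r} (hX : LeftOrthogonal X) (Ts : Tensor d) {B : ℝ}
    (hB : 0 ≤ B) (hXB : ∀ i : Fin N, (i : ℕ) + 1 = N → fnorm (X i) ≤ B) (i : Fin N) :
    √(frobSq (leftGrad (loss A fun k => inner (A k) Ts + ε k) X i)) ≤
      (√(1 + δ) * √(bil A (tensor X - Ts) (tensor X - Ts)) + ζ) *
        (if (i : ℕ) + 1 < N then B else 1) := by
  set G := leftGrad (loss A fun k => inner (A k) Ts + ε k) X i with hG
  set Λ := √(1 + δ) * √(bil A (tensor X - Ts) (tensor X - Ts)) + ζ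
  have hΛ : 0 ≤ Λ := add_nonneg (mul_nonneg (Real.sqrt_nonneg _) (Real.sqrt_nonneg _)) h.zeta_nonneg
  -- Testing the gradient on itself bounds $\|G\|^2$ by a multiple of $\|G\|$; one power cancels
  -- unless $G=0$.
  have h1 : frobSq G = lossDir A (fun k => inner (A k) Ts + ε k) (tensor X)
      (tensorAt X i (leftFold G)) := by
    rw [← fdot_leftGrad, frobSq_eq_fdot]; rfl
  have hsum : IsTTSum r (N + 3) (tensorAt X i (leftFold G)) :=
    (isTTSum_tensor _).mono hpos (by omega)
  have h2 := h.abs_bil_sub_noise_le (tensor X - Ts) hsum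
  rw [← lossDir_eq, ← h1] at h2
  have h3 := tnorm_tensorAt_le h0 hN hX hB hXB i (leftFold G)
  have h4 : fnorm (leftFold G) = √(frobSq G) := rfl
  rw [h4] at h3
  set g := √(frobSq G) with hg
  have h5 : g ^ 2 = frobSq G := Real.sq_sqrt (frobSq_nonneg _)
  have h6 : g ^ 2 ≤ Λ * (g * (if (i : ℕ) + 1 < N then B else 1)) := by
    rw [h5]
    exact (le_abs_self _).trans (h2.trans (mul_le_mul_of_nonneg_left h3 hΛ))
  rcases (Real.sqrt_nonneg (frobSq G)).eq_or_lt with h7 | h7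
  · rw [← hg] at h7
    rw [← h7]
    exact mul_nonneg hΛ (by split_ifs <;> linarith)
  · rw [← hg] at h7
    nlinarith

/-- The update of an orthonormal factor. -/
lemma leftUnfold_rgdStep_of_lt (F : Factors d r → ℝ) (w μ : ℝ) (X : Factors d r) {i : Fin N}
    (hi : (i : ℕ) + 1 < N) : leftUnfold (rgdStep F w μ X i) =
      polarRetr (leftUnfold (X i) + (-(μ / w)) • tangentProj (leftUnfold (X i)) (leftGrad F X i)) := by
  rw [rgdStep, if_pos hi, leftUnfold_leftFold, neg_smul, ← sub_eq_add_neg]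

lemma leftUnfold_rgdStep_of_not_lt (F : Factors d r → ℝ) (w μ : ℝ) (X : Factors d r) {i : Fin N}
    (hi : ¬ (i : ℕ) + 1 < N) : leftUnfold (rgdStep F w μ X i) =
      leftUnfold (X i) - μ • leftGrad F X i := by
  rw [rgdStep, if_neg hi, leftUnfold_leftFold]

lemma smul_tangentProj_tangent {p q : Type*} [Fintype p] [Fintype q] [DecidableEq q]
    {Y : Matrix p q ℝ} (hY : Yᵀ * Y = 1) (c : ℝ) (B : Matrix p q ℝ) :
    Yᵀ * (c • tangentProj Y B) + (c • tangentProj Y B)ᵀ * Y = 0 := by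
  rw [Matrix.mul_smul, Matrix.transpose_smul, Matrix.smul_mul, ← smul_add,
    tangentProj_tangent hY, smul_zero]

lemma leftOrthogonal_rgdStep (F : Factors d r → ℝ) (w μ : ℝ) {X : Factors d r}
    (hX : LeftOrthogonal X) : LeftOrthogonal (rgdStep F w μ X) := fun i hi => by
  rw [leftUnfold_rgdStep_of_lt F w μ X hi]
  exact (polarRetr_tangent (hX i hi) (smul_tangentProj_tangent (hX i hi) _ _)).1

/-- The directions in which the gradient is tested, to first order the differences of the factors. -/
def testDir (X Y : Factors d r) (i : Fin N) :
    Fin (d i) → Matrix (Fin (r i.castSucc)) (Fin (r i.succ)) ℝ :=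
  if (i : ℕ) + 1 < N then leftFold (tangentProj (leftUnfold (X i)) (leftUnfold (X i - Y i)))
  else X i - Y i

/-- One step of gradient descent on one factor. -/
lemma gap_rgdStep_le (F : Factors d r → ℝ) {M μ : ℝ} (hM : 0 < M) {X Y : Factors d r}
    (hX : LeftOrthogonal X) (hY : LeftOrthogonal Y) :
    gap (M ^ 2) (rgdStep F (M ^ 2) μ X) Y ≤ gap (M ^ 2) X Y -
      2 * μ * ∑ i, fdot (leftGrad F X i) (leftUnfold (testDir X Y i)) +
      μ ^ 2 * ∑ i : Fin N, (if (i : ℕ) + 1 < N then 1 / M ^ 2 else 1) * frobSq (leftGrad F X i) := by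
  rw [gap, gap, Finset.mul_sum, Finset.mul_sum, ← Finset.sum_sub_distrib, ← Finset.sum_add_distrib]
  refine Finset.sum_le_sum fun i _ => ?_
  set G := leftGrad F X i
  by_cases hi : (i : ℕ) + 1 < N
  · simp only [hi, if_true]
    rw [leftUnfold_rgdStep_of_lt F _ μ X hi, testDir, if_pos hi, leftUnfold_leftFold,
      ← fdot_tangentProj_left]
    -- The retraction lemma with target $Y_i$ reduces the orthonormal factor to a Euclidean gradient
    -- step along the projected gradient.
    have h1 := (polarRetr_tangent (hX i hi)
      (smul_tangentProj_tangent (hX i hi) (-(μ / M ^ 2)) G)).2 _ (hY i hi)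
    set P := tangentProj (leftUnfold (X i)) G with hP
    set Δ := leftUnfold (X i) - leftUnfold (Y i) with hΔ
    have h2 : leftUnfold (X i) + -(μ / M ^ 2) • P - leftUnfold (Y i) = Δ - (μ / M ^ 2) • P := by
      rw [hΔ, neg_smul]; abel
    have h3 : leftUnfold (X i - Y i) = Δ := rfl
    have h4 := frobSq_tangentProj_le (hX i hi) G
    rw [h2, frobSq_sub Δ, fdot_smul_right, frobSq_smul, fdot_comm] at h1
    rw [h3]
    have h5 : frobSq (polarRetr (leftUnfold (X i) + -(μ / M ^ 2) • P) - leftUnfold (Y i)) ≤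
        frobSq Δ - 2 * (μ / M ^ 2 * fdot P Δ) + (μ / M ^ 2) ^ 2 * frobSq G := by
      have := frobSq_nonneg (leftUnfold (X i) + -(μ / M ^ 2) • P -
        polarRetr (leftUnfold (X i) + -(μ / M ^ 2) • P))
      have h6 := mul_le_mul_of_nonneg_left h4 (sq_nonneg (μ / M ^ 2))
      linarith
    have h6 := mul_le_mul_of_nonneg_left h5 (sq_nonneg M)
    refine h6.trans (le_of_eq ?_)
    field_simp
  · simp only [hi, if_false]
    rw [leftUnfold_rgdStep_of_not_lt F _ μ X hi, testDir, if_neg hi, leftUnfold_sub]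
    set Δ := leftUnfold (X i) - leftUnfold (Y i) with hΔ
    have h2 : leftUnfold (X i) - μ • G - leftUnfold (Y i) = Δ - μ • G := by rw [hΔ]; abel
    rw [h2, frobSq_sub, fdot_smul_right, frobSq_smul, fdot_comm]
    apply le_of_eq; ring

lemma frobSq_mul_gram_le {p q : Type*} [Fintype p] [Fintype q] [DecidableEq q]
    {Y Δ : Matrix p q ℝ} (hY : Yᵀ * Y = 1) : frobSq (Y * (Δᵀ * Δ)) ≤ frobSq Δ ^ 2 := by
  rw [frobSq_isometry_mul hY]
  refine (frobSq_mul_le _ _).trans (le_of_eq ?_)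
  rw [frobSq_transpose, sq]

/-- The test directions recover the deviation of the tensor to first order. -/
lemma tnorm_sum_testDir_sub_le (h0 : r 0 = 1) (hN : r (Fin.last N) = 1) {X Y : Factors d r}
    (hX : LeftOrthogonal X) (hY : LeftOrthogonal Y) {M : ℝ} (hM : 0 < M)
    (hXB : ∀ i : Fin N, (i : ℕ) + 1 = N → fnorm (X i) ≤ 3 / 2 * M) :
    tnorm (∑ i, tensorAt X i (testDir X Y i) - (tensor X - tensor Y)) ≤
      3 / (4 * M) * (N * gap (M ^ 2) X Y) := by
  have h1 := tnorm_sum_tensorAt_sub_le_pairs h0 hN hX hY hM hXB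
  have h2 : ∀ i, tnorm (tensorAt X i (testDir X Y i) - tensorAt X i (X i - Y i)) ≤
      3 / (4 * M) * gapAt M X Y i ^ 2 := fun i => by
    rw [← map_sub]
    by_cases hi : (i : ℕ) + 1 < N
    · rw [testDir, if_pos hi]
      set Δ := leftUnfold (X i - Y i) with hΔ
      have h3 : tangentProj (leftUnfold (X i)) Δ =
          Δ - (1 / 2 : ℝ) • (leftUnfold (X i) * (Δᵀ * Δ)) :=
        tangentProj_sub (hX i hi) (hY i hi)
      have h4 := tnorm_tensorAt_le h0 hN hX (B := 3 / 2 * M) (by positivity) hXB i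
        (leftFold (tangentProj (leftUnfold (X i)) Δ) - (X i - Y i))
      refine h4.trans ?_
      have h5 : leftUnfold (leftFold (tangentProj (leftUnfold (X i)) Δ) - (X i - Y i)) =
          -((1 / 2 : ℝ) • (leftUnfold (X i) * (Δᵀ * Δ))) := by
        have : leftUnfold (leftFold (tangentProj (leftUnfold (X i)) Δ) - (X i - Y i)) =
          tangentProj (leftUnfold (X i)) Δ - Δ := rfl
        rw [this, h3]; abel
      have h6 : fnorm (leftFold (tangentProj (leftUnfold (X i)) Δ) - (X i - Y i)) ≤
          1 / 2 * fnorm (X i - Y i) ^ 2 := by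
        rw [fnorm_sq, ← hΔ, fnorm, h5, frobSq_neg, frobSq_smul]
        refine Real.sqrt_le_iff.2 ⟨by have := frobSq_nonneg Δ; positivity, ?_⟩
        rw [mul_pow]
        exact mul_le_mul_of_nonneg_left (frobSq_mul_gram_le (hX i hi)) (by positivity)
      rw [if_pos hi, gapAt, if_pos hi]
      have h7 := mul_le_mul_of_nonneg_right h6 (by positivity : 0 ≤ 3 / 2 * M)
      refine h7.trans (le_of_eq ?_)
      field_simp
      ring
    · rw [testDir, if_neg hi, sub_self, map_zero, tnorm_zero]
      positivity
  have h3 : ∑ i, tensorAt X i (testDir X Y i) - (tensor X - tensor Y) =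
      (∑ i, tensorAt X i (X i - Y i) - (tensor X - tensor Y)) +
        ∑ i, (tensorAt X i (testDir X Y i) - tensorAt X i (X i - Y i)) := by
    rw [Finset.sum_sub_distrib]; abel
  rw [h3]
  refine (tnorm_add_le _ _).trans ?_
  have h4 : tnorm (∑ i, (tensorAt X i (testDir X Y i) - tensorAt X i (X i - Y i))) ≤
      3 / (4 * M) * ∑ i, gapAt M X Y i ^ 2 := by
    rw [Finset.mul_sum]
    exact (tnorm_sum_le _ _).trans (Finset.sum_le_sum fun i _ => h2 i)
  -- The pairs come from the linearisation, the squares from the tangent projection. With the common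
  -- constant $3/(4M)$ they form a full square, and Cauchy–Schwarz yields the factor $N$.
  have h5 := two_mul_sum_lt_add_sum_sq (gapAt M X Y)
  have h6 := sq_sum_gapAt_le M X Y
  have h7 : 3 / (2 * M) = 2 * (3 / (4 * M)) := by field_simp; norm_num
  rw [h7] at h1
  have h8 : 0 ≤ 3 / (4 * M) := by positivity
  have h9 := mul_le_mul_of_nonneg_left h6 h8
  rw [← h5] at h9
  linarith

end Step

end TT
end

noncomputable section

namespace TT

variable {N : ℕ} {d : Fin N → ℕ} {r : Fin (N + 1) → ℕ}

/-! ### Decrease of the distance and of the loss. -/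

section Contraction

variable {m : ℕ} {A : Fin m → Tensor d} {δ : ℝ} {ε : Fin m → ℝ} {ζ : ℝ}

set_option maxHeartbeats 1000000 in
/-- One step of gradient descent decreases the weighted distance to aligned reference factors, if
the noise is small compared with the error of the tensor. -/
lemma Regular.gap_rgdStep_le (h : Regular r A δ ε ζ) (hpos : 0 < N) (h0 : r 0 = 1)
    (hN : r (Fin.last N) = 1) {X Y : Factors d r} (hX : LeftOrthogonal X) (hY : LeftOrthogonal Y)
    {M μ e : ℝ} (hM : 0 < M) (hXB : ∀ i : Fin N, (i : ℕ) + 1 = N → fnorm (X i) ≤ 3 / 2 * M)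
    (he : e = tnorm (tensor X - tensor Y))
    (hgap : 3 / (4 * M) * (N * gap (M ^ 2) X Y) ≤ e / 4) (hζ : ζ ≤ e / 20) (hμ : 0 ≤ μ)
    (hμN : μ * N ≤ 27 / 500) :
    gap (M ^ 2) (rgdStep (loss A fun k => inner (A k) (tensor Y) + ε k) (M ^ 2) μ X) Y ≤
      gap (M ^ 2) X Y - 23 / 30 * (μ * e ^ 2) := by
  have he0 : 0 ≤ e := by rw [he]; exact tnorm_nonneg _
  set E := tensor X - tensor Y with hE
  have hEs : IsTTSum r 2 E := (isTTSum_tensor X).sub hpos (isTTSum_tensor Y)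
  set W := ∑ i, tensorAt X i (testDir X Y i) with hW
  have hWs : IsTTSum r N W := isTTSum_sum_tensorAt X _
  set H := W - E with hH
  have hHs : IsTTSum r (N + 3) H := (hWs.sub hpos hEs).mono hpos (by omega)
  have hHn : tnorm H ≤ e / 4 := (tnorm_sum_testDir_sub_le h0 hN hX hY hM hXB).trans hgap
  have hWEH : W = E + H := by rw [hH]; abel
  have hlow := h.lower E (hEs.mono hpos (by omega))
  have hδ0 := h.delta_nonneg
  have hδ := h.delta_le
  have hζ0 := h.zeta_nonneg
  rw [← he] at hlow
  set a := √(bil A E E) with ha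
  have ha0 : 0 ≤ a := Real.sqrt_nonneg _
  have ha2 : a ^ 2 = bil A E E := Real.sq_sqrt (bil_self_nonneg A E)
  -- As $\delta\le7/30$, one has $e\le\sqrt{30/23}\,a$ and $b\le\sqrt{37/(16\cdot23)}\,a$; these
  -- square roots are rounded up to $1.143$ and $0.32$.
  have hea : 23 / 30 * e ^ 2 ≤ a ^ 2 := by
    rw [ha2]; nlinarith [sq_nonneg e]
  have hea1 : e ≤ 1.143 * a := by
    refine abs_le_of_sq_le_sq' ?_ (by positivity) |>.2
    nlinarith
  set b := √(bil A H H) with hb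
  have hb0 : 0 ≤ b := Real.sqrt_nonneg _
  have hb2 : b ^ 2 = bil A H H := Real.sq_sqrt (bil_self_nonneg A H)
  have hba : b ≤ 0.32 * a := by
    refine abs_le_of_sq_le_sq' ?_ (by positivity) |>.2
    have h1 := h.upper H hHs
    have h2 : tnorm H ^ 2 ≤ (e / 4) ^ 2 := pow_le_pow_left₀ (tnorm_nonneg _) hHn 2
    rw [hb2]
    have h3 : (1 + δ) * tnorm H ^ 2 ≤ 37 / 30 * (e / 4) ^ 2 := by
      apply mul_le_mul (by linarith) h2 (sq_nonneg _) (by norm_num)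
    nlinarith
  -- the inner product of the gradient with the deviation of the factors
  have hL : 0.59 * a ^ 2 ≤ ∑ i, fdot (leftGrad (loss A fun k => inner (A k) (tensor Y) + ε k) X i)
      (leftUnfold (testDir X Y i)) := by
    simp only [fdot_leftGrad, ← lossDirₗ_apply]
    rw [← map_sum, lossDirₗ_apply, lossDir_eq, ← hE, ← hW]
    have h1 : bil A E W = a ^ 2 + bil A E H := by rw [hWEH, bil_add_right, ha2]
    have h2 := (abs_le.1 (abs_bil_le A E H)).1
    have h3 := (abs_le.1 (h.noise_le W (hWs.mono hpos (by omega)))).2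
    have h4 : tnorm W ≤ 5 / 4 * e := by
      rw [hWEH]; refine (tnorm_add_le _ _).trans ?_; rw [← he]; linarith
    have h5 : ζ * tnorm W ≤ e / 20 * (5 / 4 * e) := mul_le_mul hζ h4 (tnorm_nonneg _) (by positivity)
    rw [← ha, ← hb] at h2
    have h6 := mul_le_mul_of_nonneg_left hba ha0
    -- Of $a^2$, at most $0.32a^2$ is lost to $H$ and at most $e^2/16\le0.082a^2$ to the noise.
    rw [h1]
    nlinarith
  have hG : ∑ i : Fin N, (if (i : ℕ) + 1 < N then 1 / M ^ 2 else 1) *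
      frobSq (leftGrad (loss A fun k => inner (A k) (tensor Y) + ε k) X i) ≤ N * (3.081 * a ^ 2) := by
    have h1 : ∀ i : Fin N, (if (i : ℕ) + 1 < N then 1 / M ^ 2 else 1) *
        frobSq (leftGrad (loss A fun k => inner (A k) (tensor Y) + ε k) X i) ≤ 3.081 * a ^ 2 := by
      intro i
      have h2 := h.sqrt_frobSq_leftGrad_le hpos h0 hN hX (tensor Y) (by positivity) hXB i
      set G := leftGrad (loss A fun k => inner (A k) (tensor Y) + ε k) X i
      rw [← hE, ← ha] at h2
      -- Here $1.111+1.143/20<1.17$, and $\frac94\cdot1.17^2<3.081$.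
      have h3 : √(1 + δ) * a + ζ ≤ 1.17 * a := by
        have := mul_le_mul_of_nonneg_right (sqrt_one_add_le h) ha0
        linarith
      have h4 := pow_le_pow_left₀ (Real.sqrt_nonneg _) h2 2
      rw [Real.sq_sqrt (frobSq_nonneg _)] at h4
      have h5 : (√(1 + δ) * a + ζ) ^ 2 ≤ (1.17 * a) ^ 2 :=
        pow_le_pow_left₀ (by positivity) h3 2
      rw [mul_pow] at h4
      split_ifs at h4 ⊢ with hi
      · rw [one_div, inv_mul_le_iff₀ (by positivity)]
        nlinarith [sq_nonneg M]
      · nlinarith [sq_nonneg a]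
    refine (Finset.sum_le_sum fun i _ => h1 i).trans (le_of_eq ?_)
    simp
  refine (TT.gap_rgdStep_le _ hM hX hY).trans ?_
  have h1 := mul_le_mul_of_nonneg_left hL hμ
  have h2 := mul_le_mul_of_nonneg_left hG (sq_nonneg μ)
  -- Since $2\cdot0.59-\frac{27}{500}\cdot3.081>1$, the net decrease is at least $\mu
  -- a^2\ge\frac{23}{30}\mu e^2$.
  have h3 : μ ^ 2 * (N * (3.081 * a ^ 2)) ≤ 27 / 500 * (μ * (3.081 * a ^ 2)) := by
    have := mul_le_mul_of_nonneg_right hμN (by positivity : 0 ≤ μ * (3.081 * a ^ 2))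
    calc _ = μ * N * (μ * (3.081 * a ^ 2)) := by ring
      _ ≤ _ := this
  have h4 := mul_le_mul_of_nonneg_left hea hμ
  have h5 : 0 ≤ μ * a ^ 2 := by positivity
  linarith

/-- The decrease of an orthonormal factor in one step. -/
lemma mul_frobSq_le_fdot_leftGrad (F : Factors d r → ℝ) {w μ : ℝ} (hw : 0 < w) (hμ : 0 ≤ μ)
    {X : Factors d r} (hX : LeftOrthogonal X) {i : Fin N} (hi : (i : ℕ) + 1 < N) :
    w * frobSq (leftUnfold (X i - rgdStep F w μ X i)) ≤
      μ * (fdot (leftGrad F X i) (leftUnfold (X i - rgdStep F w μ X i)) +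
        1 / 2 * (√(frobSq (leftGrad F X i)) *
          frobSq (leftUnfold (X i - rgdStep F w μ X i)))) := by
  have hX' := leftOrthogonal_rgdStep F w μ hX i hi
  -- The target is the old factor itself. Expanding the squares gives $\|D\|^2\le-\langle
  -- V,D\rangle$ for the displacement $D=Y-U$.
  have h1 := (polarRetr_tangent (hX i hi)
    (smul_tangentProj_tangent (hX i hi) (-(μ / w)) (leftGrad F X i))).2 _ (hX i hi)
  rw [← leftUnfold_rgdStep_of_lt F w μ X hi] at h1
  have h3 : leftUnfold (X i - rgdStep F w μ X i) =
    leftUnfold (X i) - leftUnfold (rgdStep F w μ X i) := rfl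
  rw [h3]
  set Y := leftUnfold (X i)
  set U := leftUnfold (rgdStep F w μ X i)
  set G := leftGrad F X i
  set D := Y - U with hD
  have h2 := tangentProj_sub (hX i hi) hX'
  have h4 : fdot (tangentProj Y G) D = fdot G D - 1 / 2 * fdot G (Y * (Dᵀ * D)) := by
    rw [fdot_tangentProj_left, hD, h2, fdot_sub_right, fdot_smul_right]
  have h5 : -fdot G (Y * (Dᵀ * D)) ≤ √(frobSq G) * frobSq D := by
    have h6 := (abs_le.1 (fdot_le G (Y * (Dᵀ * D)))).1
    have h7 : √(frobSq (Y * (Dᵀ * D))) ≤ frobSq D :=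
      Real.sqrt_le_iff.2 ⟨frobSq_nonneg _, frobSq_mul_gram_le (hX i hi)⟩
    have := mul_le_mul_of_nonneg_left h7 (Real.sqrt_nonneg (frobSq G))
    linarith
  set V := (-(μ / w)) • tangentProj Y G with hV
  have h6 : Y + V - U = V + D := by rw [hD]; abel
  have h7 : Y + V - Y = V := by abel
  have h8 : fdot V D = -(μ / w) * fdot (tangentProj Y G) D := by rw [hV, fdot_smul_left]
  rw [h6, h7, frobSq_add, frobSq_sub_comm U Y, ← hD, h8] at h1
  have h9 : frobSq D ≤ μ / w * fdot (tangentProj Y G) D := by linarith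
  have h10 : w * frobSq D ≤ μ * fdot (tangentProj Y G) D := by
    have := mul_le_mul_of_nonneg_left h9 hw.le
    rwa [← mul_assoc, mul_div_cancel₀ _ hw.ne'] at this
  rw [h4] at h10
  nlinarith [mul_le_mul_of_nonneg_left h5 hμ]

/-- One step of gradient descent does not increase the loss. -/
lemma Regular.potential_rgdStep_le (h : Regular r A δ ε ζ) (hpos : 0 < N) (h0 : r 0 = 1)
    (hN : r (Fin.last N) = 1) {X : Factors d r} (hX : LeftOrthogonal X) (Ts : Tensor d)
    (hTs : IsTTSum r 1 Ts)
    {M μ : ℝ} (hM : 0 < M) (hXB : ∀ i : Fin N, (i : ℕ) + 1 = N → fnorm (X i) ≤ 3 / 2 * M)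
    (he : tnorm (tensor X - Ts) ≤ M / 20) (hζ : ζ ≤ M / 40) (hμ : 0 < μ)
    (hμN : μ * N ≤ 27 / 500) :
    potential A ε (tensor (rgdStep (loss A fun k => inner (A k) Ts + ε k) (M ^ 2) μ X) - Ts) ≤
      potential A ε (tensor X - Ts) := by
  set F := loss A fun k => inner (A k) Ts + ε k with hF
  set X' := rgdStep F (M ^ 2) μ X with hX'
  have hX'o : LeftOrthogonal X' := leftOrthogonal_rgdStep F _ μ hX
  set E := tensor X - Ts with hE
  have hEs : IsTTSum r (N + 3) E := ((isTTSum_tensor X).sub hpos hTs).mono hpos (by omega)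
  set S := tensor X' - tensor X with hS
  have hSs : IsTTSum r (N + 3) S :=
    ((isTTSum_tensor X').sub hpos (isTTSum_tensor X)).mono hpos (by omega)
  have hES : tensor X' - Ts = E + S := by rw [hE, hS]; abel
  set W := ∑ i, tensorAt X i (X i - X' i) with hW
  have hWs : IsTTSum r N W := isTTSum_sum_tensorAt X _
  set H := W - (tensor X - tensor X') with hH
  have hHs : IsTTSum r (N + 3) H :=
    (hWs.sub hpos ((isTTSum_tensor X).sub hpos (isTTSum_tensor X'))).mono hpos (by omega)
  set Q := gap (M ^ 2) X X' with hQ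
  have hQ0 : 0 ≤ Q := gap_nonneg (sq_nonneg _) _ _
  have hN1 : (1 : ℝ) ≤ N := by exact_mod_cast hpos
  have hδ := h.delta_le
  have hδ0 := h.delta_nonneg
  -- size of the gradient
  have hΛ : √(1 + δ) * √(bil A E E) + ζ ≤ M / 10 := by
    have h1 : √(bil A E E) ≤ 1.111 * (M / 20) := by
      refine Real.sqrt_le_iff.2 ⟨by positivity, ?_⟩
      have h2 := h.upper E hEs
      have h3 := pow_le_pow_left₀ (tnorm_nonneg _) he 2
      nlinarith [mul_le_mul (by linarith : 1 + δ ≤ 37 / 30) h3 (sq_nonneg _) (by norm_num)]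
    have h2 := mul_le_mul (sqrt_one_add_le h) h1 (Real.sqrt_nonneg _) (by norm_num)
    linarith
  have hHn : tnorm H ≤ 3 / (4 * M) * (N * Q) := by
    have h1 := tnorm_sum_tensorAt_sub_le_pairs h0 hN hX hX'o hM hXB
    have h2 := two_mul_sum_lt_add_sum_sq (gapAt M X X')
    have h3 := sq_sum_gapAt_le M X X'
    have h4 : 0 ≤ ∑ i, gapAt M X X' i ^ 2 := Finset.sum_nonneg fun _ _ => sq_nonneg _
    have h7 : 3 / (2 * M) = 2 * (3 / (4 * M)) := by field_simp; norm_num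
    rw [h7] at h1
    have h8 : 0 ≤ 3 / (4 * M) := by positivity
    rw [← hQ, ← h2] at h3
    have h9 := mul_le_mul_of_nonneg_left h3 h8
    have h10 := mul_nonneg h8 h4
    exact h1.trans (by linarith)
  have hdirH : bil A E H - noise A ε H ≤ 0.075 * (N * Q) := by
    have h1 := (abs_le.1 (h.abs_bil_sub_noise_le E hHs)).2
    have h2 : (√(1 + δ) * √(bil A E E) + ζ) * tnorm H ≤ M / 10 * (3 / (4 * M) * (N * Q)) :=
      mul_le_mul hΛ hHn (tnorm_nonneg _) (by positivity)
    have h3 : M / 10 * (3 / (4 * M) * (N * Q)) = 0.075 * (N * Q) := by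
      field_simp; norm_num; ring
    linarith
  have hSq : bil A S S ≤ 37 / 30 * (9 / 4 * N * Q) := by
    have h1 := tnorm_sub_sq_le h0 hN hX hX'o hM hXB
    rw [tnorm_sub_comm] at h1
    refine (h.upper S hSs).trans ?_
    exact mul_le_mul (by linarith) h1 (sq_nonneg _) (by norm_num)
  -- On an orthonormal factor the curvature correction is half the gradient bound $\frac
  -- M{10}\cdot\frac32M$. On the last factor the identity is exact.
  have hgrad : Q * (1 - 0.075 * μ) ≤ μ * lossDir A (fun k => inner (A k) Ts + ε k) (tensor X) W := by
    rw [hW, ← lossDirₗ_apply, map_sum, Finset.mul_sum, hQ, gap, Finset.sum_mul]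
    refine Finset.sum_le_sum fun i _ => ?_
    rw [lossDirₗ_apply, ← fdot_leftGrad, ← leftUnfold_sub]
    by_cases hi : (i : ℕ) + 1 < N
    · have h1 := mul_frobSq_le_fdot_leftGrad F (w := M ^ 2) (by positivity) hμ.le hX hi
      have h2 := h.sqrt_frobSq_leftGrad_le hpos h0 hN hX Ts (by positivity) hXB i
      rw [← hX'] at h1
      rw [if_pos hi] at h2 ⊢
      have h3 : √(frobSq (leftGrad F X i)) ≤ M / 10 * (3 / 2 * M) :=
        h2.trans (mul_le_mul_of_nonneg_right hΛ (by positivity))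
      have h4 := mul_le_mul_of_nonneg_right h3 (frobSq_nonneg (leftUnfold (X i - X' i)))
      have h5 := mul_le_mul_of_nonneg_left h4 hμ.le
      linarith
    · have h1 : leftUnfold (X i - X' i) = μ • leftGrad F X i := by
        rw [leftUnfold_sub, hX', leftUnfold_rgdStep_of_not_lt F _ μ X hi]; abel
      rw [if_neg hi, h1, frobSq_smul, fdot_smul_right, ← frobSq_eq_fdot]
      have h2 := frobSq_nonneg (leftGrad F X i)
      nlinarith [mul_nonneg (mul_nonneg (sq_nonneg μ) hμ.le) h2]
  have hdir : bil A E S - noise A ε S =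
      (bil A E H - noise A ε H) - lossDir A (fun k => inner (A k) Ts + ε k) (tensor X) W := by
    have h1 : H = S + W := by rw [hH, hS]; abel
    rw [lossDir_eq, h1, bil_add_right, noise_add]; ring
  rw [hES, potential_add, hdir]
  have hNQ : 0 ≤ N * Q := by positivity
  have h1 : μ * (N * Q) ≤ 27 / 500 * Q := by
    have := mul_le_mul_of_nonneg_right hμN hQ0
    linarith
  have h2 : μ * Q ≤ μ * (N * Q) := mul_le_mul_of_nonneg_left (by nlinarith) hμ.le
  -- The positive terms add up to at most $(0.075+0.075+1.3875)\,\mu NQ$, and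
  -- $1.5375\cdot\frac{27}{500}<1$.
  have key : μ * ((bil A E H - noise A ε H) -
      lossDir A (fun k => inner (A k) Ts + ε k) (tensor X) W + 1 / 2 * bil A S S) ≤ 0 := by
    have h3 := mul_le_mul_of_nonneg_left hdirH hμ.le
    have h4 := mul_le_mul_of_nonneg_left hSq hμ.le
    linarith
  have := nonpos_of_mul_nonpos_right key hμ
  linarith

end Contraction

/-! ### The two regimes and the induction over the steps. -/

section Iteration

variable {m : ℕ} {A : Fin m → Tensor d} {δ : ℝ} {ε : Fin m → ℝ} {ζ : ℝ}

/-- If $\|E\|>30\zeta$, the potential is larger than $(\frac{23}{60}\cdot900-30)\zeta^2=315\zeta^2$.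
-/
lemma Regular.tnorm_le_of_potential_le (h : Regular r A δ ε ζ) {E : Tensor d}
    (hE : IsTTSum r (N + 3) E) (hp : potential A ε E ≤ 270 * ζ ^ 2) : tnorm E ≤ 30 * ζ := by
  by_contra hlt
  push Not at hlt
  have h1 := h.lower E hE
  have h2 := (abs_le.1 (h.noise_le E hE)).2
  have hδ := h.delta_le
  have hζ := h.zeta_nonneg
  have hE0 := tnorm_nonneg E
  rw [potential] at hp
  have h3 : 23 / 30 * tnorm E ^ 2 ≤ (1 - δ) * tnorm E ^ 2 :=
    mul_le_mul_of_nonneg_right (by linarith) (sq_nonneg _)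
  nlinarith

/-- The quadratic and the linear part are at most $(\frac{37}{60}\cdot400+20)\zeta^2<267\zeta^2$.
The height $270$ leaves room on both sides. -/
lemma Regular.potential_le_of_tnorm_le (h : Regular r A δ ε ζ) {E : Tensor d}
    (hE : IsTTSum r (N + 3) E) (he : tnorm E ≤ 20 * ζ) : potential A ε E ≤ 270 * ζ ^ 2 := by
  have h1 := h.upper E hE
  have h2 := (abs_le.1 (h.noise_le E hE)).1
  have hδ := h.delta_le
  have hδ0 := h.delta_nonneg
  have hζ := h.zeta_nonneg
  have h3 := pow_le_pow_left₀ (tnorm_nonneg E) he 2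
  have h4 : (1 + δ) * tnorm E ^ 2 ≤ 37 / 30 * (20 * ζ) ^ 2 :=
    mul_le_mul (by linarith) h3 (sq_nonneg _) (by norm_num)
  have h5 := mul_le_mul_of_nonneg_left he hζ
  rw [potential]
  nlinarith

lemma rankSum_ge (r : Fin (N + 1) → ℕ) : (N : ℝ) + 1 ≤ rankSum r := by
  rw [rankSum]
  have : (0 : ℝ) ≤ ∑ i ∈ (innerBonds N).filter (fun i : Fin (N + 1) => 2 ≤ (i : ℕ)), (r i : ℝ) :=
    Finset.sum_nonneg fun _ _ => Nat.cast_nonneg _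
  linarith

set_option maxHeartbeats 1000000 in
/-- While the noise is small compared with the error of the tensor, one step of gradient descent
decreases the squared distance. -/
lemma Regular.distSq_rgdStep_le (h : Regular r A δ ε ζ) (h2 : 2 ≤ N) (h0 : r 0 = 1)
    (hN : r (Fin.last N) = 1) {X Xs : Factors d r} (hX : LeftOrthogonal X)
    (hXs : LeftOrthogonal Xs) (hm : Minimal Xs) {μ : ℝ} (hμ : 0 < μ) (hμN : μ * N ≤ 27 / 500)
    (hζ : 20 * ζ < tnorm (tensor X - tensor Xs)) (hδ : 0 < 7 - 30 * δ)
    (hdist : distSq X Xs ≤ (7 - 30 * δ) * sigmaMin r (tensor Xs) ^ 2 /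
      (8 * rankSum r * (129 * (N : ℝ) ^ 2 + 7231 * N - 7360))) :
    distSq (rgdStep (loss A fun k => inner (A k) (tensor Xs) + ε k) (normSq (tensor Xs)) μ X) Xs ≤
      distSq X Xs - 23 / 30 * (μ * normSq (tensor X - tensor Xs)) := by
  set σ := sigmaMin r (tensor Xs) with hσ
  have hσ0 : 0 < σ := sigmaMin_pos h2 h0 hN hXs hm
  have hσM := sigmaMin_sq_le h2 h0 hXs hm
  set M := tnorm (tensor Xs) with hM
  have hMsq : normSq (tensor Xs) = M ^ 2 := (tnorm_sq _).symm
  rw [← hσ, hMsq] at hσM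
  have hM0 : 0 < M := by
    rcases (tnorm_nonneg (tensor Xs)).eq_or_lt with h | h
    · rw [← hM] at h; rw [← h] at hσM; nlinarith
    · exact h
  set e := tnorm (tensor X - tensor Xs) with he
  have hesq : normSq (tensor X - tensor Xs) = e ^ 2 := (tnorm_sq _).symm
  have he0 : 0 < e := lt_of_le_of_lt (by have := h.zeta_nonneg; positivity) hζ
  have hS := rankSum_ge r
  set S := rankSum r with hSdef
  have hN2 : (2 : ℝ) ≤ N := by exact_mod_cast h2
  have hS0 : 0 < S := by linarith
  have hδ0 := h.delta_nonneg
  set b := (7 - 30 * δ) * σ ^ 2 / (8 * S * (129 * (N : ℝ) ^ 2 + 7231 * N - 7360)) with hb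
  have hQ : 129 * (N : ℝ) ^ 2 ≤ 129 * (N : ℝ) ^ 2 + 7231 * N - 7360 := by linarith
  set Qc := 129 * (N : ℝ) ^ 2 + 7231 * N - 7360 with hQc
  have hQ0 : 0 < Qc := lt_of_lt_of_le (by positivity) hQ
  have hb0 : 0 < b := by positivity
  have hbmul : b * (8 * S * Qc) = (7 - 30 * δ) * σ ^ 2 := by
    rw [hb]; field_simp
  -- Of the polynomial in the radius only $129N^2$ is used, through $18\cdot7\le129$.
  have hbS : 9 * (N : ℝ) ^ 2 * (2 * b) * (8 * S) ≤ σ ^ 2 := by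
    have h1 : b * (8 * S) * (129 * (N : ℝ) ^ 2) ≤ b * (8 * S) * Qc :=
      mul_le_mul_of_nonneg_left hQ (by positivity)
    have h3 : (7 - 30 * δ) * σ ^ 2 ≤ 7 * σ ^ 2 := mul_le_mul_of_nonneg_right (by linarith)
      (sq_nonneg _)
    linarith [sq_nonneg σ]
  have hLe := distSq_le h2 h0 hN hX hXs hm
  rw [← hσ, hMsq, hesq, ← hSdef] at hLe
  set η₀ := 4 * S * M ^ 2 * e ^ 2 / σ ^ 2 with hη₀
  have hη₀0 : 0 < η₀ := by positivity
  have hη₀mul : σ ^ 2 * η₀ = 4 * S * M ^ 2 * e ^ 2 := by rw [hη₀]; field_simp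
  rw [hMsq, hesq]
  refine le_of_forall_pos_le_add fun η hη => ?_
  -- The slack has three purposes: $\eta$ tends to zero at the end, $b$ keeps the gap within twice
  -- the radius, and $\eta_0$ at most doubles the bound of `distSq_le`.
  obtain ⟨R, hR⟩ := exists_gap_lt X Xs (η := min η (min b η₀)) (by positivity)
  rw [hMsq] at hR
  have hR1 : gap (M ^ 2) X (rotate R Xs) ≤ distSq X Xs + η :=
    hR.le.trans (by linarith [min_le_left η (min b η₀)])
  have hR2 : gap (M ^ 2) X (rotate R Xs) ≤ 2 * b :=
    hR.le.trans (by linarith [(min_le_right η (min b η₀)).trans (min_le_left b η₀)])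
  have hR3 : gap (M ^ 2) X (rotate R Xs) ≤ distSq X Xs + η₀ :=
    hR.le.trans (by linarith [(min_le_right η (min b η₀)).trans (min_le_right b η₀)])
  set Y := rotate R Xs with hY
  have hYo : LeftOrthogonal Y := leftOrthogonal_rotate R hXs
  have hYt : tensor Y = tensor Xs := tensor_rotate R Xs
  set D := gap (M ^ 2) X Y with hD
  have hD0 : 0 ≤ D := gap_nonneg (sq_nonneg _) _ _
  have hDe : σ ^ 2 * D ≤ 8 * S * M ^ 2 * e ^ 2 := by
    have := mul_le_mul_of_nonneg_left hR3 (sq_nonneg σ)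
    linarith
  have hgap : 3 / (4 * M) * (N * D) ≤ e / 4 := by
    have h1 : 3 * (N * D) ≤ M * e := by
      refine abs_le_of_sq_le_sq' ?_ (by positivity) |>.2
      have h3 : D * (σ ^ 2 * D) ≤ 2 * b * (8 * S * M ^ 2 * e ^ 2) :=
        mul_le_mul hR2 hDe (by positivity) (by positivity)
      have h4 := mul_le_mul_of_nonneg_right hbS (by positivity : 0 ≤ M ^ 2 * e ^ 2)
      have h5 : σ ^ 2 * (3 * (N * D)) ^ 2 ≤ σ ^ 2 * (M * e) ^ 2 := by
        have h6 := mul_le_mul_of_nonneg_left h3 (by positivity : 0 ≤ 9 * (N : ℝ) ^ 2)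
        linarith
      exact le_of_mul_le_mul_left h5 (by positivity)
    have h2 : 3 / (4 * M) * (N * D) = 3 * (N * D) / (4 * M) := by ring
    rw [h2, div_le_iff₀ (by positivity)]
    linarith
  have hDM : D ≤ M ^ 2 / 8 := by
    have h1 : 1 ≤ (N : ℝ) ^ 2 * S :=
      one_le_mul_of_one_le_of_one_le (one_le_pow₀ (by linarith)) (by linarith)
    have h3 : b * 1 ≤ b * ((N : ℝ) ^ 2 * S) := mul_le_mul_of_nonneg_left h1 hb0.le
    linarith
  have s₀ : (i : Fin N) → Fin (d i) := fun i => ⟨0, hm.dim_pos h0 i⟩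
  -- The last reference factor has norm $M$, and $2M^2+2D\le\frac94M^2$.
  have hXB : ∀ i : Fin N, (i : ℕ) + 1 = N → fnorm (X i) ≤ 3 / 2 * M := fun i hi => by
    refine Real.sqrt_le_iff.2 ⟨by positivity, ?_⟩
    have h1 : leftUnfold (X i) = leftUnfold (Y i) + (leftUnfold (X i) - leftUnfold (Y i)) := by abel
    have h3 : frobSq (leftUnfold (Y i)) = M ^ 2 := by
      rw [← normSq_tensor_of_leftOrthogonal s₀ h0 hN hYo hi, hYt, hMsq]
    have h4 : frobSq (leftUnfold (X i) - leftUnfold (Y i)) ≤ D := by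
      have h5 := Finset.single_le_sum (f := fun i : Fin N => (if (i : ℕ) + 1 < N then M ^ 2 else 1) *
        frobSq (leftUnfold (X i) - leftUnfold (Y i))) (fun j _ => mul_nonneg
          (by split_ifs <;> positivity) (frobSq_nonneg _)) (Finset.mem_univ i)
      simp only [if_neg (show ¬ (i : ℕ) + 1 < N by omega), one_mul] at h5
      exact h5
    rw [h1]
    refine (frobSq_add_le _ _).trans ?_
    rw [h3]; linarith
  have hfin := h.gap_rgdStep_le (by omega) h0 hN hX hYo hM0 hXB (e := e) (by rw [hYt]) hgap
    (by linarith) hμ.le hμN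
  rw [hYt] at hfin
  have hle := distSq_le_gap
    (rgdStep (loss A fun k => inner (A k) (tensor Xs) + ε k) (M ^ 2) μ X) Xs R
  rw [hMsq, ← hY] at hle
  linarith

lemma leftOrthogonal_rgd (F : Factors d r → ℝ) (w μ : ℝ) {X₀ : Factors d r}
    (hX : LeftOrthogonal X₀) (t : ℕ) : LeftOrthogonal (rgd F w μ X₀ t) := by
  induction t with
  | zero => exact hX
  | succ t ih => exact leftOrthogonal_rgdStep F w μ ih

/-- Convergence of gradient descent under a bound for the noise. -/
theorem Regular.distSq_rgd_le (h : Regular r A δ ε ζ) (h2 : 2 ≤ N) (h0 : r 0 = 1)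
    (hN : r (Fin.last N) = 1) {X₀ Xs : Factors d r} (hX : LeftOrthogonal X₀)
    (hXs : LeftOrthogonal Xs) (hm : Minimal Xs) {μ : ℝ} (hμ : 0 < μ) (hμN : μ * N ≤ 27 / 500)
    (hζ : ζ ≤ tnorm (tensor Xs) / 600) (hδ : 0 < 7 - 30 * δ)
    (hdist : distSq X₀ Xs ≤ (7 - 30 * δ) * sigmaMin r (tensor Xs) ^ 2 /
      (8 * rankSum r * (129 * (N : ℝ) ^ 2 + 7231 * N - 7360))) (t : ℕ) :
    distSq (rgd (loss A fun k => inner (A k) (tensor Xs) + ε k) (normSq (tensor Xs)) μ X₀ t) Xs ≤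
      (1 - (7 - 30 * δ) * sigmaMin r (tensor Xs) ^ 2 /
        (1280 * rankSum r * normSq (tensor Xs)) * μ) ^ t * distSq X₀ Xs +
      3600 * rankSum r * normSq (tensor Xs) * ζ ^ 2 / sigmaMin r (tensor Xs) ^ 2 := by
  set F := loss A fun k => inner (A k) (tensor Xs) + ε k with hF
  set σ := sigmaMin r (tensor Xs) with hσ
  have hσ0 : 0 < σ := sigmaMin_pos h2 h0 hN hXs hm
  have hσM := sigmaMin_sq_le h2 h0 hXs hm
  set M := tnorm (tensor Xs) with hM
  have hMsq : normSq (tensor Xs) = M ^ 2 := (tnorm_sq _).symm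
  rw [← hσ, hMsq] at hσM
  have hM0 : 0 < M := by
    rcases (tnorm_nonneg (tensor Xs)).eq_or_lt with h | h
    · rw [← hM] at h; rw [← h] at hσM; nlinarith
    · exact h
  have hS := rankSum_ge r
  set S := rankSum r with hSdef
  have hN2 : (2 : ℝ) ≤ N := by exact_mod_cast h2
  have hS0 : 0 < S := by linarith
  have hδ0 := h.delta_nonneg
  have hζ0 := h.zeta_nonneg
  have hpos : 0 < N := by omega
  set ρ := (7 - 30 * δ) * σ ^ 2 / (1280 * S * normSq (tensor Xs)) * μ with hρ
  have hρmul : ρ * (1280 * S * M ^ 2) = (7 - 30 * δ) * σ ^ 2 * μ := by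
    rw [hρ, hMsq]; field_simp
  have hρ0 : 0 ≤ ρ := by rw [hρ, hMsq]; positivity
  have hμ1 : μ ≤ 1 := by nlinarith
  have hρ1 : ρ ≤ 1 := by
    have h1 : (7 - 30 * δ) * σ ^ 2 * μ ≤ 7 * M ^ 2 * 1 :=
      mul_le_mul (mul_le_mul (by linarith) hσM (sq_nonneg _) (by norm_num)) hμ1 hμ.le
        (by positivity)
    have h3 : 7 * M ^ 2 ≤ 1280 * S * M ^ 2 := mul_le_mul_of_nonneg_right (by linarith) (sq_nonneg _)
    have h4 : ρ * (1280 * S * M ^ 2) ≤ 1 * (1280 * S * M ^ 2) := by linarith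
    exact le_of_mul_le_mul_right h4 (by positivity)
  have hd0 : 0 ≤ distSq X₀ Xs := distSq_nonneg _ _
  have hXt := leftOrthogonal_rgd F (normSq (tensor Xs)) μ hX
  set Xt := rgd F (normSq (tensor Xs)) μ X₀ with hXtdef
  have hstep : ∀ t, Xt (t + 1) = rgdStep F (normSq (tensor Xs)) μ (Xt t) := fun t => rfl
  have hEs : ∀ t, IsTTSum r (N + 3) (tensor (Xt t) - tensor Xs) := fun t =>
    ((isTTSum_tensor _).sub hpos (isTTSum_tensor Xs)).mono hpos (by omega)
  have s₀ : (i : Fin N) → Fin (d i) := fun i => ⟨0, hm.dim_pos h0 i⟩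
  have hdesc : ∀ t, potential A ε (tensor (Xt t) - tensor Xs) ≤ 270 * ζ ^ 2 →
      potential A ε (tensor (Xt (t + 1)) - tensor Xs) ≤ 270 * ζ ^ 2 := fun t ht => by
    have he := h.tnorm_le_of_potential_le (hEs t) ht
    refine le_trans ?_ ht
    rw [hstep, hMsq]
    refine h.potential_rgdStep_le hpos h0 hN (hXt t) _ (isTTSum_tensor Xs) hM0 (fun i hi => ?_)
      (by linarith) (by linarith) hμ hμN
    have h1 : fnorm (Xt t i) = tnorm (tensor (Xt t)) := by
      rw [fnorm, ← normSq_tensor_of_leftOrthogonal s₀ h0 hN (hXt t) hi]; rfl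
    have h3 : tensor (Xt t) = (tensor (Xt t) - tensor Xs) + tensor Xs := by abel
    rw [h1, h3]
    refine (tnorm_add_le _ _).trans ?_
    linarith
  -- The second alternative is absorbing by `hdesc`. The first passes to $t+1$ unless the error is
  -- at most $20\zeta$, and then the second begins.
  have key : ∀ t, distSq (Xt t) Xs ≤ (1 - ρ) ^ t * distSq X₀ Xs ∨
      potential A ε (tensor (Xt t) - tensor Xs) ≤ 270 * ζ ^ 2 := fun t => by
    induction t with
    | zero => left; simp [hXtdef, rgd]
    | succ t ih =>
      rcases ih with ih | ih
      · by_cases he : tnorm (tensor (Xt t) - tensor Xs) ≤ 20 * ζ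
        · exact Or.inr (hdesc t (h.potential_le_of_tnorm_le (hEs t) he))
        · left
          have h1 : (1 - ρ) ^ t ≤ 1 := pow_le_one₀ (by linarith) (by linarith)
          have h3 : distSq (Xt t) Xs ≤ distSq X₀ Xs := ih.trans (mul_le_of_le_one_left hd0 h1)
          have h4 := h.distSq_rgdStep_le h2 h0 hN (hXt t) hXs hm hμ hμN (not_le.1 he) hδ
            (h3.trans hdist)
          rw [← hstep] at h4
          have h5 := distSq_le h2 h0 hN (hXt t) hXs hm
          rw [← hσ, hMsq, ← hSdef] at h5
          set E := normSq (tensor (Xt t) - tensor Xs)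
          have hE0 : 0 ≤ E := normSq_nonneg _
          -- Here `distSq_le` turns the decrease into a contraction; $7\cdot4/1280$ is far below
          -- $23/30$.
          have h6 : ρ * distSq (Xt t) Xs ≤ 23 / 30 * (μ * E) := by
            have h7 : ρ * (1280 * S * M ^ 2) * distSq (Xt t) Xs ≤
                28 * μ * (S * M ^ 2 * E) := by
              rw [hρmul]
              have h8 := mul_le_mul_of_nonneg_left h5 (by positivity : 0 ≤ (7 - 30 * δ) * μ)
              have h9 : (7 - 30 * δ) * μ * (4 * S * M ^ 2 * E) ≤ 7 * μ * (4 * S * M ^ 2 * E) :=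
                mul_le_mul_of_nonneg_right (mul_le_mul_of_nonneg_right (by linarith) hμ.le)
                  (by positivity)
              nlinarith
            have h10 : (ρ * distSq (Xt t) Xs) * (1280 * S * M ^ 2) ≤
                (23 / 30 * (μ * E)) * (1280 * S * M ^ 2) := by
              have : 0 ≤ μ * (S * M ^ 2 * E) := by positivity
              nlinarith
            exact le_of_mul_le_mul_right h10 (by positivity)
          rw [pow_succ, mul_comm _ (1 - ρ), mul_assoc]
          have h7 := mul_le_mul_of_nonneg_left ih (by linarith : 0 ≤ 1 - ρ)
          linarith
      · exact Or.inr (hdesc t ih)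
  rcases key t with hA | hB
  · have : 0 ≤ 3600 * S * normSq (tensor Xs) * ζ ^ 2 / σ ^ 2 := by rw [hMsq]; positivity
    linarith
  -- With error at most $30\zeta$, the constant of `distSq_le` becomes $4\cdot900=3600$.
  · have he := h.tnorm_le_of_potential_le (hEs t) hB
    have h1 := distSq_le h2 h0 hN (hXt t) hXs hm
    rw [← hσ, hMsq, ← hSdef, ← tnorm_sq] at h1
    have h3 := pow_le_pow_left₀ (tnorm_nonneg _) he 2
    have h4 : distSq (Xt t) Xs ≤ 3600 * S * normSq (tensor Xs) * ζ ^ 2 / σ ^ 2 := by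
      rw [le_div_iff₀ (by positivity), hMsq]
      have := mul_le_mul_of_nonneg_left h3 (by positivity : 0 ≤ 4 * S * M ^ 2)
      nlinarith
    have h5 : 0 ≤ (1 - ρ) ^ t * distSq X₀ Xs :=
      mul_nonneg (pow_nonneg (by linarith) _) hd0
    linarith

end Iteration

end TT
end

noncomputable section

namespace TT

/-! ### Nets of contractive factors. -/

section Net

/-- A set of points of the unit ball at mutual distances at least `η` is small. -/
lemma card_le_of_separated {E : Type*} [NormedAddCommGroup E] [NormedSpace ℝ E]
    [FiniteDimensional ℝ E] {η : ℝ} (hη : 0 < η) (s : Finset E) (hs : ∀ x ∈ s, ‖x‖ ≤ 1)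
    (h : ∀ x ∈ s, ∀ y ∈ s, x ≠ y → η ≤ ‖x - y‖) :
    (s.card : ℝ) ≤ (1 + 2 / η) ^ Module.finrank ℝ E := by
  borelize E
  let μ : MeasureTheory.Measure E := MeasureTheory.Measure.addHaar
  set A := ⋃ c ∈ s, Metric.ball (c : E) (η / 2) with hA
  have D : Set.Pairwise (s : Set E) (Function.onFun Disjoint fun c => Metric.ball (c : E) (η / 2)) := by
    rintro c hc d hd hcd
    apply Metric.ball_disjoint_ball
    rw [dist_eq_norm]
    have := h c hc d hd hcd
    linarith
  have hρ : 0 < 1 + η / 2 := by positivity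
  have A_subset : A ⊆ Metric.ball (0 : E) (1 + η / 2) := by
    refine Set.iUnion₂_subset fun x hx => ?_
    apply Metric.ball_subset_ball'
    rw [dist_zero_right]
    linarith [hs x hx]
  have I : (s.card : ENNReal) * ENNReal.ofReal ((η / 2) ^ Module.finrank ℝ E) * μ (Metric.ball 0 1) ≤
      ENNReal.ofReal ((1 + η / 2) ^ Module.finrank ℝ E) * μ (Metric.ball 0 1) :=
    calc _ = μ A := by
          rw [hA, MeasureTheory.measure_biUnion_finset D fun c _ => measurableSet_ball]
          simp only [μ.addHaar_ball_of_pos _ (half_pos hη)]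
          simp only [Finset.sum_const, nsmul_eq_mul, mul_assoc]
      _ ≤ μ (Metric.ball (0 : E) (1 + η / 2)) := MeasureTheory.measure_mono A_subset
      _ = _ := by simp only [μ.addHaar_ball_of_pos _ hρ]
  have J := (ENNReal.mul_le_mul_iff_left (Metric.measure_ball_pos _ _ zero_lt_one).ne'
    MeasureTheory.measure_ball_lt_top.ne).1 I
  have K := ENNReal.toReal_le_of_le_ofReal (pow_nonneg hρ.le _) J
  rw [ENNReal.toReal_mul, ENNReal.toReal_natCast, ENNReal.toReal_ofReal (by positivity)] at K
  have h1 : 1 + η / 2 = (1 + 2 / η) * (η / 2) := by field_simp; ring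
  rw [h1, mul_pow] at K
  exact le_of_mul_le_mul_right K (by positivity)

/-- Finite nets of the unit ball. -/
lemma exists_net (E : Type*) [NormedAddCommGroup E] [NormedSpace ℝ E]
    [FiniteDimensional ℝ E] {η : ℝ} (hη : 0 < η) :
    ∃ s : Finset E, (∀ x ∈ s, ‖x‖ ≤ 1) ∧ (∀ x, ‖x‖ ≤ 1 → ∃ y ∈ s, ‖x - y‖ ≤ η) ∧
      (s.card : ℝ) ≤ (1 + 2 / η) ^ Module.finrank ℝ E := by
  classical
  set p : Finset E → Prop := fun s => (∀ x ∈ s, ‖x‖ ≤ 1) ∧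
    ∀ x ∈ s, ∀ y ∈ s, x ≠ y → η ≤ ‖x - y‖ with hp
  -- A separated set of maximal cardinality is a net, since an uncovered point could be added to it.
  set C : Set ℕ := {n | ∃ s, p s ∧ s.card = n} with hC
  have hne : C.Nonempty := ⟨0, ∅, by simp [hp], rfl⟩
  have hbdd : BddAbove C := by
    refine ⟨⌊(1 + 2 / η) ^ Module.finrank ℝ E⌋₊, ?_⟩
    rintro n ⟨s, hs, rfl⟩
    exact Nat.le_floor (card_le_of_separated hη s hs.1 hs.2)
  obtain ⟨s, hs, hcard⟩ := Nat.sSup_mem hne hbdd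
  refine ⟨s, hs.1, fun x hx => ?_, card_le_of_separated hη s hs.1 hs.2⟩
  by_contra! hfar
  have hxs : x ∉ s := fun hxs => by
    have := hfar x hxs
    rw [sub_self, norm_zero] at this
    exact lt_asymm hη this
  have hins : p (insert x s) := by
    refine ⟨fun y hy => ?_, fun y hy z hz hyz => ?_⟩
    · rcases Finset.mem_insert.1 hy with rfl | hy
      · exact hx
      · exact hs.1 y hy
    · rcases Finset.mem_insert.1 hy with hy' | hy' <;> rcases Finset.mem_insert.1 hz with hz' | hz'
      · exact absurd (hy'.trans hz'.symm) hyz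
      · rw [hy']; exact (hfar z hz').le
      · rw [hz', norm_sub_rev]; exact (hfar y hy').le
      · exact hs.2 y hy' z hz' hyz
  have := le_csSup hbdd ⟨_, hins, rfl⟩
  rw [Finset.card_insert_of_notMem hxs, ← hcard] at this
  omega

lemma norm_toLp_sq {n : Type*} [Fintype n] (v : n → ℝ) :
    ‖(WithLp.toLp 2 v : EuclideanSpace ℝ n)‖ ^ 2 = v ⬝ᵥ v := by
  rw [EuclideanSpace.real_norm_sq_eq]
  simp [dotProduct, sq]

open scoped Matrix.Norms.L2Operator in
lemma opBound_iff_norm_le {p q : Type*} [Fintype p] [Fintype q] [DecidableEq q] (A : Matrix p q ℝ)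
    {c : ℝ} (hc : 0 ≤ c) : OpBound A c ↔ ‖A‖ ≤ c := by
  constructor
  · intro h
    rw [Matrix.l2_opNorm_def]
    refine ContinuousLinearMap.opNorm_le_bound _ hc fun x => ?_
    refine abs_le_of_sq_le_sq' ?_ (by positivity) |>.2
    rw [mul_pow]
    have := h (WithLp.ofLp x)
    rw [← norm_toLp_sq, ← norm_toLp_sq] at this
    exact this
  · intro h v
    rw [← norm_toLp_sq, ← norm_toLp_sq, ← mul_pow]
    refine pow_le_pow_left₀ (norm_nonneg _) ?_ 2
    exact (Matrix.l2_opNorm_mulVec A (WithLp.toLp 2 v)).trans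
      (mul_le_mul_of_nonneg_right h (norm_nonneg _))

open scoped Matrix.Norms.L2Operator in
-- The net is taken in the operator norm, so its members are contractions too and its cardinality
-- depends only on the dimension $eab$.
lemma exists_net_factor (e a b : ℕ) {η : ℝ} (hη : 0 < η) :
    ∃ s : Finset (Fin e → Matrix (Fin a) (Fin b) ℝ), (∀ Y ∈ s, OpBound (leftUnfold Y) 1) ∧
      (∀ Y : Fin e → Matrix (Fin a) (Fin b) ℝ, OpBound (leftUnfold Y) 1 →
        ∃ Z ∈ s, OpBound (leftUnfold (Y - Z)) η) ∧
      (s.card : ℝ) ≤ (1 + 2 / η) ^ (e * a * b) := by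
  classical
  obtain ⟨s, h1, h2, h3⟩ := exists_net (Matrix (Fin e × Fin a) (Fin b) ℝ) hη
  refine ⟨s.image leftFold, fun Y hY => ?_, fun Y hY => ?_, ?_⟩
  · obtain ⟨M, hM, rfl⟩ := Finset.mem_image.1 hY
    exact (opBound_iff_norm_le _ zero_le_one).2 (h1 M hM)
  · obtain ⟨M, hM, hd⟩ := h2 (leftUnfold Y) ((opBound_iff_norm_le _ zero_le_one).1 hY)
    exact ⟨leftFold M, Finset.mem_image_of_mem _ hM, (opBound_iff_norm_le _ hη.le).2 hd⟩
  · rw [Module.finrank_matrix] at h3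
    simp only [Fintype.card_prod, Fintype.card_fin, Module.finrank_self, mul_one] at h3
    exact le_trans (by exact_mod_cast Finset.card_image_le) h3

variable {N : ℕ} {d : Fin N → ℕ} {q : Fin (N + 1) → ℕ}

/-- Nets of the factors whose left unfoldings are contractions. -/
lemma exists_net_factors (d : Fin N → ℕ) (q : Fin (N + 1) → ℕ) {η : ℝ} (hη : 0 < η) :
    ∃ s : Finset (Factors d q), (∀ Z ∈ s, ∀ i, OpBound (leftUnfold (Z i)) 1) ∧
      (∀ V : Factors d q, (∀ i, OpBound (leftUnfold (V i)) 1) →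
        ∃ Z ∈ s, ∀ i, OpBound (leftUnfold (V i - Z i)) η) ∧
      (s.card : ℝ) ≤ (1 + 2 / η) ^ ∑ i : Fin N, d i * q i.castSucc * q i.succ := by
  choose s h1 h2 h3 using fun i : Fin N => exists_net_factor (d i) (q i.castSucc) (q i.succ) hη
  refine ⟨Fintype.piFinset s, fun Z hZ i => h1 i _ (Fintype.mem_piFinset.1 hZ i), fun V hV => ?_, ?_⟩
  · choose Z hZ hd using fun i => h2 i (V i) (hV i)
    exact ⟨Z, Fintype.mem_piFinset.2 hZ, hd⟩
  · rw [Fintype.card_piFinset, Nat.cast_prod, ← Finset.prod_pow_eq_pow_sum]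
    exact Finset.prod_le_prod (fun _ _ => Nat.cast_nonneg _) fun i _ => h3 i

lemma OpBound.smul {p q : Type*} [Fintype p] [Fintype q] {A : Matrix p q ℝ} {c : ℝ}
    (h : OpBound A c) (t : ℝ) : OpBound (t • A) (t * c) := fun v => by
  rw [Matrix.smul_mulVec, smul_dotProduct, dotProduct_smul, smul_eq_mul, smul_eq_mul, mul_pow]
  have := mul_le_mul_of_nonneg_left (h v) (sq_nonneg t)
  linarith

/-- A linear form of the tensor is controlled by its values on a net of the factors. -/
lemma abs_le_two_mul_of_net (hpos : 0 < N) (h0 : q 0 = 1) (hN : q (Fin.last N) = 1)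
    (f : Tensor d →ₗ[ℝ] ℝ) {K u : ℝ} (hK : ∀ T, |f T| ≤ K * tnorm T) {s : Finset (Factors d q)}
    (h1 : ∀ Z ∈ s, ∀ i, OpBound (leftUnfold (Z i)) 1)
    (h2 : ∀ V : Factors d q, (∀ i, OpBound (leftUnfold (V i)) 1) →
      ∃ Z ∈ s, ∀ i, OpBound (leftUnfold (V i - Z i)) (1 / (2 * N)))
    (hu : ∀ Z ∈ s, |f (tensor Z)| ≤ u) {V : Factors d q}
    (hV : ∀ i, OpBound (leftUnfold (V i)) 1) : |f (tensor V)| ≤ 2 * u := by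
  have hN0 : (0 : ℝ) < N := by exact_mod_cast hpos
  set B : Set ℝ := {x | ∃ V : Factors d q, (∀ i, OpBound (leftUnfold (V i)) 1) ∧
    |f (tensor V)| = x} with hB
  -- The bound by $K$ only makes the supremum finite; its value does not enter the result.
  have hbdd : BddAbove B := by
    refine ⟨|K|, ?_⟩
    rintro x ⟨V, hV, rfl⟩
    have h3 : tnorm (tensor V) ≤ 1 := by
      simpa using tnorm_tensor_le h0 hN V (fun _ => 1) hV fun _ => zero_le_one
    calc |f (tensor V)| ≤ K * tnorm (tensor V) := hK _
      _ ≤ |K| * 1 := mul_le_mul (le_abs_self _) h3 (tnorm_nonneg _) (abs_nonneg _)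
      _ = |K| := mul_one _
  have hmem : |f (tensor V)| ∈ B := ⟨V, hV, rfl⟩
  set σ := sSup B with hσ
  have hle : ∀ V : Factors d q, (∀ i, OpBound (leftUnfold (V i)) 1) → |f (tensor V)| ≤ σ :=
    fun V hV => le_csSup hbdd ⟨V, hV, rfl⟩
  have hstep : ∀ x ∈ B, x ≤ u + σ / 2 := by
    rintro x ⟨V, hV, rfl⟩
    obtain ⟨Z, hZ, hd⟩ := h2 V hV
    -- Factors are exchanged one at a time. Each difference is $1/(2N)$ times a contraction, so the
    -- $N$ terms together are at most half of the supremum.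
    have h3 : f (tensor V) = f (tensor Z) + ∑ i : Fin N, f (tensorAt (mix V Z i) i (V i - Z i)) := by
      rw [← map_sum, ← tensor_sub_eq_sum, map_sub]; ring
    have h4 : ∀ i : Fin N, |f (tensorAt (mix V Z i) i (V i - Z i))| ≤ 1 / (2 * N) * σ := fun i => by
      have h5 : V i - Z i = (1 / (2 * (N : ℝ))) • ((2 * (N : ℝ)) • (V i - Z i)) := by
        rw [smul_smul, one_div, inv_mul_cancel₀ (by positivity), one_smul]
      rw [h5, map_smul, map_smul, smul_eq_mul, abs_mul, abs_of_nonneg (by positivity)]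
      refine mul_le_mul_of_nonneg_left ?_ (by positivity)
      rw [tensorAt_apply]
      refine hle _ fun j => ?_
      by_cases hj : j = i
      · subst hj
        rw [Function.update_self]
        have h6 := (hd j).smul (2 * (N : ℝ))
        rwa [mul_one_div_cancel (by positivity)] at h6
      · rw [Function.update_of_ne hj]
        by_cases hji : (j : ℕ) < i
        · rw [mix_of_lt hji]; exact h1 Z hZ j
        · rw [mix_of_le (not_lt.1 hji)]; exact hV j
    have h7 := (Finset.abs_sum_le_sum_abs _ _).trans
      (Finset.sum_le_sum fun i (_ : i ∈ Finset.univ) => h4 i)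
    rw [Finset.sum_const, Finset.card_univ, Fintype.card_fin, nsmul_eq_mul] at h7
    have h8 : (N : ℝ) * (1 / (2 * N) * σ) = σ / 2 := by field_simp
    rw [h8] at h7
    rw [h3]
    exact (abs_add_le _ _).trans (add_le_add (hu Z hZ) h7)
  have h9 : σ ≤ u + σ / 2 := csSup_le ⟨_, hmem⟩ hstep
  have := hle V hV
  linarith

end Net

/-! ### Contractive normal form of a TT tensor. -/

section NormalForm

variable {N : ℕ} {d : Fin N → ℕ} {q : Fin (N + 1) → ℕ}

/-- A sweep from left to right replaces each factor by a polar factor and passes the square root of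
the Gram matrix on to the next. The sizes are unchanged and no rank condition is needed, but the
prefix is then isometric only on the range of $Q$. -/
lemma exists_contraction_partialProd (s₀ : (i : Fin N) → Fin (d i)) (h0 : q 0 = 1)
    (Z : Factors d q) (k : Fin (N + 1)) :
    ∃ (V : Factors d q) (Q : Matrix (Fin (q k)) (Fin (q k)) ℝ),
      (∀ i : Fin N, (i : ℕ) < k → OpBound (leftUnfold (V i)) 1) ∧
      (∀ s, partialProd Z s k = partialProd V s k * Q) ∧
      ∀ w, (leftMat V s₀ k *ᵥ (Q *ᵥ w)) ⬝ᵥ (leftMat V s₀ k *ᵥ (Q *ᵥ w)) =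
        (Q *ᵥ w) ⬝ᵥ (Q *ᵥ w) := by
  induction k using Fin.induction with
  | zero =>
    refine ⟨Z, 1, fun i hi => absurd hi (Nat.not_lt_zero _), fun s => (Matrix.mul_one _).symm,
      fun w => ?_⟩
    rw [Matrix.one_mulVec]
    have : Unique (Fin (q 0)) := by rw [h0]; infer_instance
    have h : ∀ a, (leftMat Z s₀ 0 *ᵥ w) a = w default := fun a => by
      simp [Matrix.mulVec, dotProduct, leftMat_zero s₀ Z a]
    rw [dotProduct, Fintype.sum_unique, h, dotProduct, Fintype.sum_unique]
  | succ i ih =>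
    obtain ⟨V, Q, hV, hP, hQ⟩ := ih
    set L := leftUnfold (fun x => Q * Z i x) with hL
    set Q' := cfc (fun x : ℝ => √x) (Lᵀ * L) with hQ'
    set V' := Function.update V i (leftFold (polarRetr L)) with hV'
    have hsplit : ∀ x, Q * Z i x = V' i x * Q' := fun x => by
      have h1 : leftFold L x = leftFold (polarRetr L * Q') x := by
        rw [hQ', polarRetr_mul_sqrt]
      rw [hL, leftFold_leftUnfold] at h1
      rw [h1, hV', Function.update_self]
      rfl
    have hlm : ∀ v, leftMat V' s₀ i.castSucc *ᵥ v = leftMat V s₀ i.castSucc *ᵥ v := fun v => by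
      have : leftMat V' s₀ i.castSucc = leftMat V s₀ i.castSucc := by
        ext a b
        simp only [leftMat, Matrix.of_apply, hV', partialProd_update_of_le _ _ _ _ i.castSucc le_rfl]
      rw [this]
    refine ⟨V', Q', fun j hj => ?_, fun s => ?_, fun w => ?_⟩
    · by_cases hji : j = i
      · subst hji
        rw [hV', Function.update_self, leftUnfold_leftFold]
        exact opBound_polarRetr _
      · rw [hV', Function.update_of_ne hji]
        refine hV j ?_
        have : (j : ℕ) ≠ i := fun h => hji (Fin.ext h)
        simp only [Fin.val_succ] at hj
        simp only [Fin.val_castSucc]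
        omega
    · rw [partialProd_succ, partialProd_succ, hP, Matrix.mul_assoc, Matrix.mul_assoc, ← hsplit, hV',
        partialProd_update_of_le _ _ _ _ i.castSucc le_rfl]
    · rw [leftMat_succ_dot]
      have h1 : ∀ x, V' i x *ᵥ (Q' *ᵥ w) = Q *ᵥ (Z i x *ᵥ w) := fun x => by
        rw [Matrix.mulVec_mulVec, ← hsplit, Matrix.mulVec_mulVec]
      simp only [h1, hlm, hQ]
      have h2 : ∀ x, Q *ᵥ (Z i x *ᵥ w) = (Q * Z i x) *ᵥ w := fun x => by rw [Matrix.mulVec_mulVec]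
      simp only [h2]
      rw [← leftUnfold_mulVec_dot (fun x => Q * Z i x), ← hL, mulVec_dot_self, mulVec_dot_self,
        hQ', sqrt_gram_transpose_mul_self]

/-- Every tensor in TT format is a multiple of one whose factors have left unfoldings that are
contractions, and the multiple is the norm of the tensor. -/
lemma exists_contraction_tensor (s₀ : (i : Fin N) → Fin (d i)) (h0 : q 0 = 1)
    (hN : q (Fin.last N) = 1) (Z : Factors d q) :
    ∃ (V : Factors d q) (c : ℝ), (∀ i, OpBound (leftUnfold (V i)) 1) ∧
      tensor Z = c • tensor V ∧ |c| = tnorm (tensor Z) := by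
  obtain ⟨V, Q, hV, hP, hQ⟩ := exists_contraction_partialProd s₀ h0 Z (Fin.last N)
  have : Unique (Fin (q (Fin.last N))) := by rw [hN]; infer_instance
  refine ⟨V, Q default default, fun i => hV i i.2, ?_, ?_⟩
  · ext s
    simp only [tensor, hP, Pi.smul_apply, smul_eq_mul, Fintype.sum_unique, Matrix.mul_apply,
      Finset.mul_sum]
    exact Finset.sum_congr rfl fun a _ => mul_comm _ _
  · have h1 : leftMat Z s₀ (Fin.last N) *ᵥ 1 = leftMat V s₀ (Fin.last N) *ᵥ (Q *ᵥ 1) := by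
      rw [Matrix.mulVec_mulVec]
      congr 1
      ext a b
      simp only [leftMat, Matrix.of_apply, hP, Matrix.mul_apply, Fintype.sum_unique, Finset.sum_mul]
    rw [tnorm, normSq_tensor_eq_dot s₀, h1, hQ]
    simp only [Matrix.mulVec, dotProduct, Fintype.sum_unique, Pi.one_apply, mul_one]
    exact (Real.sqrt_mul_self_eq_abs _).symm

end NormalForm

end TT
end

noncomputable section

namespace TT

/-! ### Gaussian tails and the union bound. -/

section Tail

open MeasureTheory ProbabilityTheory

lemma hasSubgaussianMGF_gaussianReal (v : ℝ≥0) : HasSubgaussianMGF id v (gaussianReal 0 v) where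
  integrable_exp_mul t := integrable_exp_mul_gaussianReal t
  mgf_le t := by rw [mgf_id_gaussianReal]; simp

lemma hasSubgaussianMGF_sum_mul {m : ℕ} (v : ℝ≥0) (c : Fin m → ℝ) :
    HasSubgaussianMGF (fun x : Fin m → ℝ => ∑ k, c k * x k)
      (∑ k, ⟨c k ^ 2, sq_nonneg _⟩ * v) (Measure.pi fun _ : Fin m => gaussianReal 0 v) := by
  have hind : iIndepFun (fun (k : Fin m) (x : Fin m → ℝ) => c k * x k)
      (Measure.pi fun _ : Fin m => gaussianReal 0 v) :=
    iIndepFun_pi (X := fun k y => c k * y) fun k => by fun_prop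
  refine HasSubgaussianMGF.sum_of_iIndepFun hind fun k _ => ?_
  refine HasSubgaussianMGF.const_mul (X := fun x : Fin m → ℝ => x k) ?_ (c k)
  have h := measurePreserving_eval (fun _ : Fin m => gaussianReal 0 v) k
  have h1 := hasSubgaussianMGF_gaussianReal v
  rw [← h.map_eq] at h1
  exact HasSubgaussianMGF.of_map h.measurable.aemeasurable h1

/-- The two-sided tail of a sub-Gaussian random variable, also in the degenerate case. -/
lemma measureReal_lt_abs_le {Ω : Type*} [MeasurableSpace Ω] {P : Measure Ω} [IsProbabilityMeasure P]
    {X : Ω → ℝ} {v : ℝ≥0} (h : HasSubgaussianMGF X v P) {u L : ℝ} (hu : 0 ≤ u)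
    (huL : 2 * v * L ≤ u ^ 2) : P.real {ω | u < |X ω|} ≤ 2 * Real.exp (-L) := by
  by_cases hv : v = 0
  · subst hv
    have h0 := h.ae_eq_zero_of_hasSubgaussianMGF_zero
    have : P {ω | u < |X ω|} = 0 := by
      refine measure_mono_null (fun ω hω => ?_) h0
      intro h'
      have hω' : u < |X ω| := hω
      have h'' : X ω = 0 := h'
      rw [h'', abs_zero] at hω'
      exact absurd hω' (not_lt.2 hu)
    rw [Measure.real, this, ENNReal.toReal_zero]
    positivity
  · have hv0 : (0 : ℝ) < v := by exact_mod_cast pos_iff_ne_zero.2 hv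
    have h1 := h.measure_ge_le hu
    have h2 := h.neg.measure_ge_le hu
    have h3 : Real.exp (-u ^ 2 / (2 * v)) ≤ Real.exp (-L) := by
      rw [Real.exp_le_exp, div_le_iff₀ (by positivity)]
      linarith
    have h4 : {ω | u < |X ω|} ⊆ {ω | u ≤ X ω} ∪ {ω | u ≤ (-X) ω} := fun ω hω => by
      rcases lt_abs.1 (show u < |X ω| from hω) with h' | h'
      · exact Or.inl h'.le
      · exact Or.inr h'.le
    have h5 := (measureReal_mono (μ := P) h4).trans (measureReal_union_le _ _)
    linarith

variable {N : ℕ} {d : Fin N → ℕ} {m : ℕ}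

/-- The noise form at $T$ is a linear combination of independent Gaussians with variance
$\frac{\gamma^2}m$ times `bil A T T`. -/
lemma measureReal_lt_abs_noise_le (A : Fin m → Tensor d) (γ : ℝ≥0) (T : Tensor d) {v u L : ℝ}
    (hv : (γ : ℝ) ^ 2 / m * bil A T T ≤ v) (hL : 0 ≤ L) (hu : 0 ≤ u) (huL : 2 * v * L ≤ u ^ 2) :
    (Measure.pi fun _ : Fin m => gaussianReal 0 (γ ^ 2)).real {x | u < |noise A x T|} ≤
      2 * Real.exp (-L) := by
  have h := hasSubgaussianMGF_sum_mul (γ ^ 2) fun k => 1 / (m : ℝ) * inner (A k) T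
  have h1 : ∀ x, noise A x T = ∑ k, 1 / (m : ℝ) * inner (A k) T * x k := fun x => by
    rw [noise, Finset.mul_sum]
    exact Finset.sum_congr rfl fun k _ => by ring
  simp only [h1]
  refine measureReal_lt_abs_le h hu (le_trans ?_ huL)
  refine mul_le_mul_of_nonneg_right (mul_le_mul_of_nonneg_left (le_trans (le_of_eq ?_) hv)
    (by norm_num)) hL
  push_cast
  rw [bil_self, Finset.mul_sum, Finset.mul_sum]
  refine Finset.sum_congr rfl fun k _ => ?_
  change (1 / (m : ℝ) * inner (A k) T) ^ 2 * (γ : ℝ) ^ 2 = _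
  ring

lemma measurable_noise (A : Fin m → Tensor d) (T : Tensor d) :
    Measurable fun x : Fin m → ℝ => noise A x T := by
  unfold noise
  fun_prop

/-- With high probability the noise is small on a given finite set of tensors. -/
lemma exists_event_noise_le {Ω : Type*} [MeasurableSpace Ω] {P : Measure Ω} [IsProbabilityMeasure P]
    {ε : Ω → Fin m → ℝ} {γ : ℝ≥0}
    (hε : HasLaw ε (Measure.pi fun _ : Fin m => gaussianReal 0 (γ ^ 2)) P)
    (A : Fin m → Tensor d) {ι : Type*} (s : Finset ι) (T : ι → Tensor d) {v u L : ℝ}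
    (hv : ∀ i ∈ s, (γ : ℝ) ^ 2 / m * bil A (T i) (T i) ≤ v) (hL : 0 ≤ L) (hu : 0 ≤ u)
    (huL : 2 * v * L ≤ u ^ 2) :
    ∃ E : Set Ω, MeasurableSet E ∧ 1 - s.card * (2 * Real.exp (-L)) ≤ P.real E ∧
      ∀ ω ∈ E, ∀ i ∈ s, |noise A (ε ω) (T i)| ≤ u := by
  set Q := Measure.pi fun _ : Fin m => gaussianReal 0 (γ ^ 2)
  set bad : Set (Fin m → ℝ) := ⋃ i ∈ s, {x | u < |noise A x (T i)|} with hbad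
  have hmeas : MeasurableSet bad := Finset.measurableSet_biUnion _ fun i _ =>
    measurableSet_lt measurable_const (measurable_noise A (T i)).abs
  have hQ : Q.real bad ≤ s.card * (2 * Real.exp (-L)) := by
    refine (measureReal_biUnion_finset_le s _).trans ?_
    rw [← nsmul_eq_mul]
    exact Finset.sum_le_card_nsmul _ _ _ fun i hi =>
      measureReal_lt_abs_noise_le A γ (T i) (hv i hi) hL hu huL
  have hP : P {ω | ε ω ∈ bad} = Q bad := hε.measure_eq (p := fun x => x ∈ bad) hmeas
  -- A law makes $\epsilon$ only almost everywhere measurable, so the bad set is replaced by a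
  -- measurable hull of the same probability.
  refine ⟨(toMeasurable P {ω | ε ω ∈ bad})ᶜ, (measurableSet_toMeasurable _ _).compl, ?_,
    fun ω hω i hi => ?_⟩
  · rw [probReal_compl_eq_one_sub (measurableSet_toMeasurable _ _), Measure.real,
      measure_toMeasurable, hP]
    exact sub_le_sub_left hQ 1
  · by_contra! hlt
    exact hω (subset_toMeasurable _ _ (Set.mem_biUnion hi hlt))

end Tail

end TT
end

noncomputable section

namespace TT

/-! ### The noise on all sums of TT tensors. -/

section NoiseBound

open MeasureTheory ProbabilityTheory

variable {N : ℕ} {d : Fin N → ℕ} {r : Fin (N + 1) → ℕ} {m : ℕ}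

lemma le_maxDim (d : Fin N → ℕ) (i : Fin N) : d i ≤ maxDim d :=
  Finset.le_sup (f := d) (Finset.mem_univ i)

lemma innerSizes_le {J : ℕ} (hJ : 1 ≤ J * maxRank r) (k : Fin (N + 1)) :
    innerSizes (fun k => J * r k) k ≤ J * maxRank r := by
  by_cases hk : k ∈ innerBonds N
  · rw [innerSizes_of_mem _ hk]
    exact Nat.mul_le_mul_left _ (le_maxRank r hk)
  · rwa [innerSizes, if_neg hk]

/-- For $N\ge2$ one has $1+4N\le N^4$ and $N+3\le\frac52N$, and $4\cdot\frac{25}4=25$. -/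
lemma log_net_le (h2 : 2 ≤ N) (D R : ℝ) (hD : 0 ≤ D) {n : ℕ}
    (hn : (n : ℝ) ≤ N * (D * (((N : ℝ) + 3) * R) ^ 2)) :
    n * Real.log (1 + 4 * N) ≤ 25 * ((N : ℝ) ^ 3 * D * R ^ 2 * Real.log N) := by
  have hN : (2 : ℝ) ≤ N := by exact_mod_cast h2
  have hlog : 0 ≤ Real.log N := Real.log_nonneg (by linarith)
  have h1 : Real.log (1 + 4 * N) ≤ 4 * Real.log N := by
    rw [show 4 * Real.log N = Real.log ((N : ℝ) ^ 4) by rw [Real.log_pow]; norm_num]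
    refine Real.log_le_log (by positivity) ?_
    have : (2 : ℝ) ^ 3 ≤ (N : ℝ) ^ 3 := pow_le_pow_left₀ (by norm_num) hN 3
    nlinarith
  have h3 : ((N : ℝ) + 3) ^ 2 ≤ (5 / 2 * N) ^ 2 := pow_le_pow_left₀ (by positivity) (by linarith) 2
  calc n * Real.log (1 + 4 * N) ≤ N * (D * (((N : ℝ) + 3) * R) ^ 2) * (4 * Real.log N) :=
        mul_le_mul hn h1 (Real.log_nonneg (by linarith)) (by positivity)
    _ = ((N : ℝ) + 3) ^ 2 * (4 * N * D * R ^ 2 * Real.log N) := by ring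
    _ ≤ (5 / 2 * N) ^ 2 * (4 * N * D * R ^ 2 * Real.log N) :=
        mul_le_mul_of_nonneg_right h3 (by positivity)
    _ = _ := by ring

lemma abs_noise_le (A : Fin m → Tensor d) (ε : Fin m → ℝ) (T : Tensor d) :
    |noise A ε T| ≤ (1 / (m : ℝ) * ∑ k, |ε k| * tnorm (A k)) * tnorm T := by
  rw [noise, abs_mul, abs_of_nonneg (by positivity : (0 : ℝ) ≤ 1 / m), mul_assoc]
  refine mul_le_mul_of_nonneg_left ?_ (by positivity)
  refine (Finset.abs_sum_le_sum_abs _ _).trans ?_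
  rw [Finset.sum_mul]
  refine Finset.sum_le_sum fun k _ => ?_
  rw [abs_mul, mul_assoc]
  exact mul_le_mul_of_nonneg_left (abs_inner_le _ _) (abs_nonneg _)

/-- The noise as a linear form. -/
def noiseₗ (A : Fin m → Tensor d) (ε : Fin m → ℝ) : Tensor d →ₗ[ℝ] ℝ where
  toFun := noise A ε
  map_add' := noise_add A ε
  map_smul' c T := by
    simp only [noise, ← innerₗ_apply, map_smul, smul_eq_mul, RingHom.id_apply, Finset.mul_sum]
    exact Finset.sum_congr rfl fun k _ => by ring

/-- With high probability the noise is small on all sums of `N + 3` tensors in TT format. -/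
lemma exists_event_noise_le_tnorm {Ω : Type*} [MeasurableSpace Ω] {P : Measure Ω}
    [IsProbabilityMeasure P] {ε : Ω → Fin m → ℝ} {γ : ℝ≥0} {A : Fin m → Tensor d} {δ : ℝ}
    (h2 : 2 ≤ N) (s₀ : (i : Fin N) → Fin (d i)) (hr : 1 ≤ maxRank r)
    (hA : RIP A ((N + 3) * maxRank r) δ) (hδ : 0 ≤ 1 + δ)
    (hε : HasLaw ε (Measure.pi fun _ : Fin m => gaussianReal 0 (γ ^ 2)) P) :
    ∃ E : Set Ω, MeasurableSet E ∧
      1 - 2 * Real.exp (-((N : ℝ) ^ 3 * maxDim d * (maxRank r : ℝ) ^ 2 * Real.log N)) ≤ P.real E ∧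
      ∀ ω ∈ E, ∀ T : Tensor d, IsTTSum r (N + 3) T → |noise A (ε ω) T| ≤
        2 * √(52 * ((γ : ℝ) ^ 2 / m * (1 + δ)) *
          ((N : ℝ) ^ 3 * maxDim d * (maxRank r : ℝ) ^ 2 * Real.log N)) * tnorm T := by
  have hpos : 0 < N := by omega
  have hN : (2 : ℝ) ≤ N := by exact_mod_cast h2
  have hN0 : (0 : ℝ) < N := by linarith
  have hlog : 0 ≤ Real.log N := Real.log_nonneg (by linarith)
  set Λ := (N : ℝ) ^ 3 * maxDim d * (maxRank r : ℝ) ^ 2 * Real.log N with hΛ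
  have hΛ0 : 0 ≤ Λ := by positivity
  set v := (γ : ℝ) ^ 2 / m * (1 + δ) with hv
  have hv0 : 0 ≤ v := by positivity
  set q := innerSizes fun k => (N + 3) * r k with hq
  have hq0 : q 0 = 1 := innerSizes_zero _
  have hqN : q (Fin.last N) = 1 := innerSizes_last _
  have hρ : 1 ≤ (N + 3) * maxRank r := Nat.mul_pos (by omega) hr
  obtain ⟨s, hs1, hs2, hs3⟩ := exists_net_factors d q (η := 1 / (2 * (N : ℝ))) (by positivity)
  set n := ∑ i : Fin N, d i * q i.castSucc * q i.succ with hn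
  have hnle : (n : ℝ) ≤ N * (maxDim d * (((N : ℝ) + 3) * maxRank r) ^ 2) := by
    have h3 : n ≤ ∑ _i : Fin N, maxDim d * ((N + 3) * maxRank r) * ((N + 3) * maxRank r) :=
      Finset.sum_le_sum fun i _ => Nat.mul_le_mul (Nat.mul_le_mul (le_maxDim d i)
        (innerSizes_le hρ _)) (innerSizes_le hρ _)
    rw [Finset.sum_const, Finset.card_univ, Fintype.card_fin, smul_eq_mul] at h3
    calc (n : ℝ) ≤ ((N * (maxDim d * ((N + 3) * maxRank r) * ((N + 3) * maxRank r)) : ℕ) : ℝ) := by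
          exact_mod_cast h3
      _ = _ := by push_cast; ring
  have hcard : (s.card : ℝ) ≤ Real.exp (25 * Λ) := by
    refine hs3.trans ?_
    have h3 : 1 + 2 / (1 / (2 * (N : ℝ))) = 1 + 4 * N := by rw [div_div_eq_mul_div]; ring
    have h4 := log_net_le h2 (maxDim d) (maxRank r) (Nat.cast_nonneg _) hnle
    rw [h3, ← Real.log_le_iff_le_exp (by positivity), Real.log_pow]
    exact h4
  set u := √(52 * v * Λ) with hu
  have husq : u ^ 2 = 52 * v * Λ := Real.sq_sqrt (by positivity)
  -- The exponent $26\Lambda$ beats the cardinality $e^{25\Lambda}$ and leaves $e^{-\Lambda}$; the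
  -- $52$ in $u^2$ is $2\cdot26$.
  obtain ⟨E, hE1, hE2, hE3⟩ := exists_event_noise_le hε A s (fun Z => tensor Z) (v := v) (u := u)
    (L := 26 * Λ) (fun Z hZ => by
      have h3 := (hA q hq0 hqN (fun k _ => innerSizes_le hρ k) Z).2
      have h4 : normSq (tensor Z) ≤ 1 := by
        simpa using normSq_tensor_le hq0 hqN Z (fun _ => 1) (hs1 Z hZ)
      rw [bil_self]
      refine mul_le_mul_of_nonneg_left (h3.trans ?_) (by positivity)
      exact mul_le_of_le_one_right hδ h4) (by positivity) (Real.sqrt_nonneg _) (by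
      rw [husq]; exact le_of_eq (by ring))
  refine ⟨E, hE1, le_trans (sub_le_sub_left ?_ 1) hE2, fun ω hω T hT => ?_⟩
  · calc s.card * (2 * Real.exp (-(26 * Λ))) ≤ Real.exp (25 * Λ) * (2 * Real.exp (-(26 * Λ))) :=
        mul_le_mul_of_nonneg_right hcard (by positivity)
      _ = 2 * Real.exp (-Λ) := by
        rw [mul_left_comm, ← Real.exp_add]; ring_nf
  · obtain ⟨Z, rfl⟩ := exists_factors_of_isTTSum hpos hT
    obtain ⟨V, c, hV, hZV, hc⟩ := exists_contraction_tensor s₀ hq0 hqN Z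
    have h3 := abs_le_two_mul_of_net hpos hq0 hqN (noiseₗ A (ε ω)) (abs_noise_le A (ε ω)) hs1 hs2
      (hE3 ω hω) hV
    have h4 : noise A (ε ω) (tensor Z) = c * noise A (ε ω) (tensor V) := by
      rw [hZV]; exact map_smul (noiseₗ A (ε ω)) c (tensor V)
    rw [h4, abs_mul, hc, mul_comm]
    exact mul_le_mul_of_nonneg_right h3 (tnorm_nonneg _)

end NoiseBound

end TT
end

set_option linter.unusedSectionVars false

/-! ### Numerical conditions and the final assembly. -/

namespace TT

variable {N : ℕ} {d : Fin N → ℕ} {r : Fin (N + 1) → ℕ}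

/-- The number of measurements makes the noise small. -/
lemma noise_level_le {Λ R γ δ m σ : ℝ} (hΛ : 0 ≤ Λ) (hR : 1 ≤ R) (hm : 0 < m) (hσ : 0 < σ)
    (hδ : δ ≤ 7 / 30) (h : 10 ^ 8 * (R * Λ * γ ^ 2 / σ ^ 2) ≤ m) :
    2 * √(52 * (γ ^ 2 / m * (1 + δ)) * Λ) ≤ σ / 600 := by
  have h1 : √(52 * (γ ^ 2 / m * (1 + δ)) * Λ) ≤ σ / 1200 := by
    refine Real.sqrt_le_iff.2 ⟨by positivity, ?_⟩
    have h2 : 10 ^ 8 * (R * Λ * γ ^ 2) ≤ m * σ ^ 2 := by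
      rwa [← mul_div_assoc, div_le_iff₀ (by positivity)] at h
    have h3 : 52 * (γ ^ 2 / m * (1 + δ)) * Λ = 52 * (1 + δ) * (Λ * γ ^ 2) / m := by ring
    have hX : 0 ≤ Λ * γ ^ 2 := by positivity
    rw [h3, div_le_iff₀ hm]
    -- Only $R\ge1$ matters. The constant $10^8$ exceeds $65\cdot1200^2$.
    have h4 : 1 * (Λ * γ ^ 2) ≤ R * (Λ * γ ^ 2) := mul_le_mul_of_nonneg_right hR hX
    have h5 : 52 * (1 + δ) * (Λ * γ ^ 2) ≤ 65 * (Λ * γ ^ 2) :=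
      mul_le_mul_of_nonneg_right (by linarith) hX
    linarith
  linarith

/-- The bound $7N/(20(9N-5))$ decreases in $N$ and equals $14/260<27/500$ at $N=2$. Positivity of
$7-30\delta$ follows from the existence of a positive admissible step size. -/
lemma step_mul_le {δ μ : ℝ} (h2 : 2 ≤ N) (hδ0 : 0 ≤ δ) (hμ0 : 0 < μ)
    (hμ : μ ≤ (7 - 30 * δ) / (20 * (9 * (N : ℝ) - 5) * (1 + δ) ^ 2)) :
    0 < 7 - 30 * δ ∧ μ * N ≤ 27 / 500 := by
  have hN : (2 : ℝ) ≤ N := by exact_mod_cast h2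
  have h1 : 0 < 20 * (9 * (N : ℝ) - 5) := by linarith
  have h3 : (1 : ℝ) ≤ (1 + δ) ^ 2 := one_le_pow₀ (by linarith)
  rw [le_div_iff₀ (by positivity)] at hμ
  have h4 : 0 < μ * (20 * (9 * (N : ℝ) - 5) * (1 + δ) ^ 2) := by positivity
  have h5 : μ * (20 * (9 * (N : ℝ) - 5)) * 1 ≤ μ * (20 * (9 * (N : ℝ) - 5)) * (1 + δ) ^ 2 :=
    mul_le_mul_of_nonneg_left h3 (by positivity)
  have h6 : μ * 2 ≤ μ * N := mul_le_mul_of_nonneg_left hN hμ0.le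
  exact ⟨by linarith, by linarith⟩

/-- Here $3600\cdot4\cdot52=748800$, and $7-30\delta\le7$ pays for the extra denominator, as
$7\cdot748800<10^7$. The part with $\mu$ is surplus. -/
lemma noise_term_le {D R S lg M2 γ δ m σ μ Nr : ℝ} (hN : 0 ≤ Nr) (hμ : 0 ≤ μ) (hD : 0 ≤ D)
    (hS : 0 ≤ S) (hlg : 0 ≤ lg) (hM : 0 ≤ M2) (hm : 0 < m) (hσ : 0 < σ) (hδ0 : 0 ≤ δ)
    (hδ : 0 < 7 - 30 * δ) :
    3600 * S * M2 * (2 * √(52 * (γ ^ 2 / m * (1 + δ)) * (Nr ^ 3 * D * R ^ 2 * lg))) ^ 2 / σ ^ 2 ≤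
      10 ^ 7 * ((Nr + μ) * S * (1 + δ) * Nr ^ 2 * D * R ^ 2 * lg * M2 * γ ^ 2 /
        (m * (7 - 30 * δ) * σ ^ 2)) := by
  rw [mul_pow, Real.sq_sqrt (by positivity)]
  set B := S * (1 + δ) * Nr ^ 2 * D * R ^ 2 * lg * M2 * γ ^ 2 with hB
  have hB0 : 0 ≤ B := by positivity
  have e1 : 3600 * S * M2 * (2 ^ 2 * (52 * (γ ^ 2 / m * (1 + δ)) * (Nr ^ 3 * D * R ^ 2 * lg))) /
      σ ^ 2 = 748800 * (7 - 30 * δ) * (Nr * B) / (m * (7 - 30 * δ) * σ ^ 2) := by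
    rw [hB]
    generalize 7 - 30 * δ = e at hδ
    have := hδ.ne'
    field_simp
    ring
  have e2 : 10 ^ 7 * ((Nr + μ) * S * (1 + δ) * Nr ^ 2 * D * R ^ 2 * lg * M2 * γ ^ 2 /
      (m * (7 - 30 * δ) * σ ^ 2)) = 10 ^ 7 * ((Nr + μ) * B) / (m * (7 - 30 * δ) * σ ^ 2) := by
    rw [hB]; ring
  rw [e1, e2]
  refine div_le_div_of_nonneg_right ?_ (by positivity)
  have h1 : 0 ≤ Nr * B := by positivity
  have h2 : 0 ≤ μ * B := by positivity
  have h3 : 748800 * (7 - 30 * δ) * (Nr * B) ≤ 748800 * 7 * (Nr * B) :=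
    mul_le_mul_of_nonneg_right (by linarith) h1
  linarith

end TT

theorem mainTheorem3 :
    ∃ c C K : ℝ, 0 < c ∧ 0 < C ∧ 0 < K ∧
    ∀ (N : ℕ) (d : Fin N → ℕ) (r : Fin (N + 1) → ℕ) (m : ℕ)
      (Xs : TT.Factors d r) (A : Fin m → TT.Tensor d) (δ : ℝ) (γ : ℝ≥0)
      (Ω : Type*) [MeasurableSpace Ω] (P : MeasureTheory.Measure Ω)
      [MeasureTheory.IsProbabilityMeasure P] (ε : Ω → Fin m → ℝ),
      2 ≤ N → r 0 = 1 → r (Fin.last N) = 1 →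
      TT.LeftOrthogonal Xs → TT.Minimal Xs →
      TT.RIP A ((N + 3) * TT.maxRank r) δ → δ ≤ 7 / 30 →
      ProbabilityTheory.HasLaw ε
        (MeasureTheory.Measure.pi fun _ : Fin m => ProbabilityTheory.gaussianReal 0 (γ ^ 2)) P →
      C * ((N : ℝ) ^ 4 * TT.maxDim d * (TT.maxRank r : ℝ) ^ 3 * Real.log N * (γ : ℝ) ^ 2 /
        TT.sigmaMin r (TT.tensor Xs) ^ 2) ≤ m →
      ∃ E : Set Ω, MeasurableSet E ∧
        1 - 2 * (N : ℝ) *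
              Real.exp (-(c * (N * TT.maxDim d * (TT.maxRank r : ℝ) ^ 2 * Real.log N)))
          - 2 * Real.exp
              (-(c * ((N : ℝ) ^ 3 * TT.maxDim d * (TT.maxRank r : ℝ) ^ 2 * Real.log N)))
          ≤ P.real E ∧
        ∀ ω ∈ E, ∀ X₀ : TT.Factors d r, TT.LeftOrthogonal X₀ →
          TT.distSq X₀ Xs ≤
            (7 - 30 * δ) * TT.sigmaMin r (TT.tensor Xs) ^ 2 /
              (8 * TT.rankSum r * (129 * (N : ℝ) ^ 2 + 7231 * N - 7360)) →
          ∀ μ : ℝ, 0 < μ → μ ≤ (7 - 30 * δ) / (20 * (9 * (N : ℝ) - 5) * (1 + δ) ^ 2) →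
          ∀ t : ℕ,
            TT.distSq
                (TT.rgd (TT.loss A fun k => TT.inner (A k) (TT.tensor Xs) + ε ω k)
                  (TT.normSq (TT.tensor Xs)) μ X₀ (t + 1)) Xs ≤
              (1 - (7 - 30 * δ) * TT.sigmaMin r (TT.tensor Xs) ^ 2 /
                  (1280 * TT.rankSum r * TT.normSq (TT.tensor Xs)) * μ) ^ (t + 1) *
                TT.distSq X₀ Xs +
              K * (((N : ℝ) + μ) * TT.rankSum r * (1 + δ) * (N : ℝ) ^ 2 * TT.maxDim d *
                  (TT.maxRank r : ℝ) ^ 2 * Real.log N * TT.normSq (TT.tensor Xs) * (γ : ℝ) ^ 2 /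
                (m * (7 - 30 * δ) * TT.sigmaMin r (TT.tensor Xs) ^ 2)) := by
  refine ⟨1, 10 ^ 8, 10 ^ 7, one_pos, by norm_num, by norm_num, ?_⟩
  intro N d r m Xs A δ γ Ω _ P _ ε h2 h0 hN hXs hm hA hδ hε hC
  have hpos : 0 < N := by omega
  have hN2 : (2 : ℝ) ≤ N := by exact_mod_cast h2
  have hlog : 0 ≤ Real.log N := Real.log_nonneg (by linarith)
  have hσ := TT.sigmaMin_pos h2 h0 hN hXs hm
  have hσM := TT.sigmaMin_sq_le h2 h0 hXs hm
  set σ := TT.sigmaMin r (TT.tensor Xs)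
  have hM : 0 < TT.normSq (TT.tensor Xs) := lt_of_lt_of_le (by positivity) hσM
  -- The isometry property at the nonzero tensor $\mathcal X^\star$ forces $\delta\ge0$, and $m>0$
  -- because the middle term would vanish otherwise.
  have hRIP := hA.isTTSum hpos
    ((TT.isTTSum_tensor Xs).mono hpos (by omega : 1 ≤ N + 3))
  have hδ0 : 0 ≤ δ := by
    by_contra! hneg
    nlinarith [hRIP.1.trans hRIP.2]
  have hm0 : (0 : ℝ) < m := by
    refine lt_of_le_of_ne (Nat.cast_nonneg _) fun h => ?_
    have h1 := hRIP.1
    rw [← h, div_zero, zero_mul] at h1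
    nlinarith
  have hr : 1 ≤ TT.maxRank r :=
    (hm.pos h0 ⟨1, by omega⟩).trans_le (TT.le_maxRank r (TT.mem_innerBonds.2 ⟨le_rfl, h2⟩))
  have hr' : (1 : ℝ) ≤ TT.maxRank r := by exact_mod_cast hr
  obtain ⟨E, hE1, hE2, hE3⟩ := TT.exists_event_noise_le_tnorm h2
    (fun i => ⟨0, hm.dim_pos h0 i⟩) hr hA (by linarith) hε
  refine ⟨E, hE1, le_trans ?_ hE2, fun ω hω X₀ hX₀ hdist μ hμ0 hμ t => ?_⟩
  · rw [one_mul, one_mul]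
    -- The event already has the probability given by the second exponential; the first is a
    -- nonnegative surplus.
    have : 0 ≤ 2 * (N : ℝ) *
        Real.exp (-(N * TT.maxDim d * (TT.maxRank r : ℝ) ^ 2 * Real.log N)) := by positivity
    linarith
  · obtain ⟨hδ', hμN⟩ := TT.step_mul_le h2 hδ0 hμ0 hμ
    have hreg : TT.Regular r A δ (ε ω) _ :=
      { delta_nonneg := hδ0
        delta_le := hδ
        zeta_nonneg := by positivity
        lower := fun T hT => by
          rw [TT.tnorm_sq, TT.bil_self]; exact (hA.isTTSum hpos hT).1
        upper := fun T hT => by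
          rw [TT.tnorm_sq, TT.bil_self]; exact (hA.isTTSum hpos hT).2
        noise_le := hE3 ω hω }
    -- The assumed lower bound for $m$ is larger than necessary by $R=N\overline r$.
    have hlevel := TT.noise_level_le (Λ := (N : ℝ) ^ 3 * TT.maxDim d * (TT.maxRank r : ℝ) ^ 2 *
      Real.log N) (R := N * TT.maxRank r) (γ := γ) (by positivity)
      (one_le_mul_of_one_le_of_one_le (by linarith) hr') hm0 hσ hδ
      (le_trans (le_of_eq (by ring)) hC)
    have hσM' : σ ≤ TT.tnorm (TT.tensor Xs) := Real.le_sqrt_of_sq_le hσM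
    refine (hreg.distSq_rgd_le h2 h0 hN hX₀ hXs hm hμ0 hμN
      (hlevel.trans (by linarith)) hδ' hdist (t + 1)).trans ?_
    refine add_le_add le_rfl ?_
    have hS := TT.rankSum_ge r
    exact TT.noise_term_le (by linarith) hμ0.le (Nat.cast_nonneg _) (by linarith) hlog hM.le hm0 hσ
      hδ0 hδ'
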